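/- **Setting.** Let $M$ be a smooth manifold, $G$ a unimodular locally compact group acting properly and cocompactly on $M$ by diffeomorphisms, and $\varphi$ the flow of a complete, nowhere vanishing smooth vector field $u$ on $M$, with every $\varphi_t$ $G$-equivariant. Let $F\to M$ be a $G$-equivariant complex vector bundle with a flat, $G$-invariant connection $\nabla^F$. Let $g\in G$ and let $Z<G$ be the centraliser of $g$. For $x\in G$ put $$L_x(\varphi)=\{l\in\mathbb R\setminus\{0\} : \exists m\in M,\ \varphi_l(m)=xm\},$$ and for $l\in L_x(\varphi)$ let $\Gamma^x_l(\varphi)$ be the set of flow curves $\gamma$ with $\gamma(l)=x\gamma(0)$, modulo time shifts. For such $\gamma$, let $P^x_\gamma$ be the endomorphism of $T_{\gamma(0)}M/\mathbb R u(\gamma(0))$ induced by $T_{\gamma(0)}(\varphi_l\circ x^{-1})$, and let $\rho_x(\gamma)\in\mathrm{End}(F_{\gamma(0)})$ be parallel transport along $\gamma$ from $F_{\gamma(0)}$ to $F_{\gamma(-l)}$, followed by $x\colon F_{\gamma(-l)}\to F_{\gamma(0)}$. Assume that $L_g(\varphi)$ is countable and that $\varphi$ is $g$-nondegenerate: $\det(P^g_\gamma-1)\neq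 0$ for all $l\in L_g(\varphi)$, $\gamma\in\Gamma^g_l(\varphi)$. Fix a Haar measure on $G$ and a $G$-invariant Radon measure $d(hZ)\ne0$ on $G/Z$, which is assumed to exist. A cutoff function for $G$ is a $\chi\in C_c^\infty(M)$, real-valued, with $\int_G\chi(xm)\,dx=1$ for all $m\in M$. Put $T_\gamma=\int_{I_\gamma}\chi(\gamma(s))\,ds$, where $I_\gamma\subset\mathbb R$ is an interval that $\gamma$ maps bijectively to its image. For $\sigma\in\mathbb C$, the equivariant Ruelle zeta function $R^g(\sigma)=e^{\log R^g(\sigma)}$ is defined by $$2\log R^g(\sigma)=\int_{G/Z}\ \sum_{l\in L_g(\varphi)}\frac{e^{-|l|\sigma}}{|l|}\sum_{\gamma\in\Gamma_l^{hgh^{-1}}(\varphi)}\operatorname{sgn}\bigl(\det(1-P_\gamma^{hgh^{-1}})\bigr)\operatorname{tr}\bigl(\rho_{hgh^{-1}}(\gamma)\bigr)\,T_\gamma\ d(hZ).\qquad(*)$$ It converges absolutely if the integral over $G/Z$ of the double sum of the absolute values of all terms is finite. **Lemma.** Let $H<G$ be a closed, cocompact, unimodular subgroup with $g\in H$. Let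 $Z_H=Z\cap H$, and suppose that $H/Z_H$ has a nonzero $H$-invariant Radon measure; fix one, and a Haar measure on $H$. Let $\log R^{g,H}$ and $R^{g,H}$ be defined by $(*)$ for the action by $H$ on $M$. Give $Z/Z_H$ the measure compatible with the Haar measures on $G$ and $H$ and the given measures on $G/Z$ and $H/Z_H$ (that is, Weil's formula $\int_A f=\int_{A/B}\int_B f$ holds for $(A,B)=(G,Z)$, $(H,Z_H)$ and $(Z,Z_H)$, with suitable Haar measures on $Z$ and $Z_H$), and suppose that $\mathrm{vol}(Z/Z_H)<\infty$. 1. For every $\sigma\in\mathbb C$ and all cutoff functions used for $G$ and $H$, $(*)$ for $G$ converges absolutely if and only if $(*)$ for $H$ does. In that case $$R^{g,H}(\sigma)=R^g(\sigma)^{\mathrm{vol}(Z/Z_H)},$$ where the power means $\exp\bigl(\mathrm{vol}(Z/Z_H)\log R^g(\sigma)\bigr)$; more precisely $\log R^{g,H}(\sigma)=\mathrm{vol}(Z/Z_H)\log R^g(\sigma)$. 2. If $G$ is compact, then the same is true with absolute convergence replaced by convergence, where the sums over $l\in L_g(\varphi)$ are taken along any fixed increasing sequence $L_1\subset L_2\subset\cdots$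 of finite sets with union $L_g(\varphi)$, the same for $G$ and $H$, and where convergence has either of the following meanings: (a) the constant cutoff functions $1/\mathrm{vol}(G)$ and $1/\mathrm{vol}(H)$ are used, and in $(*)$ the sum over $l$ converges for almost every $hZ$, to an integrable function; (b) arbitrary cutoff functions are used, and the expressions obtained from $(*)$ by restricting the sum to $l\in L_n$ converge as $n\to\infty$; the limit is then the value of $2\log R^g(\sigma)$, respectively $2\log R^{g,H}(\sigma)$. -/

import Mathlib

open MeasureTheory Filter Topology Bundle
open scoped Manifold ContDiff

noncomputable section

namespace Ruelle

/-! ### Flows -/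

section Flow

variable {E : Type*} [NormedAddCommGroup E] [NormedSpace ℝ E]
  {M : Type*} [TopologicalSpace M] [ChartedSpace E M]

/-- `φ` is a smooth one-parameter group of diffeomorphisms of `M`, i.e. the flow of a smooth
vector field that is defined for all time. The vector field is `generator φ`. -/
structure IsSmoothFlow (E : Type*) [NormedAddCommGroup E] [NormedSpace ℝ E]
    {M : Type*} [TopologicalSpace M] [ChartedSpace E M] (φ : ℝ → M → M) : Prop where
  contMDiff : ContMDiff (𝓘(ℝ, ℝ).prod 𝓘(ℝ, E)) 𝓘(ℝ, E) ∞ (fun p : ℝ × M => φ p.1 p.2)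
  map_zero : ∀ m, φ 0 m = m
  map_add : ∀ s t m, φ (s + t) m = φ s (φ t m)

/-- The velocity `γ'(t)` of a curve in `M`. -/
def velocity (E : Type*) [NormedAddCommGroup E] [NormedSpace ℝ E]
    {M : Type*} [TopologicalSpace M] [ChartedSpace E M] (γ : ℝ → M) (t : ℝ) :
    TangentSpace 𝓘(ℝ, E) (γ t) :=
  mfderiv 𝓘(ℝ, ℝ) 𝓘(ℝ, E) γ t (1 : ℝ)

/-- The vector field `u` that generates `φ`. (As `φ 0 m = m`, the velocity at time `0` is a tangent
vector at `m`.) -/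
def generator (E : Type*) [NormedAddCommGroup E] [NormedSpace ℝ E]
    {M : Type*} [TopologicalSpace M] [ChartedSpace E M] (φ : ℝ → M → M) (m : M) :
    TangentSpace 𝓘(ℝ, E) m :=
  velocity E (fun t => φ t m) 0

/-- `γ` is a flow curve of `φ`. -/
def IsFlowCurve (φ : ℝ → M → M) (γ : ℝ → M) : Prop :=
  ∀ t, γ t = φ t (γ 0)

variable {G : Type*} [Group G] [MulAction G M]

/-- The `x`-delocalised length spectrum of `φ`. -/
def lengthSpectrum (φ : ℝ → M → M) (x : G) : Set ℝ :=
  {l | l ≠ 0 ∧ ∃ m, φ l m = x • m}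

/-- The set of `(x, l)`-periodic flow curves of `φ`. -/
def PeriodicCurve (φ : ℝ → M → M) (x : G) (l : ℝ) : Type _ :=
  {γ : ℝ → M // IsFlowCurve φ γ ∧ γ l = x • γ 0}

/-- Two periodic flow curves are in the same orbit of the action of `ℝ` by time shifts. -/
instance periodicCurveSetoid (φ : ℝ → M → M) (x : G) (l : ℝ) : Setoid (PeriodicCurve φ x l) where
  r γ₁ γ₂ := ∃ s : ℝ, ∀ t, γ₂.1 t = γ₁.1 (t + s)
  iseqv :=
    { refl := fun γ => ⟨0, fun t => by simp⟩
      symm := fun {_ _} ⟨s, hs⟩ => ⟨-s, fun t => by simp [hs]⟩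
      trans := fun {_ _ _} ⟨s, hs⟩ ⟨r, hr⟩ =>
        ⟨r + s, fun t => by rw [hr, hs, add_assoc]⟩ }

/-- The set of `(x, l)`-periodic flow curves modulo time shifts. -/
def CurveClass (φ : ℝ → M → M) (x : G) (l : ℝ) : Type _ :=
  Quotient (periodicCurveSetoid φ x l)

/-- A representative of a class of periodic flow curves. -/
def CurveClass.rep {φ : ℝ → M → M} {x : G} {l : ℝ} (c : CurveClass φ x l) :
    PeriodicCurve φ x l :=
  Quotient.out c

/-- An interval that a flow curve `γ` maps bijectively to its image: a half-open interval whose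
length is the smallest positive period of `γ` if `γ` is periodic, the real line otherwise. -/
def fundamentalInterval (γ : ℝ → M) : Set ℝ :=
  open Classical in
  if ∃ T > 0, γ T = γ 0 then Set.Ico 0 (sInf {T : ℝ | 0 < T ∧ γ T = γ 0}) else Set.univ

/-- The `χ`-primitive period of a flow curve. -/
def primitivePeriod (χ : M → ℝ) (γ : ℝ → M) : ℝ :=
  ∫ s in fundamentalInterval γ, χ (γ s)

/-- The linearised `x`-delocalised Poincaré map: the endomorphism of `T_m M / ℝ u(m)` induced by
`T_m (φ_l ∘ x⁻¹)`, for a point `m` with `φ_l(m) = x m`. For such `m` the map `φ_l ∘ x⁻¹` fixes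
`m`, and its derivative fixes `u(m)` if `φ` is an equivariant flow, so that the first alternative
applies. -/
def poincareMap (E : Type*) [NormedAddCommGroup E] [NormedSpace ℝ E]
    {M : Type*} [TopologicalSpace M] [ChartedSpace E M]
    {G : Type*} [Group G] [MulAction G M] (φ : ℝ → M → M) (x : G) (l : ℝ) (m : M) :
    (TangentSpace 𝓘(ℝ, E) m ⧸ Submodule.span ℝ {generator E φ m}) →ₗ[ℝ]
      (TangentSpace 𝓘(ℝ, E) m ⧸ Submodule.span ℝ {generator E φ m}) :=
  let T : TangentSpace 𝓘(ℝ, E) m →ₗ[ℝ] TangentSpace 𝓘(ℝ, E) m :=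
    (mfderiv 𝓘(ℝ, E) 𝓘(ℝ, E) (fun p : M => φ l (x⁻¹ • p)) m).toLinearMap
  open Classical in
  if h : Submodule.span ℝ {generator E φ m} ≤ (Submodule.span ℝ {generator E φ m}).comap T then
    Submodule.mapQ _ _ T h
  else 0

/-- The flow `φ` is `g`-nondegenerate. -/
def Nondegenerate (E : Type*) [NormedAddCommGroup E] [NormedSpace ℝ E]
    {M : Type*} [TopologicalSpace M] [ChartedSpace E M]
    {G : Type*} [Group G] [MulAction G M] (φ : ℝ → M → M) (g : G) : Prop :=
  ∀ (l : ℝ) (m : M), l ≠ 0 → φ l m = g • m → LinearMap.det (poincareMap E φ g l m - 1) ≠ 0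

/-- `χ` is a smooth, compactly supported cutoff function for the action of `G` on `M`, with respect
to the Haar measure `μ` on `G`. -/
structure IsCutoff (E : Type*) [NormedAddCommGroup E] [NormedSpace ℝ E]
    {M : Type*} [TopologicalSpace M] [ChartedSpace E M]
    {G : Type*} [Group G] [MulAction G M] [MeasurableSpace G] (μ : Measure G) (χ : M → ℝ) :
    Prop where
  contMDiff : ContMDiff 𝓘(ℝ, E) 𝓘(ℝ, ℝ) ∞ χ
  hasCompactSupport : HasCompactSupport χ
  integral_eq_one : ∀ m, ∫ x : G, χ (x • m) ∂μ = 1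

end Flow

/-! ### Flat equivariant complex vector bundles

A complex vector bundle `V` over `M` with typical fibre `W` is described by Mathlib's bundle
classes; its smooth structure is that of the underlying real vector bundle. -/

section Bundles

variable {E : Type*} [NormedAddCommGroup E] [NormedSpace ℝ E]
  {M : Type*} [TopologicalSpace M] [ChartedSpace E M]
  {W : Type*} [NormedAddCommGroup W] [NormedSpace ℂ W]
  {V : M → Type*} [TopologicalSpace (TotalSpace W V)]
  [∀ m, AddCommGroup (V m)] [∀ m, Module ℂ (V m)] [∀ m, TopologicalSpace (V m)]
  [∀ m, IsTopologicalAddGroup (V m)] [∀ m, ContinuousSMul ℝ (V m)]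
  [FiberBundle W V]

/-- The section `S` of `V` is smooth at `m`. -/
def SmoothSectionAt (E : Type*) [NormedAddCommGroup E] [NormedSpace ℝ E]
    {M : Type*} [TopologicalSpace M] [ChartedSpace E M]
    (W : Type*) [NormedAddCommGroup W] [NormedSpace ℂ W]
    {V : M → Type*} [TopologicalSpace (TotalSpace W V)] [∀ m, TopologicalSpace (V m)]
    [FiberBundle W V] (S : ∀ m, V m) (m : M) : Prop :=
  ContMDiffAt 𝓘(ℝ, E) (𝓘(ℝ, E).prod 𝓘(ℝ, W)) ∞ (fun p => (⟨p, S p⟩ : TotalSpace W V)) m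

/-- `D` is a flat, complex linear connection: near every point there is a smooth complex frame of
parallel sections (equivalently, the curvature of `D` is zero). -/
structure IsFlat (D : CovariantDerivative 𝓘(ℝ, E) W V) : Prop where
  smul_I : ∀ (S : ∀ m, V m) (m : M), SmoothSectionAt E W S m → ∀ v : TangentSpace 𝓘(ℝ, E) m,
    D (fun p => Complex.I • S p) m v = Complex.I • D S m v
  exists_frame : ∀ m : M, ∃ U ∈ 𝓝 m, ∃ e : Fin (Module.finrank ℂ W) → ∀ p, V p,
    ∀ p ∈ U, (∀ i, SmoothSectionAt E W (e i) p ∧ D (e i) p = 0) ∧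
      LinearIndependent ℂ (fun i => e i p) ∧ Submodule.span ℂ (Set.range fun i => e i p) = ⊤

/-- The section `s` of `V` along the curve `γ` is parallel: locally `s(t) = S(γ(t))` for a smooth
local section `S` of `V` with `D_{γ'(t)} S = 0`. This is used for curves with nowhere vanishing
velocity; every smooth section along such a curve has such local extensions. -/
def IsParallelAlong (D : CovariantDerivative 𝓘(ℝ, E) W V) (γ : ℝ → M) (s : ∀ t, V (γ t)) : Prop :=
  ∀ t₀ : ℝ, ∃ S : ∀ m, V m, SmoothSectionAt E W S (γ t₀) ∧
    ∀ᶠ t in 𝓝 t₀, s t = S (γ t) ∧ D S (γ t) (velocity E γ t) = 0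

/-- The parallel transport map along `γ` from `V_{γ(a)}` to `V_{γ(b)}`: it maps `s(a)` to `s(b)`
for all parallel sections `s` along `γ`. -/
def parallelTransport (D : CovariantDerivative 𝓘(ℝ, E) W V) (γ : ℝ → M) (a b : ℝ) :
    V (γ a) →ₗ[ℂ] V (γ b) :=
  open Classical in
  if h : ∃ T : V (γ a) →ₗ[ℂ] V (γ b),
      ∀ v, ∃ s : ∀ t, V (γ t), IsParallelAlong D γ s ∧ s a = v ∧ s b = T v then
    h.choose
  else 0

/-- A lift of the action of `G` on `M` to the vector bundle `V`, by fibrewise complex linear maps,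
continuous, and smooth for every element of `G`. -/
structure BundleAction (E : Type*) [NormedAddCommGroup E] [NormedSpace ℝ E]
    {M : Type*} [TopologicalSpace M] [ChartedSpace E M]
    (G : Type*) [Group G] [TopologicalSpace G] [MulAction G M]
    (W : Type*) [NormedAddCommGroup W] [NormedSpace ℂ W]
    (V : M → Type*) [TopologicalSpace (TotalSpace W V)]
    [∀ m, AddCommGroup (V m)] [∀ m, Module ℂ (V m)] [∀ m, TopologicalSpace (V m)]
    [FiberBundle W V] where
  /-- The map from the fibre at `m` to the fibre at `x • m`. -/
  act : ∀ (x : G) (m : M), V m →ₗ[ℂ] V (x • m)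
  one_act : ∀ (m : M) (v : V m), (⟨(1 : G) • m, act 1 m v⟩ : TotalSpace W V) = ⟨m, v⟩
  mul_act : ∀ (x y : G) (m : M) (v : V m),
    (⟨(x * y) • m, act (x * y) m v⟩ : TotalSpace W V) = ⟨x • y • m, act x (y • m) (act y m v)⟩
  continuous_act : Continuous fun q : G × TotalSpace W V =>
    (⟨q.1 • q.2.proj, act q.1 q.2.proj q.2.snd⟩ : TotalSpace W V)
  contMDiff_act : ∀ x : G, ContMDiff (𝓘(ℝ, E).prod 𝓘(ℝ, W)) (𝓘(ℝ, E).prod 𝓘(ℝ, W)) ∞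
    fun q : TotalSpace W V => (⟨x • q.proj, act x q.proj q.snd⟩ : TotalSpace W V)

variable {G : Type*} [Group G] [TopologicalSpace G] [MulAction G M]

/-- The restriction of the action of `G` on `V` to a subgroup. -/
def BundleAction.restrict (A : BundleAction E G W V) (H : Subgroup G) : BundleAction E H W V where
  act x m := A.act (x : G) m
  one_act m v := A.one_act m v
  mul_act x y m v := A.mul_act (x : G) (y : G) m v
  continuous_act := A.continuous_act.comp (continuous_subtype_val.prodMap continuous_id)
  contMDiff_act x := A.contMDiff_act (x : G)

/-- The connection `D` is `G`-invariant: if `S' = x · S`, then `D S' = x · D S`. -/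
def IsInvariantConnection (A : BundleAction E G W V) (D : CovariantDerivative 𝓘(ℝ, E) W V) :
    Prop :=
  ∀ (x : G) (S S' : ∀ m, V m), (∀ p, S' (x • p) = A.act x p (S p)) →
    ∀ m, SmoothSectionAt E W S m → ∀ v : TangentSpace 𝓘(ℝ, E) m,
      D S' (x • m) (mfderiv 𝓘(ℝ, E) 𝓘(ℝ, E) (fun p : M => x • p) m v) = A.act x m (D S m v)

/-- The identification of the fibres of `V` over equal points. -/
def fibreCast (V : M → Type*) [∀ m, AddCommGroup (V m)] [∀ m, Module ℂ (V m)] {m m' : M}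
    (h : m = m') : V m →ₗ[ℂ] V m' :=
  h ▸ LinearMap.id

/-- The map `ρ_x(γ)`: parallel transport from `γ(0)` to `γ(-l)` along `γ`, followed by the action
of `x` from the fibre at `γ(-l)` to the fibre at `x γ(-l) = γ(0)`. The last equality holds if `φ` is
an equivariant flow. -/
def holonomy (A : BundleAction E G W V) (D : CovariantDerivative 𝓘(ℝ, E) W V)
    (x : G) (l : ℝ) (γ : ℝ → M) : V (γ 0) →ₗ[ℂ] V (γ 0) :=
  open Classical in
  if h : x • γ (-l) = γ 0 then
    fibreCast V h ∘ₗ A.act x (γ (-l)) ∘ₗ parallelTransport D γ 0 (-l)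
  else 0

/-! ### The equivariant Ruelle zeta function -/

/-- The contribution `sgn(det(1 - P_γ)) tr(ρ_x(γ)) T_γ` of a class of periodic flow curves. -/
def curveTerm (A : BundleAction E G W V) (D : CovariantDerivative 𝓘(ℝ, E) W V)
    (φ : ℝ → M → M) (χ : M → ℝ) (x : G) (l : ℝ) (c : CurveClass φ x l) : ℂ :=
  (Real.sign (LinearMap.det (1 - poincareMap E φ x l (c.rep.1 0))) : ℂ) *
    LinearMap.trace ℂ (V (c.rep.1 0)) (holonomy A D x l c.rep.1) *
    (primitivePeriod χ c.rep.1 : ℂ)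

/-- The factor `e^{-|l|σ} / |l|`. -/
def lengthFactor (σ : ℂ) (l : ℝ) : ℂ :=
  Complex.exp (-(|l| : ℝ) * σ) / (|l| : ℝ)

/-- The contribution of the length `l` to the integrand at the group element `x = h g h⁻¹`. -/
def lengthTerm (A : BundleAction E G W V) (D : CovariantDerivative 𝓘(ℝ, E) W V)
    (φ : ℝ → M → M) (χ : M → ℝ) (σ : ℂ) (x : G) (l : ℝ) : ℂ :=
  lengthFactor σ l * ∑' c : CurveClass φ x l, curveTerm A D φ χ x l c

/-- The conjugate `h g h⁻¹` of `g` determined by the coset `hZ`, where `Z` is the centraliser of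
`g`. -/
def cosetConj (g : G) (c : G ⧸ Subgroup.centralizer ({g} : Set G)) : G :=
  c.out * g * c.out⁻¹

/-- The expression that defines `2 log R^g(σ)` converges absolutely. -/
def AbsConverges (A : BundleAction E G W V) (D : CovariantDerivative 𝓘(ℝ, E) W V)
    (φ : ℝ → M → M) (g : G) [MeasurableSpace (G ⧸ Subgroup.centralizer ({g} : Set G))]
    (ν : Measure (G ⧸ Subgroup.centralizer ({g} : Set G))) (χ : M → ℝ) (σ : ℂ) : Prop :=
  ∫⁻ c, ∑' l : lengthSpectrum φ g, ∑' γ : CurveClass φ (cosetConj g c) (l : ℝ),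
    ‖lengthFactor σ l * curveTerm A D φ χ (cosetConj g c) l γ‖ₑ ∂ν < ⊤

/-- The logarithm `log R^g(σ)`, in case of absolute convergence. -/
def logZeta (A : BundleAction E G W V) (D : CovariantDerivative 𝓘(ℝ, E) W V)
    (φ : ℝ → M → M) (g : G) [MeasurableSpace (G ⧸ Subgroup.centralizer ({g} : Set G))]
    (ν : Measure (G ⧸ Subgroup.centralizer ({g} : Set G))) (χ : M → ℝ) (σ : ℂ) : ℂ :=
  (1 / 2) * ∫ c, ∑' l : lengthSpectrum φ g, lengthTerm A D φ χ σ (cosetConj g c) l ∂ν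

/-- The equivariant Ruelle zeta function `R^g(σ)`, in case of absolute convergence. -/
def zeta (A : BundleAction E G W V) (D : CovariantDerivative 𝓘(ℝ, E) W V)
    (φ : ℝ → M → M) (g : G) [MeasurableSpace (G ⧸ Subgroup.centralizer ({g} : Set G))]
    (ν : Measure (G ⧸ Subgroup.centralizer ({g} : Set G))) (χ : M → ℝ) (σ : ℂ) : ℂ :=
  Complex.exp (logZeta A D φ g ν χ σ)

/-- `L` is an exhaustion of the length spectrum by finite sets: it fixes the order in which a sum
over the length spectrum is taken. -/
structure IsExhaustion (φ : ℝ → M → M) (g : G) (L : ℕ → Finset ℝ) : Prop where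
  monotone : Monotone L
  iUnion_eq : ⋃ n, (L n : Set ℝ) = lengthSpectrum φ g

/-- The expression that defines `2 log R^g(σ)` converges as it is written: for almost every `hZ` the
sum over the lengths, taken in the order given by `L`, converges, the sum is integrable over
`G / Z`, and the integral is `2 ℓ`, so that `ℓ` is the resulting value of `log R^g(σ)`. -/
def HasLogZeta (A : BundleAction E G W V) (D : CovariantDerivative 𝓘(ℝ, E) W V)
    (φ : ℝ → M → M) (g : G) [MeasurableSpace (G ⧸ Subgroup.centralizer ({g} : Set G))]
    (ν : Measure (G ⧸ Subgroup.centralizer ({g} : Set G))) (χ : M → ℝ) (σ : ℂ)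
    (L : ℕ → Finset ℝ) (ℓ : ℂ) : Prop :=
  ∃ F : G ⧸ Subgroup.centralizer ({g} : Set G) → ℂ, Integrable F ν ∧
    (∀ᵐ c ∂ν, (∀ l ∈ lengthSpectrum φ g, Summable (curveTerm A D φ χ (cosetConj g c) l)) ∧
      Tendsto (fun n => ∑ l ∈ L n, lengthTerm A D φ χ σ (cosetConj g c) l) atTop (𝓝 (F c))) ∧
    2 * ℓ = ∫ c, F c ∂ν

/-- The expression that defines `2 log R^g(σ)` converges as a limit of truncations: its truncations
to the finite sets `L n` of lengths are well-defined, and converge to `2 ℓ`, so that `ℓ` is the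
resulting value of `log R^g(σ)`. -/
def HasTruncatedLogZeta (A : BundleAction E G W V) (D : CovariantDerivative 𝓘(ℝ, E) W V)
    (φ : ℝ → M → M) (g : G) [MeasurableSpace (G ⧸ Subgroup.centralizer ({g} : Set G))]
    (ν : Measure (G ⧸ Subgroup.centralizer ({g} : Set G))) (χ : M → ℝ) (σ : ℂ)
    (L : ℕ → Finset ℝ) (ℓ : ℂ) : Prop :=
  (∀ l ∈ lengthSpectrum φ g,
    (∀ᵐ c ∂ν, Summable (curveTerm A D φ χ (cosetConj g c) l)) ∧
      Integrable (fun c => lengthTerm A D φ χ σ (cosetConj g c) l) ν) ∧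
  Tendsto (fun n => ∫ c, ∑ l ∈ L n, lengthTerm A D φ χ σ (cosetConj g c) l ∂ν) atTop (𝓝 (2 * ℓ))

end Bundles

/-! ### Invariant measures on quotients -/

section Weil

/-- The measures `α` on a group `A`, `β` on a closed subgroup, and `ν` on the quotient of `A` by
this subgroup are compatible: `∫_A f(a) da = ∫_{A/K} ∫_K f(ab) db d(aK)` for all continuous,
compactly supported functions `f` on `A`. Here the closed subgroup `K` is given as the image of a
map `ι : B → A`. -/
def CompatibleMeasures {A B : Type*} [Group A] [TopologicalSpace A] [MeasurableSpace A]
    [MeasurableSpace B] (K : Subgroup A) [MeasurableSpace (A ⧸ K)] (ι : B → A)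
    (α : Measure A) (β : Measure B) (ν : Measure (A ⧸ K)) : Prop :=
  ∀ f : A → ℝ, Continuous f → HasCompactSupport f →
    ∫ a, f a ∂α = ∫ c : A ⧸ K, ∫ b, f (c.out * ι b) ∂β ∂ν

/-- The inclusion of the centraliser of `g` in the subgroup `H` into the centraliser of `g` in
`G`. -/
def centralizerInclusion {G : Type*} [Group G] (H : Subgroup G) (g : H)
    (z : Subgroup.centralizer ({g} : Set H)) : Subgroup.centralizer ({(g : G)} : Set G) :=
  ⟨((z : H) : G), by
    have h := Subgroup.mem_centralizer_singleton_iff.1 z.2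
    exact Subgroup.mem_centralizer_singleton_iff.2 (congrArg Subtype.val h)⟩

end Weil

end Ruelle

end

set_option linter.unusedSectionVars false

namespace Ruelle

open scoped Pointwise

/-! ### Haar measures and quotients -/

section Weil

/-! Write $Z$ for the centraliser of $g$ in $G$. Translation by $h^{-1}$ identifies the flow curves
that are periodic for $hgh^{-1}$ with those that are periodic for $g$, so the sums on all cosets
$hZ$ can be indexed by the same set: the pairs $i$ of a length $l$ and a flow orbit on which
$\varphi_l=g$. Let $\eta_i$ be Lebesgue measure along such an orbit, pushed to $M$. The sign of the
determinant and the trace of the holonomy are invariant under conjugation by elements of $G$ and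
under time shifts, so the integrand at $hZ$ becomes $\sum_i w_i\int_M\chi(hm)\,d\eta_i(m)$, where
$w_i$ does not depend on $h$ and is constant on $Z$-classes of orbits (`curveTerm_eq`,
`OrbitIndex.weight_congr`).

For weights $u_i\ge0$ that are constant on classes, the measure $\eta=\sum_i u_i\eta_i$ is
$Z$-invariant. Let $p\ge0$ be a function whose averages over $Z$ equal one. Inserting such an
average and applying Weil's formula gives $$\int_{G/Z}\int_M f(hm)\,d\eta\,d(hZ)=\int_M p(m)\int_G
f(am)\,da\,d\eta(m)$$ (`lintegral_quotient_lintegral_smul`). For $f=\chi$ the inner integral on the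
right is one, which leaves $\int p\,d\eta$: the cutoff function has disappeared. For $f=|\chi|$ it
is bounded, because the action is cocompact. Thus absolute convergence amounts to finiteness of
$\int p\,d\eta$ for $u_i=|w_i|$, and the value of the integral is $\sum_i w_i\int p\,d\eta_i$
(`zeta_terms`). As $\chi$ may change sign, the necessity of this condition uses that each $Z$-class
of orbits contributes a finite amount to $\int p\,d\eta$. That holds because $g\in Z$ shifts the
orbit by time $l$, so that the orbit is compact modulo $Z$.

For $H$ the orbits, the measures and the weights are the same, and only $p$ is replaced by a
function $q$ normalised over $Z_H=Z\cap H$. As $\int_Z q(zm)\,dz=\mathrm{vol}(Z/Z_H)$, symmetry of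
averaging against the $Z$-invariant $\eta$ gives $\int q\,d\eta=\mathrm{vol}(Z/Z_H)\int p\,d\eta$
(`lintegral_cutoffSum_subgroup`). This proves the first part. Nondegeneracy enters through
`eventually_mem_orbit_of_fixed`: orbits of a given length are isolated, hence countable in number,
with locally finite measures.

If $G$ is compact, then so is $M$, and each length has finitely many orbits. The identity then holds
for every single length, so the partial sums for $G$ and $H$ are proportional. For constant cutoff
functions the integrand does not depend on the coset at all, which reduces convergence for almost
every $hZ$ to convergence of one sequence. -/

theorem t2Space_quotient {A : Type*} [Group A] [TopologicalSpace A] [IsTopologicalGroup A]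
    {K : Subgroup A} (hK : IsClosed (K : Set A)) : T2Space (A ⧸ K) := by
  have hq : IsOpenQuotientMap (fun a : A => (a : A ⧸ K)) := QuotientGroup.isOpenQuotientMap_mk
  rw [t2Space_iff_of_isOpenQuotientMap hq]
  have : {q : A × A | (q.1 : A ⧸ K) = q.2} = (fun q : A × A => q.1⁻¹ * q.2) ⁻¹' K := by
    ext q
    exact QuotientGroup.eq
  rw [this]
  exact hK.preimage (by fun_prop)

variable {A B : Type*} [Group A] [TopologicalSpace A] [IsTopologicalGroup A] [MeasurableSpace A]
  [BorelSpace A] [Group B] [TopologicalSpace B] [IsTopologicalGroup B] [MeasurableSpace B]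
  [BorelSpace B] {K : Subgroup A} [MeasurableSpace (A ⧸ K)] {ι : B →* A}
  {α : Measure A} {β : Measure B} {ν : Measure (A ⧸ K)}

/-- A closed subgroup of a unimodular group is unimodular if the quotient has a compatible
measure. -/
theorem CompatibleMeasures.isMulRightInvariant [LocallyCompactSpace A] [LocallyCompactSpace B]
    [α.IsHaarMeasure] [α.IsMulRightInvariant] [β.IsHaarMeasure] [β.Regular]
    (hc : CompatibleMeasures K ι α β ν) : β.IsMulRightInvariant := by
  refine ⟨fun b₀ => ?_⟩
  have hreg : (β.map (· * b₀)).Regular := Measure.Regular.map (Homeomorph.mulRight b₀)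
  have hsmul := Measure.isMulLeftInvariant_eq_smul_of_regular (β.map (· * b₀)) β
  set c := Measure.haarScalarFactor (β.map (· * b₀)) β
  obtain ⟨f, hf, hf0, hf1⟩ := exists_continuous_nonneg_pos (1 : A)
  have hpos : 0 < ∫ a, f a ∂α :=
    f.continuous.integral_pos_of_hasCompactSupport_nonneg_nonzero hf hf0 hf1
  -- Right translation by `ι b₀` preserves `α`, while in Weil's formula it multiplies every inner
  -- integral by the modular factor `c`.
  have key : ∫ a, f a ∂α = c * ∫ a, f a ∂α := by
    conv_lhs => rw [← integral_mul_right_eq_self (μ := α) f (ι b₀)]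
    rw [hc (fun a => f (a * ι b₀)) (by fun_prop) (hf.comp_homeomorph (Homeomorph.mulRight (ι b₀))),
      hc f f.continuous hf, ← integral_const_mul]
    refine integral_congr_ae (Eventually.of_forall fun d => ?_)
    have h1 : ∫ b, f (d.out * ι b * ι b₀) ∂β = ∫ b, f (d.out * ι b) ∂(β.map (· * b₀)) := by
      refine Eq.trans ?_ ((Homeomorph.mulRight b₀).isClosedEmbedding.integral_map
        (fun b => f (d.out * ι b))).symm
      simp [mul_assoc]
    simp only [h1, hsmul, integral_smul_nnreal_measure]
    rfl
  have hc1 : c = 1 := by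
    have : (c : ℝ) = 1 := by
      field_simp at key
      nlinarith
    exact_mod_cast this
  rw [hsmul, hc1, one_smul]

/-- A regular Haar measure on a unimodular group is invariant under inversion. -/
theorem isInvInvariant_of_isMulRightInvariant [LocallyCompactSpace B]
    [β.IsHaarMeasure] [β.Regular] [β.IsMulRightInvariant] : β.IsInvInvariant := by
  constructor
  let c : ENNReal := Measure.haarScalarFactor β.inv β
  have hreg : β.inv.Regular := Measure.Regular.map (Homeomorph.inv B)
  have hc : β.inv = c • β := Measure.isMulLeftInvariant_eq_smul_of_regular β.inv β
  -- Inverting twice is the identity, which forces `c ^ 2 = 1`.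
  have h2 : Measure.map Inv.inv (Measure.map Inv.inv β) = c ^ 2 • β := by
    rw [← Measure.inv_def β, hc, Measure.map_smul, ← Measure.inv_def β, hc, smul_smul, pow_two]
  have μeq : β = c ^ 2 • β := by
    rw [Measure.map_map continuous_inv.measurable continuous_inv.measurable] at h2
    simpa only [inv_involutive, Function.Involutive.comp_self, Measure.map_id] using h2
  have K : TopologicalSpace.PositiveCompacts B := Classical.arbitrary _
  have h3 : c ^ 2 * β K = 1 ^ 2 * β K := by
    conv_rhs => rw [μeq]
    simp
  have h4 : c ^ 2 = 1 ^ 2 :=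
    (ENNReal.mul_left_inj (Measure.measure_pos_of_nonempty_interior _ K.interior_nonempty).ne'
          K.isCompact.measure_lt_top.ne).1 h3
  have h5 : c = 1 := (ENNReal.pow_right_strictMono two_ne_zero).injective h4
  rw [hc, h5, one_smul]

/-- Averages of a continuous, compactly supported function over a closed subgroup are
continuous. -/
theorem continuous_integral_mul_subgroup [LocallyCompactSpace A] [IsFiniteMeasureOnCompacts β]
    (hι : IsClosedEmbedding ι) {f : A → ℝ} (hf : Continuous f) (hfs : HasCompactSupport f) :
    Continuous fun a => ∫ b, f (a * ι b) ∂β := by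
  rw [continuous_iff_continuousAt]
  intro a₀
  obtain ⟨N, hN, haN⟩ := exists_compact_mem_nhds a₀
  have hk : IsCompact (ι ⁻¹' ((N⁻¹ : Set A) * tsupport f)) :=
    hι.isCompact_preimage (hN.inv.mul hfs.isCompact)
  refine ((continuousOn_integral_of_compact_support (f := fun a b => f (a * ι b)) (s := N) hk
    ?_ ?_).continuousAt haN)
  · have := hι.continuous
    exact Continuous.continuousOn (by simp only [Function.uncurry_def]; fun_prop)
  · intro a b ha hb
    by_contra h
    refine hb ⟨a⁻¹, Set.inv_mem_inv.2 ha, a * ι b, subset_tsupport _ h, by simp⟩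

variable [BorelSpace (A ⧸ K)]

/-- The average of a continuous, compactly supported function over a subgroup, as a function on the
quotient. -/
theorem CompatibleMeasures.quotient_average [LocallyCompactSpace A] [β.IsMulLeftInvariant]
    [IsFiniteMeasureOnCompacts β] (hι : IsClosedEmbedding ι) (hK : ι.range = K) {f : A → ℝ}
    (hf : Continuous f) (hfs : HasCompactSupport f) :
    Continuous (fun c : A ⧸ K => ∫ b, f (c.out * ι b) ∂β) ∧
      HasCompactSupport (fun c : A ⧸ K => ∫ b, f (c.out * ι b) ∂β) ∧
      ∀ a : A, ∫ b, f ((a : A ⧸ K).out * ι b) ∂β = ∫ b, f (a * ι b) ∂β := by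
  -- Left invariance of `β` makes the average independent of the representative `out`.
  have hmk : ∀ a : A, ∫ b, f ((a : A ⧸ K).out * ι b) ∂β = ∫ b, f (a * ι b) ∂β := by
    intro a
    obtain ⟨k, hk⟩ := QuotientGroup.mk_out_eq_mul K a
    have hkK : (k : A) ∈ ι.range := hK ▸ k.2
    obtain ⟨b₀, hb₀⟩ := hkK
    rw [hk, ← hb₀]
    simp only [mul_assoc, ← map_mul]
    exact integral_mul_left_eq_self (μ := β) (fun b => f (a * ι b)) b₀
  refine ⟨?_, ?_, hmk⟩
  · rw [(QuotientGroup.isQuotientMap_mk (N := K)).continuous_iff]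
    convert continuous_integral_mul_subgroup (β := β) hι hf hfs using 2 with a
    exact hmk a
  · have := t2Space_quotient (hK ▸ hι.isClosed_range : IsClosed (K : Set A))
    refine HasCompactSupport.of_support_subset_isCompact
      (hfs.isCompact.image (QuotientGroup.continuous_mk (N := K))) ?_
    intro c hc
    by_contra h
    refine hc ?_
    refine integral_eq_zero_of_ae (Eventually.of_forall fun b => ?_)
    by_contra hb
    refine h ⟨_, subset_tsupport _ hb, ?_⟩
    rw [QuotientGroup.mk_mul_of_mem _ (hK ▸ ⟨b, rfl⟩ : ι b ∈ K)]
    exact Quotient.out_eq c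

/-- Weil's formula for Lebesgue integrals of continuous, compactly supported functions. -/
theorem CompatibleMeasures.lintegral_eq [LocallyCompactSpace A] [IsFiniteMeasureOnCompacts α]
    [β.IsMulLeftInvariant]
    [IsFiniteMeasureOnCompacts β] [IsFiniteMeasureOnCompacts ν]
    (hc : CompatibleMeasures K ι α β ν) (hι : IsClosedEmbedding ι) (hK : ι.range = K) {f : A → ℝ}
    (hf : Continuous f) (hfs : HasCompactSupport f) (hf0 : ∀ a, 0 ≤ f a) :
    Continuous (fun c : A ⧸ K => ∫⁻ b, ENNReal.ofReal (f (c.out * ι b)) ∂β) ∧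
    (∀ a : A, ∫⁻ b, ENNReal.ofReal (f ((a : A ⧸ K).out * ι b)) ∂β =
      ∫⁻ b, ENNReal.ofReal (f (a * ι b)) ∂β) ∧
    ∫⁻ a, ENNReal.ofReal (f a) ∂α = ∫⁻ c : A ⧸ K, ∫⁻ b, ENNReal.ofReal (f (c.out * ι b)) ∂β ∂ν := by
  obtain ⟨h1, h2, h3⟩ := CompatibleMeasures.quotient_average (β := β) hι hK hf hfs
  have hint : ∀ a, ∫⁻ b, ENNReal.ofReal (f (a * ι b)) ∂β
      = ENNReal.ofReal (∫ b, f (a * ι b) ∂β) := by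
    intro a
    rw [ofReal_integral_eq_lintegral_ofReal]
    · refine Continuous.integrable_of_hasCompactSupport
        (hf.comp (continuous_const.mul hι.continuous)) ?_
      exact (hfs.comp_homeomorph (Homeomorph.mulLeft a)).comp_isClosedEmbedding hι
    · exact Eventually.of_forall fun b => hf0 _
  simp only [hint]
  refine ⟨ENNReal.continuous_ofReal.comp h1, fun a => by rw [h3], ?_⟩
  rw [← ofReal_integral_eq_lintegral_ofReal (hf.integrable_of_hasCompactSupport hfs)
    (Eventually.of_forall hf0), hc f hf hfs, ofReal_integral_eq_lintegral_ofReal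
    (h1.integrable_of_hasCompactSupport h2)]
  exact Eventually.of_forall fun c => integral_nonneg fun b => hf0 _

end Weil


/-! ### Averages over proper actions, and cutoff sequences -/

section Proper

variable {B M : Type*} [Group B] [TopologicalSpace B] [TopologicalSpace M] [MulAction B M]

/-- Projection to `B` of the preimage of `S ×ˢ L` under the proper map `(b, m) ↦ (b • m, m)`. It
provides the common compact support that makes averages over `B` continuous in the point. -/
theorem isCompact_setOf_smul_mem [ProperSMul B M] {S L : Set M} (hS : IsCompact S)
    (hL : IsCompact L) : IsCompact {b : B | ∃ m ∈ L, b • m ∈ S} := by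
  have h := (ProperSMul.isProperMap_smul_pair (G := B) (X := M)).isCompact_preimage (hS.prod hL)
  convert h.image continuous_fst
  ext b
  constructor
  · rintro ⟨m, hm, hb⟩
    exact ⟨(b, m), ⟨hb, hm⟩, rfl⟩
  · rintro ⟨⟨b', m⟩, ⟨h1, h2⟩, rfl⟩
    exact ⟨m, h2, h1⟩

/-- A compact exhaustion of `M` pulls back along an orbit map to one of `B`. Haar measures on `B`
are then σ-finite, as Tonelli's theorem requires. -/
theorem sigmaCompactSpace_of_properSMul [ProperSMul B M] [SigmaCompactSpace M] [Nonempty M] :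
    SigmaCompactSpace B := by
  obtain ⟨m⟩ := ‹Nonempty M›
  refine ⟨fun n => {b : B | ∃ p ∈ ({m} : Set M), b • p ∈ compactCovering M n}, fun n =>
    isCompact_setOf_smul_mem (isCompact_compactCovering M n) isCompact_singleton, ?_⟩
  rw [Set.eq_univ_iff_forall]
  intro b
  obtain ⟨n, hn⟩ := exists_mem_compactCovering (b • m)
  exact Set.mem_iUnion.2 ⟨n, m, rfl, hn⟩

theorem hasCompactSupport_smul [IsTopologicalGroup B] [T2Space B] [ProperSMul B M] {f : M → ℝ}
    (hfs : HasCompactSupport f) (m : M) : HasCompactSupport fun b : B => f (b • m) := by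
  refine HasCompactSupport.of_support_subset_isCompact
    (isCompact_setOf_smul_mem (B := B) hfs.isCompact (isCompact_singleton (x := m))) ?_
  intro b hb
  exact ⟨m, rfl, subset_tsupport _ hb⟩

theorem hasCompactSupport_inv_smul [IsTopologicalGroup B] [T2Space B] [ProperSMul B M] {f : M → ℝ}
    (hfs : HasCompactSupport f) (m : M) : HasCompactSupport fun b : B => f (b⁻¹ • m) :=
  (hasCompactSupport_smul hfs m).comp_homeomorph (Homeomorph.inv B)

variable [MeasurableSpace B] [BorelSpace B] {β : Measure B} [IsFiniteMeasureOnCompacts β]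

/-- Continuity of averages over a proper action, along a continuous family of points. -/
theorem continuous_integral_smul_comp [ProperSMul B M] [LocallyCompactSpace M] {A : Type*}
    [Group A] [TopologicalSpace A] [IsTopologicalGroup A] [MulAction A M] [ContinuousSMul A M]
    [LocallyCompactSpace A] {f : M → ℝ} (hf : Continuous f) (hfs : HasCompactSupport f) :
    Continuous fun q : A × M => ∫ b : B, f (q.1 • b • q.2) ∂β := by
  rw [continuous_iff_continuousAt]
  rintro ⟨a₀, m₀⟩
  obtain ⟨N, hN, haN⟩ := exists_compact_mem_nhds a₀
  obtain ⟨L, hL, hmL⟩ := exists_compact_mem_nhds m₀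
  have hS : IsCompact ((fun q : A × M => q.1⁻¹ • q.2) '' (N ×ˢ tsupport f)) :=
    (hN.prod hfs.isCompact).image (by fun_prop)
  refine ((continuousOn_integral_of_compact_support (f := fun (q : A × M) b => f (q.1 • b • q.2))
    (s := N ×ˢ L) (isCompact_setOf_smul_mem (B := B) hS hL) ?_ ?_).continuousAt
    (prod_mem_nhds haN hmL))
  · exact Continuous.continuousOn (by simp only [Function.uncurry_def]; fun_prop)
  · rintro ⟨a, m⟩ b ⟨ha, hm⟩ hb
    by_contra h
    exact hb ⟨m, hm, ⟨(a, a • b • m), ⟨ha, subset_tsupport _ h⟩, by simp⟩⟩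

theorem continuous_integral_smul [IsTopologicalGroup B] [ProperSMul B M] [LocallyCompactSpace M]
    [LocallyCompactSpace B]
    {f : M → ℝ} (hf : Continuous f) (hfs : HasCompactSupport f) :
    Continuous fun m : M => ∫ b : B, f (b • m) ∂β := by
  have := (continuous_integral_smul_comp (A := B) (β := β) hf hfs).comp
    (Continuous.prodMk_right (1 : B))
  simpa [Function.comp_def] using this

theorem continuous_integral_inv_smul [IsTopologicalGroup B] [ProperSMul B M]
    [LocallyCompactSpace M] {f : M → ℝ} (hf : Continuous f) (hfs : HasCompactSupport f) :
    Continuous fun m : M => ∫ b : B, f (b⁻¹ • m) ∂β := by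
  rw [continuous_iff_continuousAt]
  intro m₀
  obtain ⟨L, hL, hmL⟩ := exists_compact_mem_nhds m₀
  refine ((continuousOn_integral_of_compact_support (f := fun m (b : B) => f (b⁻¹ • m))
    (s := L) (isCompact_setOf_smul_mem (B := B) hfs.isCompact hL).inv ?_ ?_).continuousAt hmL)
  · exact Continuous.continuousOn (by simp only [Function.uncurry_def]; fun_prop)
  · intro m b hm hb
    by_contra h
    exact hb ⟨m, hm, subset_tsupport _ h⟩

/-- A sequence of nonnegative, continuous, compactly supported functions on `M`, whose averages over
`B` add up to one. -/
structure IsCutoffSequence (β : Measure B) (p : ℕ → M → ℝ) : Prop where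
  continuous : ∀ n, Continuous (p n)
  hasCompactSupport : ∀ n, HasCompactSupport (p n)
  nonneg : ∀ n m, 0 ≤ p n m
  tsum_eq_one : ∀ m, ∑' n, ∫⁻ b : B, ENNReal.ofReal (p n (b⁻¹ • m)) ∂β = 1

/-- The quotient of `M` by `B` need not be compact, so one compactly supported function may not
suffice. Bump functions `b n` that are one on an exhaustion of `M` have `B`-invariant averages `F
n`, and dividing by a positive, invariant weighted sum `d` of these normalises the total average. -/
theorem exists_isCutoffSequence [IsTopologicalGroup B] [T2Space B] [LocallyCompactSpace B]
    [ProperSMul B M] [LocallyCompactSpace M] [T2Space M] [SigmaCompactSpace M]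
    [β.IsMulLeftInvariant] [β.IsOpenPosMeasure] :
    ∃ p : ℕ → M → ℝ, IsCutoffSequence β p := by
  have hex : ∀ n : ℕ, ∃ b : C(M, ℝ), HasCompactSupport b ∧ (∀ m, 0 ≤ b m) ∧
      ∀ m ∈ compactCovering M n, b m = 1 := by
    intro n
    obtain ⟨b, h1, -, h2, h3⟩ := exists_continuous_one_zero_of_isCompact
      (isCompact_compactCovering M n) isClosed_empty (Set.disjoint_empty _)
    exact ⟨b, h2, fun m => (h3 m).1, fun m hm => h1 hm⟩
  choose b hbs hb0 hb1 using hex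
  let F : ℕ → M → ℝ := fun n m => ∫ z : B, b n (z⁻¹ • m) ∂β
  have hFc : ∀ n, Continuous (F n) := fun n => continuous_integral_inv_smul (b n).continuous (hbs n)
  have hF0 : ∀ n m, 0 ≤ F n m := fun n m => integral_nonneg fun z => hb0 _ _
  have hFinv : ∀ n (z : B) m, F n (z⁻¹ • m) = F n m := by
    intro n z m
    simp only [F, smul_smul, ← mul_inv_rev]
    exact integral_mul_left_eq_self (μ := β) (fun y : B => b n (y⁻¹ • m)) z
  -- `F n` is invariant and vanishes on orbits that miss the support of `b n`, so its bound on that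
  -- compact support is global.
  have hbd : ∀ n, ∃ C : ℝ, 0 ≤ C ∧ ∀ m, F n m ≤ C := by
    intro n
    obtain ⟨C, hC⟩ := (hbs n).isCompact.bddAbove_image (hFc n).continuousOn
    refine ⟨max C 0, le_max_right _ _, fun m => ?_⟩
    by_cases h : ∃ z : B, b n (z⁻¹ • m) ≠ 0
    · obtain ⟨z, hz⟩ := h
      rw [← hFinv n z m]
      exact (hC ⟨_, subset_tsupport _ hz, rfl⟩).trans (le_max_left _ _)
    · push Not at h
      simp [F, h]
  choose C hC0 hC using hbd
  -- The weights ensure `ε n * F n m ≤ 2⁻ⁿ` uniformly in `m`, so that `d` is continuous.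
  let ε : ℕ → ℝ := fun n => (1 / 2) ^ n / (1 + C n)
  have hε : ∀ n, 0 < ε n := fun n => div_pos (by positivity) (by linarith [hC0 n])
  have hle : ∀ n m, ‖ε n * F n m‖ ≤ (1 / 2) ^ n := by
    intro n m
    rw [Real.norm_of_nonneg (mul_nonneg (hε n).le (hF0 n m)), div_mul_eq_mul_div, div_le_iff₀
      (by linarith [hC0 n])]
    exact mul_le_mul_of_nonneg_left (by linarith [hC n m]) (by positivity)
  have hsum : ∀ m, Summable fun n => ε n * F n m := fun m =>
    Summable.of_norm_bounded summable_geometric_two (hle · m)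
  let d : M → ℝ := fun m => ∑' n, ε n * F n m
  have hdc : Continuous d := continuous_tsum (fun n => (hFc n).const_mul _)
    summable_geometric_two hle
  have hdpos : ∀ m, 0 < d m := by
    intro m
    obtain ⟨n, hn⟩ := exists_mem_compactCovering m
    refine (hsum m).tsum_pos (fun n => mul_nonneg (hε n).le (hF0 n m)) n
      (mul_pos (hε n) ?_)
    refine Continuous.integral_pos_of_hasCompactSupport_nonneg_nonzero (x := (1 : B)) ?_
      (hasCompactSupport_inv_smul (hbs n) m) (fun z => hb0 _ _) ?_
    · fun_prop
    · simp [hb1 n m hn]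
  have hdinv : ∀ (z : B) m, d (z⁻¹ • m) = d m := fun z m => by simp only [d, hFinv]
  refine ⟨fun n m => ε n * b n m / d m, fun n => ?_, fun n => ?_, fun n m => ?_, fun m => ?_⟩
  · exact ((b n).continuous.const_mul _).div hdc fun m => (hdpos m).ne'
  · refine (hbs n).mono fun m hm h => hm ?_
    simp [h]
  · exact div_nonneg (mul_nonneg (hε n).le (hb0 n m)) (hdpos m).le
  · have h1 : ∀ n, ∫⁻ z : B, ENNReal.ofReal (ε n * b n (z⁻¹ • m) / d (z⁻¹ • m)) ∂β
        = ENNReal.ofReal (ε n * F n m / d m) := by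
      intro n
      simp only [hdinv]
      rw [← ofReal_integral_eq_lintegral_ofReal]
      · rw [integral_div, integral_const_mul]
      · exact ((Continuous.integrable_of_hasCompactSupport (by fun_prop)
          (hasCompactSupport_inv_smul (hbs n) m)).const_mul _).div_const _
      · exact Eventually.of_forall fun z =>
          div_nonneg (mul_nonneg (hε n).le (hb0 _ _)) (hdpos m).le
    simp only [h1]
    rw [← ENNReal.ofReal_tsum_of_nonneg
      (fun n => div_nonneg (mul_nonneg (hε n).le (hF0 n m)) (hdpos m).le) ((hsum m).div_const _),
      tsum_div_const, div_self (hdpos m).ne', ENNReal.ofReal_one]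

end Proper


/-! ### Unfolding integrals over quotients against invariant measures -/

section Unfolding

variable {M : Type*} [TopologicalSpace M] [MeasurableSpace M] [BorelSpace M]
  [SecondCountableTopology M] [LocallyCompactSpace M]

/-- The sum of a sequence of nonnegative functions, with values in `[0, ∞]`. -/
noncomputable def cutoffSum {M : Type*} (p : ℕ → M → ℝ) (m : M) : ENNReal := ∑' n, ENNReal.ofReal (p n m)

variable {B : Type*} [Group B] [TopologicalSpace B] [IsTopologicalGroup B] [MulAction B M]
  [MeasurableSpace B] [BorelSpace B] {β : Measure B} {p : ℕ → M → ℝ}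

theorem IsCutoffSequence.measurable_cutoffSum (hp : IsCutoffSequence β p) :
    Measurable (cutoffSum p) :=
  Measurable.tsum fun n => (hp.continuous n).measurable.ennreal_ofReal

theorem IsCutoffSequence.lintegral_cutoffSum [ContinuousSMul B M] (hp : IsCutoffSequence β p)
    (m : M) : ∫⁻ b : B, cutoffSum p (b⁻¹ • m) ∂β = 1 := by
  rw [← hp.tsum_eq_one m]
  refine lintegral_tsum fun n => ?_
  have := hp.continuous n
  exact (Continuous.measurable (by fun_prop)).ennreal_ofReal.aemeasurable

/-- Averaging over a group of symmetries of a measure is symmetric. -/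
theorem lintegral_mul_lintegral_inv_smul [ContinuousSMul B M] [SFinite β] {η : Measure M}
    [SFinite η] (hη : ∀ b : B, η.map (b • ·) = η) {f k : M → ENNReal} (hf : Measurable f)
    (hk : Measurable k) :
    ∫⁻ m, f m * ∫⁻ b : B, k (b⁻¹ • m) ∂β ∂η = ∫⁻ m, k m * ∫⁻ b : B, f (b • m) ∂β ∂η := by
  have hm1 : Measurable fun q : M × B => k (q.2⁻¹ • q.1) :=
    hk.comp (Continuous.measurable (by fun_prop))
  have hm2 : Measurable fun q : M × B => f (q.2 • q.1) :=
    hf.comp (Continuous.measurable (by fun_prop))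
  have h1 : ∀ m, f m * ∫⁻ b : B, k (b⁻¹ • m) ∂β = ∫⁻ b : B, f m * k (b⁻¹ • m) ∂β := fun m =>
    (lintegral_const_mul _ (hm1.comp measurable_prodMk_left)).symm
  have h2 : ∀ m, k m * ∫⁻ b : B, f (b • m) ∂β = ∫⁻ b : B, k m * f (b • m) ∂β := fun m =>
    (lintegral_const_mul _ (hm2.comp measurable_prodMk_left)).symm
  simp only [h1, h2]
  rw [lintegral_lintegral_swap (f := fun m (b : B) => f m * k (b⁻¹ • m))
      ((hf.comp measurable_fst).mul hm1).aemeasurable,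
    lintegral_lintegral_swap (f := fun m (b : B) => k m * f (b • m))
      ((hk.comp measurable_fst).mul hm2).aemeasurable]
  refine lintegral_congr fun b => ?_
  have hb : Measurable fun m : M => b • m := (continuous_const_smul b).measurable
  have hb' : Measurable fun m : M => b⁻¹ • m := (continuous_const_smul b⁻¹).measurable
  -- For fixed `b`, the substitution `m ↦ b • m` preserves `η` and moves `b` from `k` to `f`.
  conv_lhs => rw [← hη b]
  refine (lintegral_map (hf.mul (hk.comp hb')) hb).trans ?_
  simp [mul_comm]

/-- The integral of a cutoff function is finite if the group orbits in the support of the measure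
uniformly meet a set of finite measure. -/
theorem IsCutoffSequence.lintegral_cutoffSum_lt_top [ContinuousSMul B M] [SFinite β]
    {η : Measure M} [SFinite η] (hη : ∀ b : B, η.map (b • ·) = η) (hp : IsCutoffSequence β p)
    {f : M → ENNReal} (hf : Measurable f) (hfint : ∫⁻ m, f m ∂η ≠ ⊤) {δ : ENNReal} (hδ : δ ≠ 0)
    (hle : ∀ᵐ m ∂η, δ ≤ ∫⁻ b : B, f (b • m) ∂β) : ∫⁻ m, cutoffSum p m ∂η < ⊤ := by
  have h1 : (∫⁻ m, cutoffSum p m ∂η) * δ ≤ ∫⁻ m, f m ∂η := by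
    calc (∫⁻ m, cutoffSum p m ∂η) * δ = ∫⁻ m, cutoffSum p m * δ ∂η :=
          (lintegral_mul_const _ hp.measurable_cutoffSum).symm
      _ ≤ ∫⁻ m, cutoffSum p m * ∫⁻ b : B, f (b • m) ∂β ∂η :=
          lintegral_mono_ae (hle.mono fun m hm => mul_le_mul_right hm _)
      _ = ∫⁻ m, f m * ∫⁻ b : B, cutoffSum p (b⁻¹ • m) ∂β ∂η :=
          (lintegral_mul_lintegral_inv_smul hη hf hp.measurable_cutoffSum).symm
      _ = ∫⁻ m, f m ∂η := by simp [hp.lintegral_cutoffSum]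
  by_contra h
  rw [not_lt, top_le_iff] at h
  rw [h, ENNReal.top_mul hδ, top_le_iff] at h1
  exact hfint h1

/-- Unfolding: the integral over `A / K` of the translates of a function on `M`, integrated against
a `K`-invariant measure. -/
theorem lintegral_quotient_lintegral_smul {A : Type*} [Group A] [TopologicalSpace A]
    [IsTopologicalGroup A] [T2Space A] [LocallyCompactSpace A] [MeasurableSpace A] [BorelSpace A]
    [MulAction A M] [ProperSMul A M] {K : Subgroup A} (hK : IsClosed (K : Set A))
    [MeasurableSpace (A ⧸ K)] [BorelSpace (A ⧸ K)] {α : Measure A} {β : Measure K}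
    {ν : Measure (A ⧸ K)} [IsFiniteMeasureOnCompacts α] [β.IsMulLeftInvariant]
    [IsFiniteMeasureOnCompacts β] [IsFiniteMeasureOnCompacts ν] [SFinite β] [SFinite ν]
    (hc : CompatibleMeasures K (fun k : K => (k : A)) α β ν) {η : Measure M} [SFinite η]
    (hη : ∀ k : K, η.map ((k : A) • ·) = η) {p : ℕ → M → ℝ} (hp : IsCutoffSequence β p)
    {f : M → ℝ} (hf : Continuous f) (hfs : HasCompactSupport f) (hf0 : ∀ m, 0 ≤ f m) :
    ∫⁻ c : A ⧸ K, ∫⁻ m, ENNReal.ofReal (f (c.out • m)) ∂η ∂ν =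
      ∫⁻ m, cutoffSum p m * ∫⁻ a : A, ENNReal.ofReal (f (a • m)) ∂α ∂η := by
  have hι : IsClosedEmbedding K.subtype := hK.isClosedEmbedding_subtypeVal
  have hmeas : ∀ c : A ⧸ K, Measurable fun m => ENNReal.ofReal (f (c.out • m)) := fun c =>
    (Continuous.measurable (by fun_prop)).ennreal_ofReal
  -- Insert the average of `cutoffSum p` over `K`, which is one, and move the averaging to the
  -- translate of `f`.
  have h1 : ∀ c : A ⧸ K, ∫⁻ m, ENNReal.ofReal (f (c.out • m)) ∂η =
      ∫⁻ m, cutoffSum p m * ∫⁻ k : K, ENNReal.ofReal (f (c.out • k • m)) ∂β ∂η := by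
    intro c
    have := lintegral_mul_lintegral_inv_smul (β := β) hη (hmeas c) hp.measurable_cutoffSum
    simp only [hp.lintegral_cutoffSum, mul_one] at this
    exact this
  have hw := fun m : M => CompatibleMeasures.lintegral_eq (β := β) hc hι (Subgroup.range_subtype K)
    (f := fun a => f (a • m)) (by fun_prop) (hasCompactSupport_smul hfs m) fun a => hf0 _
  -- Joint continuity gives the measurability for Tonelli. It is checked on `A × M`, which maps to
  -- `(A ⧸ K) × M` by an open quotient map.
  have hYc : Continuous fun q : (A ⧸ K) × M =>
      ∫⁻ k : K, ENNReal.ofReal (f ((q.1.out * (k : A)) • q.2)) ∂β := by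
    have hq : IsOpenQuotientMap (Prod.map (fun a : A => (a : A ⧸ K)) (id : M → M)) :=
      QuotientGroup.isOpenQuotientMap_mk.prodMap .id
    rw [← hq.continuous_comp_iff]
    have : Continuous fun q : A × M => ∫ k : K, f (q.1 • k • q.2) ∂β := by
      have := properSMul_of_isClosedEmbedding (X := M) K.subtype hι fun _ _ => rfl
      exact continuous_integral_smul_comp hf hfs
    refine (ENNReal.continuous_ofReal.comp this).congr fun q => Eq.symm ?_
    have h2 := (hw q.2).2.1 q.1
    refine h2.trans ?_
    rw [Function.comp_apply, ofReal_integral_eq_lintegral_ofReal]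
    · simp only [mul_smul]
      rfl
    · refine Continuous.integrable_of_hasCompactSupport (by fun_prop) ?_
      have := properSMul_of_isClosedEmbedding (X := M) K.subtype hι fun _ _ => rfl
      exact hasCompactSupport_smul (f := fun m => f (q.1 • m))
        (hfs.comp_homeomorph (Homeomorph.smul q.1)) q.2
    · exact Eventually.of_forall fun k => hf0 _
  simp only [h1]
  rw [lintegral_lintegral_swap]
  · refine lintegral_congr fun m => ?_
    rw [lintegral_const_mul, (hw m).2.2]
    · simp only [mul_smul]
      rfl
    · convert (hYc.comp (Continuous.prodMk_left m)).measurable using 2 with c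
      simp only [Function.comp_apply, mul_smul]
      rfl
  · have hY : Measurable fun q : (A ⧸ K) × M =>
        ∫⁻ k : K, ENNReal.ofReal (f (q.1.out • k • q.2)) ∂β := by
      convert hYc.measurable using 4 with q
      rw [mul_smul]
      rfl
    exact ((hp.measurable_cutoffSum.comp measurable_snd).mul hY).aemeasurable

/-- The integrals of cutoff functions for a group and a subgroup differ by the volume of the
quotient. -/
theorem lintegral_cutoffSum_subgroup {A : Type*} [Group A] [TopologicalSpace A]
    [IsTopologicalGroup A] [T2Space A] [LocallyCompactSpace A] [MeasurableSpace A] [BorelSpace A]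
    [MulAction A M] [ProperSMul A M] {K : Subgroup A}
    [MeasurableSpace (A ⧸ K)] [BorelSpace (A ⧸ K)] {α : Measure A}
    {ν : Measure (A ⧸ K)} [IsFiniteMeasureOnCompacts α] [β.IsMulLeftInvariant]
    [IsFiniteMeasureOnCompacts β] [IsFiniteMeasureOnCompacts ν] [SFinite α] [α.IsInvInvariant]
    {ι : B →* A} (hι : IsClosedEmbedding ι) (hK : ι.range = K)
    (hact : ∀ (b : B) (m : M), ι b • m = b • m) (hc : CompatibleMeasures K ι α β ν)
    {η : Measure M} [SFinite η] (hη : ∀ a : A, η.map (a • ·) = η) {p q : ℕ → M → ℝ}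
    (hp : IsCutoffSequence α p) (hq : IsCutoffSequence β q) :
    ∫⁻ m, cutoffSum q m ∂η = ν Set.univ * ∫⁻ m, cutoffSum p m ∂η := by
  -- After inversion in `A`, Weil's formula has inner integral one, by the normalisation of `q` over
  -- `B`, and what remains is the volume of `A ⧸ K`.
  have h1 : ∀ m : M, ∫⁻ a : A, cutoffSum q (a • m) ∂α = ν Set.univ := by
    intro m
    have hw := fun n => CompatibleMeasures.lintegral_eq (β := β) hc hι hK
      (f := fun a => q n (a⁻¹ • m)) ((hq.continuous n).comp (by fun_prop))
      (hasCompactSupport_inv_smul (hq.hasCompactSupport n) m) fun a => hq.nonneg n _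
    rw [← lintegral_inv_eq_self (μ := α)]
    unfold cutoffSum
    rw [lintegral_tsum]
    · simp only [fun n => (hw n).2.2]
      rw [← lintegral_tsum fun n => (hw n).1.measurable.aemeasurable]
      simp only [mul_inv_rev, mul_smul, ← map_inv, hact, hq.tsum_eq_one]
      simp
    · intro n
      have := hq.continuous n
      exact (Continuous.measurable (by fun_prop)).ennreal_ofReal.aemeasurable
  have h2 := lintegral_mul_lintegral_inv_smul (β := α) hη hq.measurable_cutoffSum
    hp.measurable_cutoffSum
  simp only [hp.lintegral_cutoffSum, mul_one, h1] at h2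
  rw [h2, lintegral_mul_const _ hp.measurable_cutoffSum, mul_comm]

end Unfolding

end Ruelle

namespace Ruelle

/-! ### Fixed points of diffeomorphisms that commute with a flow -/

section Fixed

variable {E : Type*} [NormedAddCommGroup E] [NormedSpace ℝ E]
  {M : Type*} [TopologicalSpace M] [ChartedSpace E M] {φ : ℝ → M → M}

/-- The derivative of a self-map of `M`, as a linear endomorphism of the model space. -/
noncomputable def tangentMapAt (E : Type*) [NormedAddCommGroup E] [NormedSpace ℝ E] {M : Type*}
    [TopologicalSpace M] [ChartedSpace E M] (f : M → M) (p : M) : E →L[ℝ] E :=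
  mfderiv 𝓘(ℝ, E) 𝓘(ℝ, E) f p

/-- The generating vector field of a flow, with values in the model space. -/
noncomputable def generatorVec (E : Type*) [NormedAddCommGroup E] [NormedSpace ℝ E] {M : Type*}
    [TopologicalSpace M] [ChartedSpace E M] (φ : ℝ → M → M) (m : M) : E := generator E φ m

theorem tangentMapAt_comp {f g : M → M} {p : M} (hg : MDifferentiable 𝓘(ℝ, E) 𝓘(ℝ, E) g)
    (hf : MDifferentiable 𝓘(ℝ, E) 𝓘(ℝ, E) f) :
    tangentMapAt E (g ∘ f) p = tangentMapAt E g (f p) ∘L tangentMapAt E f p :=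
  mfderiv_comp p (hg (f p)) (hf p)

theorem tangentMapAt_id {p : M} : tangentMapAt E (id : M → M) p = ContinuousLinearMap.id ℝ E :=
  mfderiv_id

theorem IsSmoothFlow.mdifferentiable_curve (hφ : IsSmoothFlow E φ) (m : M) :
    MDifferentiable 𝓘(ℝ, ℝ) 𝓘(ℝ, E) fun t => φ t m :=
  (hφ.contMDiff.comp (contMDiff_id.prodMk contMDiff_const)).mdifferentiable (by simp)

theorem IsSmoothFlow.contMDiff_map (hφ : IsSmoothFlow E φ) (t : ℝ) :
    ContMDiff 𝓘(ℝ, E) 𝓘(ℝ, E) ∞ (φ t) :=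
  hφ.contMDiff.comp (contMDiff_const.prodMk contMDiff_id)

theorem IsSmoothFlow.continuous (hφ : IsSmoothFlow E φ) :
    Continuous fun p : ℝ × M => φ p.1 p.2 := hφ.contMDiff.continuous

theorem IsSmoothFlow.continuous_curve (hφ : IsSmoothFlow E φ) (m : M) :
    Continuous fun t => φ t m := hφ.continuous.comp (Continuous.prodMk_left m)

theorem IsSmoothFlow.map_neg_map (hφ : IsSmoothFlow E φ) (t : ℝ) (m : M) : φ (-t) (φ t m) = m := by
  rw [← hφ.map_add, neg_add_cancel, hφ.map_zero]

theorem IsSmoothFlow.map_map_neg (hφ : IsSmoothFlow E φ) (t : ℝ) (m : M) : φ t (φ (-t) m) = m := by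
  rw [← hφ.map_add, add_neg_cancel, hφ.map_zero]

theorem IsSmoothFlow.map_comm (hφ : IsSmoothFlow E φ) (s t : ℝ) (m : M) :
    φ t (φ s m) = φ s (φ t m) := by
  rw [← hφ.map_add, ← hφ.map_add, add_comm]

/-- A map that commutes with a flow preserves its generating vector field. -/
theorem tangentMapAt_generatorVec (hφ : IsSmoothFlow E φ) {θ : M → M}
    (hθ : MDifferentiable 𝓘(ℝ, E) 𝓘(ℝ, E) θ) (hc : ∀ t m, φ t (θ m) = θ (φ t m)) (m : M) :
    tangentMapAt E θ m (generatorVec E φ m) = generatorVec E φ (θ m) := by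
  have h1 : (mfderiv 𝓘(ℝ, ℝ) 𝓘(ℝ, E) (θ ∘ fun t => φ t m) (0 : ℝ) : ℝ →L[ℝ] E) =
      tangentMapAt E θ (φ 0 m) ∘L (mfderiv 𝓘(ℝ, ℝ) 𝓘(ℝ, E) (fun t => φ t m) (0 : ℝ) : ℝ →L[ℝ] E) :=
    mfderiv_comp (0 : ℝ) (hθ _) (hφ.mdifferentiable_curve m _)
  rw [hφ.map_zero] at h1
  have h2 : (θ ∘ fun t => φ t m) = fun t => φ t (θ m) := by
    ext t
    exact (hc t m).symm
  rw [h2] at h1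
  exact (congrArg (fun L : ℝ →L[ℝ] E => L 1) h1).symm

/-! ### Linearised Poincaré maps and isolation of periodic orbits -/

section Poincare

variable {G : Type*} [Group G] [MulAction G M]

/-- The map `φ l ∘ x⁻¹` fixes `m` and commutes with the flow, so its derivative fixes the generator
there. Hence `poincareMap` is the induced map and not the default value zero. Working in the model
space `E` allows comparison of different points of `M`. -/
theorem det_poincareMap_eq (hφ : IsSmoothFlow E φ)
    (hsmooth : ∀ x : G, ContMDiff 𝓘(ℝ, E) 𝓘(ℝ, E) ∞ (fun m : M => x • m))
    (hequiv : ∀ (t : ℝ) (x : G) (m : M), φ t (x • m) = x • φ t m) {x : G} {l : ℝ} {m : M}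
    (hm : φ l m = x • m) :
    ∃ h : Submodule.span ℝ {generatorVec E φ m} ≤ (Submodule.span ℝ {generatorVec E φ m}).comap
        (tangentMapAt E (fun p : M => φ l (x⁻¹ • p)) m).toLinearMap,
      LinearMap.det (1 - poincareMap E φ x l m) =
        LinearMap.det (1 - Submodule.mapQ (Submodule.span ℝ {generatorVec E φ m})
          (Submodule.span ℝ {generatorVec E φ m})
          (tangentMapAt E (fun p : M => φ l (x⁻¹ • p)) m).toLinearMap h) ∧
      LinearMap.det (poincareMap E φ x l m - 1) =
        LinearMap.det (Submodule.mapQ (Submodule.span ℝ {generatorVec E φ m})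
          (Submodule.span ℝ {generatorVec E φ m})
          (tangentMapAt E (fun p : M => φ l (x⁻¹ • p)) m).toLinearMap h - 1) := by
  have h : Submodule.span ℝ {generatorVec E φ m} ≤ (Submodule.span ℝ {generatorVec E φ m}).comap
        (tangentMapAt E (fun p : M => φ l (x⁻¹ • p)) m).toLinearMap := by
    rw [Submodule.span_singleton_le_iff_mem, Submodule.mem_comap]
    have h1 := tangentMapAt_generatorVec hφ (θ := fun p => φ l (x⁻¹ • p))
      (((hφ.contMDiff_map l).comp (hsmooth x⁻¹)).mdifferentiable (by simp))
      (fun t p => by rw [hφ.map_comm, hequiv]) m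
    have h2 : φ l (x⁻¹ • m) = m := by rw [hequiv, hm, inv_smul_smul]
    simp only [h2] at h1
    change tangentMapAt E (fun p : M => φ l (x⁻¹ • p)) m (generatorVec E φ m) ∈ _
    rw [h1]
    exact Submodule.mem_span_singleton_self _
  have h' : poincareMap E φ x l m = Submodule.mapQ (Submodule.span ℝ {generator E φ m})
      (Submodule.span ℝ {generator E φ m})
      (mfderiv 𝓘(ℝ, E) 𝓘(ℝ, E) (fun p : M => φ l (x⁻¹ • p)) m).toLinearMap h := by
    unfold poincareMap
    exact dif_pos h
  refine ⟨h, ?_, ?_⟩ <;> rw [h'] <;> rfl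

/-- The determinants of linearised Poincaré maps that are related by a diffeomorphism commuting
with the flow are equal. -/
theorem det_poincareMap_conj (hφ : IsSmoothFlow E φ)
    (hsmooth : ∀ x : G, ContMDiff 𝓘(ℝ, E) 𝓘(ℝ, E) ∞ (fun m : M => x • m))
    (hequiv : ∀ (t : ℝ) (x : G) (m : M), φ t (x • m) = x • φ t m) {x h : G} {l : ℝ} {m : M}
    (s : ℝ) (hm : φ l m = x • m) :
    LinearMap.det (1 - poincareMap E φ (h * x * h⁻¹) l (φ s (h • m))) =
      LinearMap.det (1 - poincareMap E φ x l m) := by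
  set m' := φ s (h • m) with hm'def
  have hm' : φ l m' = (h * x * h⁻¹) • m' := by
    rw [hm'def, hφ.map_comm, hequiv l, hm, ← hequiv s]
    simp [mul_smul]
  obtain ⟨h1, e1, -⟩ := det_poincareMap_eq hφ hsmooth hequiv hm
  obtain ⟨h2, e2, -⟩ := det_poincareMap_eq hφ hsmooth hequiv hm'
  set T := tangentMapAt E (fun p : M => φ l (x⁻¹ • p)) m with hT
  set T' := tangentMapAt E (fun p : M => φ l ((h * x * h⁻¹)⁻¹ • p)) m' with hT'
  -- `θ` commutes with the flow and conjugates the two maps whose derivatives are `T` and `T'`. Its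
  -- derivative descends to an isomorphism of the quotients by the generators.
  let θ : M → M := fun p => φ s (h • p)
  let θi : M → M := fun p => h⁻¹ • φ (-s) p
  have hθ : MDifferentiable 𝓘(ℝ, E) 𝓘(ℝ, E) θ :=
    ((hφ.contMDiff_map s).comp (hsmooth h)).mdifferentiable (by simp)
  have hθi : MDifferentiable 𝓘(ℝ, E) 𝓘(ℝ, E) θi :=
    ((hsmooth h⁻¹).comp (hφ.contMDiff_map (-s))).mdifferentiable (by simp)
  have hf : ∀ y : G, MDifferentiable 𝓘(ℝ, E) 𝓘(ℝ, E) (fun p : M => φ l (y⁻¹ • p)) := fun y =>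
    ((hφ.contMDiff_map l).comp (hsmooth y⁻¹)).mdifferentiable (by simp)
  have hli : θi ∘ θ = id := by
    ext p
    simp [θ, θi, hφ.map_neg_map]
  have hri : θ ∘ θi = id := by
    ext p
    simp [θ, θi, hφ.map_map_neg]
  have hθm : θi m' = m := congrFun hli m
  have c1 : tangentMapAt E θi m' ∘L tangentMapAt E θ m = ContinuousLinearMap.id ℝ E := by
    rw [← tangentMapAt_id (p := m), ← hli, tangentMapAt_comp hθi hθ]
  have c2 : tangentMapAt E θ m ∘L tangentMapAt E θi m' = ContinuousLinearMap.id ℝ E := by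
    rw [← tangentMapAt_id (p := m'), ← hri, tangentMapAt_comp hθ hθi, hθm]
  let e : E ≃ₗ[ℝ] E := LinearEquiv.ofLinearMap (tangentMapAt E θ m).toLinearMap
    (tangentMapAt E θi m').toLinearMap
    (LinearMap.ext fun v => congrArg (fun L : E →L[ℝ] E => L v) c2)
    (LinearMap.ext fun v => congrArg (fun L : E →L[ℝ] E => L v) c1)
  have hconj : tangentMapAt E θ m ∘L T = T' ∘L tangentMapAt E θ m := by
    have hcomp : θ ∘ (fun p : M => φ l (x⁻¹ • p)) =
        (fun p : M => φ l ((h * x * h⁻¹)⁻¹ • p)) ∘ θ := by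
      ext p
      simp only [θ, Function.comp_apply]
      rw [← hequiv s _ (h • p), hφ.map_comm s l, ← hequiv l]
      simp [mul_smul]
    have h3 := tangentMapAt_comp (p := m) hθ (hf x)
    have h4 := tangentMapAt_comp (p := m) (hf (h * x * h⁻¹)) hθ
    have h5 : φ l (x⁻¹ • m) = m := by rw [hequiv, hm, inv_smul_smul]
    rw [hcomp, h4] at h3
    simp only [h5] at h3
    exact h3.symm
  have hspan : (Submodule.span ℝ {generatorVec E φ m}).map (e : E →ₗ[ℝ] E) =
      Submodule.span ℝ {generatorVec E φ m'} := by
    rw [Submodule.map_span, Set.image_singleton]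
    congr 2
    exact tangentMapAt_generatorVec hφ hθ (fun t p => by
      simp only [θ]
      rw [hφ.map_comm, hequiv]) m
  let Q := Submodule.Quotient.equiv _ _ e hspan
  rw [e1, e2, ← LinearMap.det_conj _ Q]
  congr 1
  refine LinearMap.ext fun v => ?_
  obtain ⟨w, rfl⟩ := Q.surjective v
  obtain ⟨v, rfl⟩ := Submodule.Quotient.mk_surjective _ w
  have h6 : T' (e v) = e (T v) := congrArg (fun L : E →L[ℝ] E => L v) hconj.symm
  simp only [LinearMap.comp_apply, LinearEquiv.coe_coe, LinearEquiv.symm_apply_apply,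
    LinearMap.sub_apply, Module.End.one_apply, map_sub]
  congr 1
  change Submodule.mapQ _ _ _ h2 (Submodule.Quotient.mk (e v)) = _
  rw [Submodule.mapQ_apply, Submodule.mapQ_apply]
  change Submodule.Quotient.mk (T' (e v)) = Submodule.Quotient.mk (e (T v))
  rw [h6]

/-- Nondegeneracy, in terms of the derivative of `φ_l ∘ x⁻¹`. -/
theorem mem_span_of_tangentMapAt_sub_mem [FiniteDimensional ℝ E] (hφ : IsSmoothFlow E φ)
    (hsmooth : ∀ x : G, ContMDiff 𝓘(ℝ, E) 𝓘(ℝ, E) ∞ (fun m : M => x • m))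
    (hequiv : ∀ (t : ℝ) (x : G) (m : M), φ t (x • m) = x • φ t m) {x : G} {l : ℝ} {m : M}
    (hm : φ l m = x • m) (hdet : LinearMap.det (poincareMap E φ x l m - 1) ≠ 0) {v : E}
    (hv : tangentMapAt E (fun p : M => φ l (x⁻¹ • p)) m v - v ∈
      Submodule.span ℝ {generatorVec E φ m}) : v ∈ Submodule.span ℝ {generatorVec E φ m} := by
  obtain ⟨h1, -, e1⟩ := det_poincareMap_eq hφ hsmooth hequiv hm
  rw [e1] at hdet
  have hinj := (LinearMap.equivOfDetNeZero _ hdet).injective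
  rw [← Submodule.Quotient.mk_eq_zero]
  apply hinj
  rw [map_zero]
  change Submodule.mapQ _ _ _ h1 (Submodule.Quotient.mk v) - Submodule.Quotient.mk v = 0
  rw [Submodule.mapQ_apply, ← Submodule.Quotient.mk_sub, Submodule.Quotient.mk_eq_zero]
  exact hv

/-- Points near `m` are reached in small time from a transversal at `m`, and the flow preserves the
condition `φ l p = x • p`. By nondegeneracy the displacement of `φ l ∘ x⁻¹` has injective derivative
on the transversal, so `m` is the only such point there. The bound on `t` serves to bound the length
of a nonperiodic orbit near `m`. -/
theorem eventually_mem_orbit_of_fixed [FiniteDimensional ℝ E] [IsManifold 𝓘(ℝ, E) ∞ M]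
    (hφ : IsSmoothFlow E φ)
    (hsmooth : ∀ x : G, ContMDiff 𝓘(ℝ, E) 𝓘(ℝ, E) ∞ (fun m : M => x • m))
    (hequiv : ∀ (t : ℝ) (x : G) (m : M), φ t (x • m) = x • φ t m) {x : G} {l : ℝ} {m : M}
    (hm : φ l m = x • m) (hdet : LinearMap.det (poincareMap E φ x l m - 1) ≠ 0) :
    ∀ᶠ p in 𝓝 m, φ l p = x • p → ∃ t : ℝ, |t| < 1 ∧ p = φ t m := by
  have : CompleteSpace E := FiniteDimensional.complete ℝ E
  set κ := extChartAt 𝓘(ℝ, E) m with hκ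
  have hκm : κ.symm (κ m) = m := extChartAt_to_inv m
  have hmT : κ.target ∈ 𝓝 (κ m) := extChartAt_target_mem_nhds m
  have hmS : κ.source ∈ 𝓝 m := extChartAt_source_mem_nhds m
  have hκc : ContMDiffAt 𝓘(ℝ, E) 𝓘(ℝ, E) ∞ κ m := contMDiffAt_extChartAt
  have hκs : ContMDiffAt 𝓘(ℝ, E) 𝓘(ℝ, E) ∞ κ.symm (κ m) :=
    (contMDiffOn_extChartAt_symm m).contMDiffAt hmT
  have hκsc : ContinuousAt κ.symm (κ m) := hκs.continuousAt
  -- the flow in the chart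
  let F : ℝ × E → E := fun q => κ (φ q.1 (κ.symm q.2))
  have hFc : ContDiffAt ℝ ∞ F (0, κ m) := by
    rw [← contMDiffAt_iff_contDiffAt]
    have h1 : ContMDiffAt 𝓘(ℝ, ℝ × E) (𝓘(ℝ, ℝ).prod 𝓘(ℝ, E)) ∞
        (fun q : ℝ × E => (q.1, κ.symm q.2)) (0, κ m) :=
      contDiff_fst.contMDiff.contMDiffAt.prodMk
        (ContMDiffAt.comp (0, κ m) (g := κ.symm) hκs contDiff_snd.contMDiff.contMDiffAt)
    have h2 : ContMDiffAt 𝓘(ℝ, ℝ × E) 𝓘(ℝ, E) ∞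
        (fun q : ℝ × E => φ q.1 (κ.symm q.2)) (0, κ m) :=
      (hφ.contMDiff _).comp _ h1
    refine ContMDiffAt.comp (g := κ) (0, κ m) ?_ h2
    simpa only [hκm, hφ.map_zero] using hκc
  have hF : HasStrictFDerivAt F (fderiv ℝ F (0, κ m)) (0, κ m) :=
    hFc.hasStrictFDerivAt (by simp)
  set F' := fderiv ℝ F (0, κ m)
  have hF2 : ∀ y : E, F' (0, y) = y := by
    have h1 : HasFDerivAt (fun y => F (0, y)) (F' ∘L ContinuousLinearMap.inr ℝ ℝ E) (κ m) :=
      hF.hasFDerivAt.comp (κ m) (hasFDerivAt_prodMk_right (0 : ℝ) (κ m))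
    have h2 : HasFDerivAt (fun y => F (0, y)) (ContinuousLinearMap.id ℝ E) (κ m) := by
      refine (hasFDerivAt_id (κ m)).congr_of_eventuallyEq ?_
      filter_upwards [hmT] with y hy
      simp only [F, hφ.map_zero, κ.right_inv hy, id]
    intro y
    exact congrArg (fun L : E →L[ℝ] E => L y) (h1.unique h2)
  have hF1 : F' (1, 0) = generatorVec E φ m := by
    have h1 : HasFDerivAt (fun t => F (t, κ m)) (F' ∘L ContinuousLinearMap.inl ℝ ℝ E) 0 :=
      HasFDerivAt.comp (g := F) (f := fun t : ℝ => (t, κ m)) (0 : ℝ) hF.hasFDerivAt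
        (hasFDerivAt_prodMk_left (𝕜 := ℝ) (0 : ℝ) (κ m))
    let D : ℝ →L[ℝ] E := mfderiv 𝓘(ℝ, ℝ) 𝓘(ℝ, E) (fun t => φ t m) (0 : ℝ)
    have h3 : HasFDerivAt (fun t => F (t, κ m)) D 0 := by
      have h2 : HasFDerivWithinAt (fun t => extChartAt 𝓘(ℝ, E) (φ 0 m) (φ t m)) D
          (Set.range 𝓘(ℝ, ℝ)) 0 := (hφ.mdifferentiable_curve m 0).hasMFDerivAt.2
      rw [modelWithCornersSelf_coe, Set.range_id, hasFDerivWithinAt_univ, hφ.map_zero] at h2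
      simpa only [F, hκm] using h2
    exact congrArg (fun L : ℝ →L[ℝ] E => L 1) (h1.unique h3)
  obtain ⟨E', hE'⟩ := Submodule.exists_isCompl (Submodule.span ℝ {generatorVec E φ m})
  let j : ℝ × E' →L[ℝ] ℝ × E := (ContinuousLinearMap.id ℝ ℝ).prodMap E'.subtypeL
  let F₀ : ℝ × E' → E := fun q => F (q.1, κ m + q.2)
  have hF₀ : HasStrictFDerivAt F₀ (F' ∘L j) (0, 0) := by
    have h1 : HasStrictFDerivAt (fun q : ℝ × E' => (0, κ m) + j q) j (0, 0) :=
      j.hasStrictFDerivAt.const_add _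
    have h2 : ((0, κ m) + j (0, 0) : ℝ × E) = (0, κ m) := by
      rw [show j (0, 0) = 0 from j.map_zero, add_zero]
    have h3 := HasStrictFDerivAt.comp (g := F) (0, 0) (h2 ▸ hF) h1
    have h4 : F₀ = fun q => F ((0, κ m) + j q) := by
      ext q
      change F (q.1, κ m + q.2) = F (0 + q.1, κ m + q.2)
      rw [zero_add]
    rw [h4]
    exact h3
  -- The derivative is `(t, b) ↦ t • u + b`, with `u` the generator at `m`, and `E'` is a complement
  -- of the line spanned by `u`.
  have hsurj : (F' ∘L j).range = ⊤ := by
    rw [LinearMap.range_eq_top]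
    intro v
    have hv : v ∈ Submodule.span ℝ {generatorVec E φ m} ⊔ E' := by
      rw [hE'.sup_eq_top]
      trivial
    obtain ⟨a, ha, b, hb, rfl⟩ := Submodule.mem_sup.1 hv
    obtain ⟨t, rfl⟩ := Submodule.mem_span_singleton.1 ha
    refine ⟨(t, ⟨b, hb⟩), ?_⟩
    have h1 : ((t, b) : ℝ × E) = t • (1, 0) + (0, b) := by simp
    change F' (t, b) = _
    rw [h1, map_add, map_smul, hF1, hF2]
  have hmap := hF₀.map_nhds_eq_of_surj hsurj
  have hF₀0 : F₀ (0, 0) = κ m := by simp [F₀, F, hκm, hφ.map_zero]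
  rw [hF₀0] at hmap
  -- fixed points on a transversal
  have hfm : φ l (x⁻¹ • m) = m := by rw [hequiv, hm, inv_smul_smul]
  set f : M → M := fun p => φ l (x⁻¹ • p) with hfdef
  set T := tangentMapAt E f m with hT
  have hfd : HasFDerivAt (fun y => κ (f (κ.symm y))) T (κ m) := by
    have hfmd : MDifferentiable 𝓘(ℝ, E) 𝓘(ℝ, E) f :=
      ((hφ.contMDiff_map l).comp (hsmooth x⁻¹)).mdifferentiable (by simp)
    have h2 : HasFDerivWithinAt
        (fun y => extChartAt 𝓘(ℝ, E) (f m) (f (κ.symm y))) T (Set.range 𝓘(ℝ, E)) (κ m) :=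
      (hfmd m).hasMFDerivAt.2
    rw [modelWithCornersSelf_coe, Set.range_id, hasFDerivWithinAt_univ] at h2
    have hfm' : f m = m := hfm
    rwa [hfm'] at h2
  let k : E' → E := fun y => κ (f (κ.symm (κ m + y))) - (κ m + y)
  have hk : HasFDerivAt k ((T - ContinuousLinearMap.id ℝ E) ∘L E'.subtypeL) 0 := by
    have h1 : HasFDerivAt (fun y : E' => κ m + E'.subtypeL y) E'.subtypeL 0 :=
      E'.subtypeL.hasFDerivAt.const_add _
    have h2 : κ m + E'.subtypeL 0 = κ m := by simp
    have h3 := HasFDerivAt.comp (0 : E') (h2 ▸ hfd) h1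
    exact h3.sub h1
  have hkinj : Function.Injective ((T - ContinuousLinearMap.id ℝ E) ∘L E'.subtypeL) := by
    rw [injective_iff_map_eq_zero]
    rintro ⟨v, hv⟩ h
    have h1 : T v - v = 0 := h
    have h2 := mem_span_of_tangentMapAt_sub_mem hφ hsmooth hequiv hm hdet (v := v)
      (by change T v - v ∈ _; rw [h1]; exact Submodule.zero_mem _)
    have h3 := hE'.disjoint.le_bot ⟨h2, hv⟩
    exact Subtype.ext h3
  -- An injective linear map in finite dimension is bounded below, so the zero of `k` at the origin
  -- is isolated.
  have hkne : ∀ᶠ y in 𝓝 (0 : E'), k y = 0 → y = 0 := by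
    obtain ⟨C, -, hC⟩ := LinearMap.exists_antilipschitzWith
      ((T - ContinuousLinearMap.id ℝ E) ∘L E'.subtypeL).toLinearMap (LinearMap.ker_eq_bot.2 hkinj)
    have h1 := hk.eventually_ne (c := 0) ⟨C, hC⟩
    rw [eventually_nhdsWithin_iff] at h1
    filter_upwards [h1] with y hy hy0
    by_contra hne
    exact hy hne hy0
  have hcont0 : ContinuousAt (fun q : ℝ × E' => κ m + (q.2 : E)) (0, 0) := by fun_prop
  have ht0 : Tendsto (fun q : ℝ × E' => κ m + (q.2 : E)) (𝓝 (0, 0)) (𝓝 (κ m)) := by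
    simpa using hcont0.tendsto
  have hflow : Tendsto (fun q : ℝ × E' => φ q.1 (κ.symm (κ m + q.2))) (𝓝 (0, 0)) (𝓝 m) := by
    have h1 : Tendsto (fun q : ℝ × E' => (q.1, κ.symm (κ m + q.2))) (𝓝 (0, 0)) (𝓝 (0, m)) := by
      refine Tendsto.prodMk_nhds continuousAt_fst ?_
      have := hκsc.tendsto.comp ht0
      rwa [hκm] at this
    have h2 := (hφ.continuous.tendsto (0, m)).comp h1
    simp only [hφ.map_zero] at h2
    exact h2
  -- `F₀` maps this neighbourhood onto a neighbourhood of `κ m`, so every `p` near `m` flows from a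
  -- point of the transversal to which `hkne` applies.
  have hS : {q : ℝ × E' | |q.1| < 1 ∧ (k q.2 = 0 → q.2 = 0) ∧ κ m + q.2 ∈ κ.target ∧
      φ q.1 (κ.symm (κ m + q.2)) ∈ κ.source} ∈ 𝓝 ((0, 0) : ℝ × E') := by
    have h1 : ∀ᶠ q : ℝ × E' in 𝓝 (0, 0), |q.1| < 1 :=
      (continuous_fst.abs.tendsto ((0, 0) : ℝ × E')).eventually
        (gt_mem_nhds (by simp : |((0, 0) : ℝ × E').1| < 1))
    have h2 : ∀ᶠ q : ℝ × E' in 𝓝 (0, 0), k q.2 = 0 → q.2 = 0 :=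
      (continuous_snd.tendsto ((0, 0) : ℝ × E')).eventually hkne
    filter_upwards [h1, h2, ht0.eventually hmT, hflow.eventually hmS] with q a b c d
    exact ⟨a, b, c, d⟩
  have himg := image_mem_map (m := F₀) hS
  rw [hmap] at himg
  filter_upwards [hκc.continuousAt.tendsto.eventually himg, hmS] with p hp hps hpx
  obtain ⟨⟨t, y'⟩, ⟨h1, h2, h3, h4⟩, h5⟩ := hp
  simp only at h1 h2 h3 h4
  set y := κ.symm (κ m + y') with hy
  have hpy : p = φ t y := κ.injOn hps h4 h5.symm
  have hfy : f y = y := by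
    have h6 : y = φ (-t) p := by rw [hpy, hφ.map_neg_map]
    simp only [hfdef]
    rw [h6, ← hequiv, hφ.map_comm, hequiv, hpx, inv_smul_smul]
  have hky : k y' = 0 := by
    simp only [k, ← hy, hfy]
    rw [hy, κ.right_inv h3, sub_self]
  refine ⟨t, h1, ?_⟩
  rw [hpy, hy, h2 hky]
  simp [hκm]

end Poincare

end Fixed

/-! ### Flat sections -/

section FlatSections

variable {E : Type*} [NormedAddCommGroup E] [NormedSpace ℝ E]
  {M : Type*} [TopologicalSpace M] [ChartedSpace E M] [IsManifold 𝓘(ℝ, E) ∞ M]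
  {W : Type*} [NormedAddCommGroup W] [NormedSpace ℂ W] [FiniteDimensional ℂ W]
  {V : M → Type*} [TopologicalSpace (TotalSpace W V)]
  [∀ m, AddCommGroup (V m)] [∀ m, Module ℂ (V m)] [∀ m, TopologicalSpace (V m)]
  [∀ m, IsTopologicalAddGroup (V m)] [∀ m, ContinuousSMul ℝ (V m)]
  [FiberBundle W V] [VectorBundle ℂ W V] [VectorBundle ℝ W V]
  [ContMDiffVectorBundle ∞ W V 𝓘(ℝ, E)]
  {D : CovariantDerivative 𝓘(ℝ, E) W V}

theorem SmoothSectionAt.contMDiffAt {S : ∀ m, V m} {p : M} (h : SmoothSectionAt E W S p) :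
    ContMDiffAt 𝓘(ℝ, E) (𝓘(ℝ, E).prod 𝓘(ℝ, W)) ∞ (fun p => (⟨p, S p⟩ : TotalSpace W V)) p := h

theorem SmoothSectionAt.mdifferentiableAt {S : ∀ m, V m} {p : M} (h : SmoothSectionAt E W S p) :
    MDifferentiableAt 𝓘(ℝ, E) (𝓘(ℝ, E).prod 𝓘(ℝ, W)) (fun p => (⟨p, S p⟩ : TotalSpace W V)) p :=
  h.contMDiffAt.mdifferentiableAt (by simp)

theorem SmoothSectionAt.add {S S' : ∀ m, V m} {p : M} (h : SmoothSectionAt E W S p)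
    (h' : SmoothSectionAt E W S' p) : SmoothSectionAt E W (S + S') p :=
  ContMDiffAt.add_section h h'

theorem SmoothSectionAt.smul {S : ∀ m, V m} {p : M} (h : SmoothSectionAt E W S p) (a : ℝ) :
    SmoothSectionAt E W (a • S) p :=
  ContMDiffAt.const_smul_section (a := a) h

theorem SmoothSectionAt.smul_I {S : ∀ m, V m} {p : M} (h : SmoothSectionAt E W S p) :
    SmoothSectionAt E W (fun q => Complex.I • S q) p := by
  have h1 := (contMDiffAt_section p).1 h.contMDiffAt
  refine (contMDiffAt_section p).2 ?_
  let L : W →L[ℝ] W := (Complex.I • ContinuousLinearMap.id ℂ W).restrictScalars ℝ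
  refine (L.contDiff.contMDiff.contMDiffAt.comp p h1).congr_of_eventuallyEq ?_
  filter_upwards [(trivializationAt W V p).open_baseSet.mem_nhds
    (mem_baseSet_trivializationAt W V p)] with q hq
  exact ((trivializationAt W V p).linear ℂ hq).map_smul Complex.I (S q)

variable (D) in
/-- The section `S` is smooth and parallel in a neighbourhood of `p`. -/
def IsFlatSectionNear (S : ∀ m, V m) (p : M) : Prop :=
  ∀ᶠ q in 𝓝 p, SmoothSectionAt E W S q ∧ D S q = 0

theorem covariantDerivative_add {S S' : ∀ m, V m} {p : M} (h : SmoothSectionAt E W S p)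
    (h' : SmoothSectionAt E W S' p) : D (S + S') p = D S p + D S' p :=
  D.isCovariantDerivativeOnUniv.add h.mdifferentiableAt h'.mdifferentiableAt

theorem covariantDerivative_smul {S : ∀ m, V m} {p : M} (h : SmoothSectionAt E W S p) (a : ℝ) :
    D (a • S) p = a • D S p :=
  D.isCovariantDerivativeOnUniv.smul_const a h.mdifferentiableAt

theorem IsFlatSectionNear.add {S S' : ∀ m, V m} {p : M} (h : IsFlatSectionNear D S p)
    (h' : IsFlatSectionNear D S' p) : IsFlatSectionNear D (S + S') p := by
  filter_upwards [h, h'] with q hq hq'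
  refine ⟨hq.1.add hq'.1, ?_⟩
  rw [covariantDerivative_add hq.1 hq'.1, hq.2, hq'.2, add_zero]

theorem IsFlatSectionNear.real_smul {S : ∀ m, V m} {p : M} (h : IsFlatSectionNear D S p) (a : ℝ) :
    IsFlatSectionNear D (a • S) p := by
  filter_upwards [h] with q hq
  refine ⟨hq.1.smul a, ?_⟩
  rw [covariantDerivative_smul hq.1, hq.2, smul_zero]

theorem IsFlatSectionNear.smul_I (hflat : IsFlat D) {S : ∀ m, V m} {p : M}
    (h : IsFlatSectionNear D S p) : IsFlatSectionNear D (fun q => Complex.I • S q) p := by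
  filter_upwards [h] with q hq
  refine ⟨hq.1.smul_I, ?_⟩
  ext v
  rw [hflat.smul_I S q hq.1 v, hq.2]
  simp

theorem IsFlatSectionNear.zero (p : M) : IsFlatSectionNear D (0 : ∀ m, V m) p := by
  refine Eventually.of_forall fun q => ⟨?_, ?_⟩
  · exact contMDiffAt_zeroSection (IB := 𝓘(ℝ, E)) ℝ V
  · rw [D.zero]
    rfl

theorem IsFlatSectionNear.smul (hflat : IsFlat D) {S : ∀ m, V m} {p : M}
    (h : IsFlatSectionNear D S p) (a : ℂ) : IsFlatSectionNear D (fun q => a • S q) p := by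
  convert! (h.real_smul a.re).add ((h.smul_I hflat).real_smul a.im) using 1
  ext q
  change a • S q = a.re • S q + a.im • (Complex.I • S q)
  rw [← Complex.coe_smul, ← Complex.coe_smul, smul_smul, ← add_smul, Complex.re_add_im]

theorem IsFlatSectionNear.sum {ι : Type*} (t : Finset ι) {S : ι → ∀ m, V m} {p : M}
    (h : ∀ i, IsFlatSectionNear D (S i) p) (c : ι → ℝ) :
    IsFlatSectionNear D (fun q => ∑ i ∈ t, c i • S i q) p := by
  classical
  induction t using Finset.induction_on with
  | empty =>
    simp only [Finset.sum_empty]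
    exact IsFlatSectionNear.zero p
  | insert i t hi ih =>
    simp only [Finset.sum_insert hi]
    exact ((h i).real_smul (c i)).add ih

variable (D) in
/-- A real frame of flat sections over the open set `U`. -/
structure IsFlatFrame {ι : Type*} (e : ι → ∀ m, V m) (U : Set M) : Prop where
  isOpen : IsOpen U
  smooth : ∀ q ∈ U, ∀ i, SmoothSectionAt E W (e i) q
  parallel : ∀ q ∈ U, ∀ i, D (e i) q = 0
  linearIndependent : ∀ q ∈ U, LinearIndependent ℝ fun i => e i q
  span : ∀ q ∈ U, Submodule.span ℝ (Set.range fun i => e i q) = ⊤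

theorem IsFlatFrame.isFlatSectionNear {ι : Type*} {e : ι → ∀ m, V m} {U : Set M}
    (he : IsFlatFrame D e U) {q : M} (hq : q ∈ U) (i : ι) : IsFlatSectionNear D (e i) q := by
  filter_upwards [he.isOpen.mem_nhds hq] with r hr
  exact ⟨he.smooth r hr i, he.parallel r hr i⟩

/-- The connection is a real one, so real frames are needed. A parallel complex frame `e` together
with `i e` is a parallel real frame, because `D` commutes with multiplication by `i`. -/
theorem IsFlat.exists_isFlatFrame (hflat : IsFlat D) (p : M) :
    ∃ U, p ∈ U ∧ ∃ e : Fin 2 × Fin (Module.finrank ℂ W) → ∀ m, V m, IsFlatFrame D e U := by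
  obtain ⟨U, hU, e, he⟩ := hflat.exists_frame p
  have key : ∀ q ∈ U, ∃ b : Module.Basis (Fin 2 × Fin (Module.finrank ℂ W)) ℝ (V q),
      ∀ i, b i = Complex.basisOneI i.1 • e i.2 q := by
    intro q hq
    obtain ⟨-, h1, h2⟩ := he q hq
    refine ⟨Complex.basisOneI.smulTower (Module.Basis.mk h1 h2.ge), fun i => ?_⟩
    rw [Module.Basis.smulTower_apply, Module.Basis.mk_apply]
  refine ⟨interior U, mem_interior_iff_mem_nhds.2 hU,
    fun i q => Complex.basisOneI i.1 • e i.2 q, isOpen_interior, ?_, ?_, ?_, ?_⟩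
  · intro q hq i
    have h1 := ((he q (interior_subset hq)).1 i.2).1
    obtain ⟨i, j⟩ := i
    fin_cases i
    · simpa [Complex.basisOneI] using h1
    · simpa [Complex.basisOneI] using h1.smul_I
  · intro q hq i
    have h1 := (he q (interior_subset hq)).1 i.2
    obtain ⟨i, j⟩ := i
    fin_cases i
    · simpa [Complex.basisOneI] using h1.2
    · ext v
      have := hflat.smul_I (e j) q h1.1 v
      rw [h1.2] at this
      simpa [Complex.basisOneI] using this
  · intro q hq
    obtain ⟨b, hb⟩ := key q (interior_subset hq)
    rw [← (funext hb : ⇑b = _)]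
    exact b.linearIndependent
  · intro q hq
    obtain ⟨b, hb⟩ := key q (interior_subset hq)
    rw [← (funext hb : ⇑b = _)]
    exact b.span_eq

/-- The Leibniz rule with `D (e i) = 0`. Differentiability is part of the induction because `D` is
additive only on differentiable sections. -/
theorem IsFlatFrame.covariantDerivative_sum {ι : Type*} {e : ι → ∀ m, V m} {U : Set M}
    (he : IsFlatFrame D e U) {p : M} (hp : p ∈ U) {f : ι → M → ℝ}
    (hf : ∀ i, MDifferentiableAt 𝓘(ℝ, E) 𝓘(ℝ, ℝ) (f i) p) (t : Finset ι) :
    MDifferentiableAt 𝓘(ℝ, E) (𝓘(ℝ, E).prod 𝓘(ℝ, W))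
      (fun q => (⟨q, ∑ i ∈ t, f i q • e i q⟩ : TotalSpace W V)) p ∧
    D (fun q => ∑ i ∈ t, f i q • e i q) p =
      ∑ i ∈ t, (mvfderiv 𝓘(ℝ, E) (f i) p).smulRight (e i p) := by
  classical
  induction t using Finset.induction_on with
  | empty =>
    simp only [Finset.sum_empty]
    refine ⟨(contMDiffAt_zeroSection (IB := 𝓘(ℝ, E)) (n := 1) ℝ V).mdifferentiableAt (by simp), ?_⟩
    change D 0 p = 0
    rw [D.zero]
    rfl
  | insert i t hi ih =>
    simp only [Finset.sum_insert hi]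
    have h1 := (he.smooth p hp i).mdifferentiableAt
    have h2 : MDifferentiableAt 𝓘(ℝ, E) (𝓘(ℝ, E).prod 𝓘(ℝ, W))
        (fun q => (⟨q, f i q • e i q⟩ : TotalSpace W V)) p := (hf i).smul_section h1
    refine ⟨mdifferentiableAt_add_section h2 ih.1, ?_⟩
    refine (D.isCovariantDerivativeOnUniv.add h2 ih.1).trans ?_
    rw [ih.2]
    congr 1
    refine (D.isCovariantDerivativeOnUniv.leibniz h1 (hf i)).trans ?_
    rw [he.parallel p hp i, smul_zero, zero_add]

/-- The coefficients of a smooth section in a flat frame are differentiable. -/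
theorem IsFlatFrame.exists_coeff {ι : Type*} [Fintype ι] {e : ι → ∀ m, V m} {U : Set M}
    (he : IsFlatFrame D e U) {p : M} (hp : p ∈ U) {S : ∀ m, V m} (hS : SmoothSectionAt E W S p) :
    ∃ f : ι → M → ℝ, ∀ᶠ q in 𝓝 p, (∀ i, MDifferentiableAt 𝓘(ℝ, E) 𝓘(ℝ, ℝ) (f i) q) ∧
      S q = ∑ i, f i q • e i q := by
  have : FiniteDimensional ℝ W := FiniteDimensional.complexToReal W
  have : CompleteSpace W := FiniteDimensional.complete ℝ W
  set Φ := trivializationAt W V p with hΦ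
  have hpΦ : p ∈ Φ.baseSet := mem_baseSet_trivializationAt W V p
  have hsec : ∀ {S : ∀ m, V m}, SmoothSectionAt E W S p →
      ContMDiffAt 𝓘(ℝ, E) 𝓘(ℝ, W) 1 (fun q => (Φ ⟨q, S q⟩).2) p := fun h =>
    ((contMDiffAt_section p).1 h.contMDiffAt).of_le (by simp)
  -- In a trivialisation the frame at `q` becomes a linear map `B (w q)` from coefficients to `W`.
  -- It is invertible at `p`, and inversion is smooth near invertible maps, so the coefficients of
  -- `S` depend differentiably on `q`.
  let w : M → ι → W := fun q i => (Φ ⟨q, e i q⟩).2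
  have hw : ContMDiffAt 𝓘(ℝ, E) 𝓘(ℝ, ι → W) 1 w p :=
    contMDiffAt_pi_space.2 fun i => hsec (he.smooth p hp i)
  let B : (ι → W) →L[ℝ] ((ι → ℝ) →L[ℝ] W) :=
    ∑ i, (ContinuousLinearMap.smulRightL ℝ (ι → ℝ) W (ContinuousLinearMap.proj i)) ∘L
      (ContinuousLinearMap.proj i)
  have hB : ∀ u a, B u a = ∑ i, a i • u i := by
    intro u a
    simp [B]
  have hBw : ContMDiffAt 𝓘(ℝ, E) 𝓘(ℝ, (ι → ℝ) →L[ℝ] W) 1 (fun q => B (w q)) p :=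
    B.contDiff.contMDiff.contMDiffAt.comp p hw
  have hlin : ∀ q ∈ Φ.baseSet, ∀ a : ι → ℝ, B (w q) a = (Φ ⟨q, ∑ i, a i • e i q⟩).2 := by
    intro q hq a
    rw [hB]
    have := map_sum (Φ.linearEquivAt ℝ q hq) (fun i => a i • e i q) Finset.univ
    simp only [map_smul, Trivialization.linearEquivAt_apply] at this
    exact this.symm
  let b : Module.Basis ι ℝ (V p) :=
    Module.Basis.mk (he.linearIndependent p hp) (he.span p hp).ge
  let T : (ι → ℝ) ≃L[ℝ] W :=
    (b.equivFun.symm.trans (Φ.linearEquivAt ℝ p hpΦ)).toContinuousLinearEquiv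
  have hT : (T : (ι → ℝ) →L[ℝ] W) = B (w p) := by
    ext1 a
    rw [hlin p hpΦ]
    change (Φ ⟨p, b.equivFun.symm a⟩).2 = _
    rw [Module.Basis.equivFun_symm_apply]
    simp [b]
  have hinv : ContMDiffAt 𝓘(ℝ, E) 𝓘(ℝ, W →L[ℝ] (ι → ℝ)) 1
      (fun q => (B (w q)).inverse) p := by
    have h1 : ContDiffAt ℝ 1 ContinuousLinearMap.inverse (B (w p)) :=
      hT ▸ contDiffAt_map_inverse T
    exact h1.contMDiffAt.comp p hBw
  let f : M → ι → ℝ := fun q => (B (w q)).inverse (Φ ⟨q, S q⟩).2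
  have hf : ContMDiffAt 𝓘(ℝ, E) 𝓘(ℝ, ι → ℝ) 1 f p := hinv.clm_apply (hsec hS)
  refine ⟨fun i q => f q i, ?_⟩
  have hev : ∀ᶠ q in 𝓝 p, B (w q) ∈
      Set.range ((↑) : ((ι → ℝ) ≃L[ℝ] W) → (ι → ℝ) →L[ℝ] W) :=
    hBw.continuousAt.eventually (by
      have := ContinuousLinearEquiv.nhds T
      rwa [hT] at this)
  have : IsManifold 𝓘(ℝ, E) 1 M := IsManifold.of_le (n := ∞) (by simp)
  filter_upwards [(contMDiffAt_iff_contMDiffAt_nhds (by simp)).1 hf, hev, Φ.open_baseSet.mem_nhds hpΦ] with q h1 h2 h3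
  refine ⟨fun i => (contMDiffAt_pi_space.1 h1 i).mdifferentiableAt (by simp), ?_⟩
  obtain ⟨T', hT'⟩ := h2
  have h4 : B (w q) (f q) = (Φ ⟨q, S q⟩).2 := by
    simp only [f, ← hT', ContinuousLinearMap.inverse_equiv]
    simp
  rw [hlin q h3] at h4
  exact ((Φ.linearEquivAt ℝ q h3).injective h4).symm

end FlatSections

/-! ### Parallel sections along curves -/

section ParallelSections

variable {E : Type*} [NormedAddCommGroup E] [NormedSpace ℝ E]
  {M : Type*} [TopologicalSpace M] [ChartedSpace E M] [IsManifold 𝓘(ℝ, E) ∞ M]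
  {W : Type*} [NormedAddCommGroup W] [NormedSpace ℂ W] [FiniteDimensional ℂ W]
  {V : M → Type*} [TopologicalSpace (TotalSpace W V)]
  [∀ m, AddCommGroup (V m)] [∀ m, Module ℂ (V m)] [∀ m, TopologicalSpace (V m)]
  [∀ m, IsTopologicalAddGroup (V m)] [∀ m, ContinuousSMul ℝ (V m)]
  [FiberBundle W V] [VectorBundle ℂ W V] [VectorBundle ℝ W V]
  [ContMDiffVectorBundle ∞ W V 𝓘(ℝ, E)]
  {D : CovariantDerivative 𝓘(ℝ, E) W V} {γ : ℝ → M}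

variable (D) in
/-- The section `s` along `γ` is parallel near the time `t₀`. -/
def IsParallelNear (γ : ℝ → M) (s : ∀ t, V (γ t)) (t₀ : ℝ) : Prop :=
  ∃ S : ∀ m, V m, SmoothSectionAt E W S (γ t₀) ∧
    ∀ᶠ t in 𝓝 t₀, s t = S (γ t) ∧ D S (γ t) (velocity E γ t) = 0

/-- A parallel section has constant coefficients with respect to a flat frame. -/
theorem IsParallelNear.exists_coeff (hγ : MDifferentiable 𝓘(ℝ, ℝ) 𝓘(ℝ, E) γ) {s : ∀ t, V (γ t)}
    {t₀ : ℝ} (hs : IsParallelNear D γ s t₀) {ι : Type*} [Fintype ι] {e : ι → ∀ m, V m} {U : Set M}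
    (he : IsFlatFrame D e U) (hU : γ t₀ ∈ U) :
    ∃ c : ι → ℝ, ∀ᶠ t in 𝓝 t₀, s t = ∑ i, c i • e i (γ t) := by
  obtain ⟨S, hS, hsS⟩ := hs
  obtain ⟨f, hf⟩ := he.exists_coeff hU hS
  have hc : ContinuousAt γ t₀ := (hγ t₀).continuousAt
  -- The derivative of `S` along the curve is the sum of the derivatives of the coefficients times
  -- the frame. It vanishes, and the frame is linearly independent.
  have key : ∀ᶠ t in 𝓝 t₀, (∀ i, HasDerivAt (fun t => f i (γ t)) 0 t) ∧
      s t = ∑ i, f i (γ t) • e i (γ t) := by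
    filter_upwards [hsS, hc.eventually hf.eventually_nhds,
      hc.eventually (he.isOpen.mem_nhds hU)] with t h1 h2 h3
    have h4 := h2.self_of_nhds
    refine ⟨?_, h1.1.trans h4.2⟩
    obtain ⟨h5, h6⟩ := he.covariantDerivative_sum h3 h4.1 Finset.univ
    have h7 : D S (γ t) = D (fun q => ∑ i, f i q • e i q) (γ t) := by
      have hev : ∀ᶠ q in 𝓝 (γ t), S q = ∑ i, f i q • e i q := h2.mono fun q hq => hq.2
      refine D.isCovariantDerivativeOnUniv.congr_of_eventuallyEq (h5.congr_of_eventuallyEq ?_) h5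
        univ_mem hev
      filter_upwards [hev] with q hq
      rw [hq]
    have h8 := h1.2
    rw [h7, h6] at h8
    have h9 := Fintype.linearIndependent_iff.1 (he.linearIndependent _ h3)
      (fun i => mvfderiv 𝓘(ℝ, E) (f i) (γ t) (velocity E γ t)) (by simpa using h8)
    intro i
    obtain ⟨L, hL, hL'⟩ : ∃ L : ℝ →L[ℝ] ℝ,
        HasMFDerivAt 𝓘(ℝ, ℝ) 𝓘(ℝ, ℝ) (fun t => f i (γ t)) t L ∧ L 1 = 0 :=
      ⟨_, (h4.1 i).hasMFDerivAt.comp t (hγ t).hasMFDerivAt, h9 i⟩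
    have h11 : HasFDerivAt (fun t => f i (γ t)) L t := hasMFDerivAt_iff_hasFDerivAt.1 hL
    have h12 := h11.hasDerivAt
    rwa [hL'] at h12
  obtain ⟨r, hr, hball⟩ := Metric.eventually_nhds_iff_ball.1 key
  refine ⟨fun i => f i (γ t₀), ?_⟩
  filter_upwards [Metric.ball_mem_nhds t₀ hr] with t ht
  rw [(hball t ht).2]
  refine Finset.sum_congr rfl fun i _ => ?_
  congr 1
  refine (convex_ball t₀ r).is_const_of_fderivWithin_eq_zero (𝕜 := ℝ) (f := fun t => f i (γ t))
    (fun x hx => ((hball x hx).1 i).differentiableAt.differentiableWithinAt) (fun x hx => ?_)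
    ht (Metric.mem_ball_self hr)
  rw [fderivWithin_of_isOpen Metric.isOpen_ball hx]
  have := ((hball x hx).1 i).hasFDerivAt.fderiv
  rw [this]
  ext
  simp

theorem isParallelNear_of_isFlatSectionNear (hγ : MDifferentiable 𝓘(ℝ, ℝ) 𝓘(ℝ, E) γ)
    {s : ∀ t, V (γ t)} {t₀ : ℝ} {S : ∀ m, V m} (hS : IsFlatSectionNear D S (γ t₀))
    (hs : ∀ᶠ t in 𝓝 t₀, s t = S (γ t)) : IsParallelNear D γ s t₀ := by
  refine ⟨S, hS.self_of_nhds.1, ?_⟩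
  filter_upwards [hs, (hγ t₀).continuousAt.eventually hS] with t h1 h2
  refine ⟨h1, ?_⟩
  rw [h2.2]
  rfl

/-- The extension in `IsParallelNear` is parallel only in the direction of the curve. Constant
coefficients in a flat frame give one that is parallel in all directions, and such extensions can be
added, scaled and translated by the group. -/
theorem IsParallelNear.exists_isFlatSectionNear (hflat : IsFlat D)
    (hγ : MDifferentiable 𝓘(ℝ, ℝ) 𝓘(ℝ, E) γ) {s : ∀ t, V (γ t)} {t₀ : ℝ}
    (hs : IsParallelNear D γ s t₀) :
    ∃ S : ∀ m, V m, IsFlatSectionNear D S (γ t₀) ∧ ∀ᶠ t in 𝓝 t₀, s t = S (γ t) := by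
  obtain ⟨U, hU, e, he⟩ := hflat.exists_isFlatFrame (γ t₀)
  obtain ⟨c, hc⟩ := hs.exists_coeff hγ he hU
  exact ⟨fun q => ∑ i, c i • e i q,
    IsFlatSectionNear.sum Finset.univ (fun i => he.isFlatSectionNear hU i) c, hc⟩

theorem IsParallelNear.add (hflat : IsFlat D) (hγ : MDifferentiable 𝓘(ℝ, ℝ) 𝓘(ℝ, E) γ)
    {s s' : ∀ t, V (γ t)} {t₀ : ℝ} (hs : IsParallelNear D γ s t₀)
    (hs' : IsParallelNear D γ s' t₀) : IsParallelNear D γ (s + s') t₀ := by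
  obtain ⟨S, hS, h⟩ := hs.exists_isFlatSectionNear hflat hγ
  obtain ⟨S', hS', h'⟩ := hs'.exists_isFlatSectionNear hflat hγ
  refine isParallelNear_of_isFlatSectionNear hγ (hS.add hS') ?_
  filter_upwards [h, h'] with t h1 h2
  exact congrArg₂ (· + ·) h1 h2

theorem IsParallelNear.smul (hflat : IsFlat D) (hγ : MDifferentiable 𝓘(ℝ, ℝ) 𝓘(ℝ, E) γ)
    {s : ∀ t, V (γ t)} {t₀ : ℝ} (hs : IsParallelNear D γ s t₀) (a : ℂ) :
    IsParallelNear D γ (a • s) t₀ := by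
  obtain ⟨S, hS, h⟩ := hs.exists_isFlatSectionNear hflat hγ
  refine isParallelNear_of_isFlatSectionNear hγ (hS.smul hflat a) ?_
  filter_upwards [h] with t h1
  exact congrArg (a • ·) h1

theorem IsParallelNear.congr {s s' : ∀ t, V (γ t)} {t₀ : ℝ} (hs : IsParallelNear D γ s t₀)
    (h : ∀ᶠ t in 𝓝 t₀, s' t = s t) : IsParallelNear D γ s' t₀ := by
  obtain ⟨S, hS, h'⟩ := hs
  refine ⟨S, hS, ?_⟩
  filter_upwards [h, h'] with t h1 h2
  exact ⟨h1.trans h2.1, h2.2⟩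

/-- Two parallel sections agree near a point if and only if they agree at this point. -/
theorem IsParallelNear.eventually_eq_iff (hflat : IsFlat D)
    (hγ : MDifferentiable 𝓘(ℝ, ℝ) 𝓘(ℝ, E) γ) {s s' : ∀ t, V (γ t)} {t₀ : ℝ}
    (hs : IsParallelNear D γ s t₀) (hs' : IsParallelNear D γ s' t₀) :
    ∀ᶠ t in 𝓝 t₀, s t = s' t ↔ s t₀ = s' t₀ := by
  obtain ⟨U, hU, e, he⟩ := hflat.exists_isFlatFrame (γ t₀)
  obtain ⟨c, hc⟩ := hs.exists_coeff hγ he hU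
  obtain ⟨c', hc'⟩ := hs'.exists_coeff hγ he hU
  have key : ∀ᶠ t in 𝓝 t₀, s t = s' t ↔ c = c' := by
    filter_upwards [hc, hc', (hγ t₀).continuousAt.eventually (he.isOpen.mem_nhds hU)]
      with t h1 h2 h3
    rw [h1, h2]
    refine ⟨fun h => ?_, fun h => by rw [h]⟩
    have h4 := Fintype.linearIndependent_iff.1 (he.linearIndependent _ h3)
      (fun i => c i - c' i) (by simp [sub_smul, h])
    ext i
    exact sub_eq_zero.1 (h4 i)
  filter_upwards [key] with t ht
  exact ht.trans key.self_of_nhds.symm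

/-- By `IsParallelNear.eventually_eq_iff`, agreement of two parallel sections is a locally constant
property of the time. -/
theorem eq_of_isParallelNear (hflat : IsFlat D) (hγ : MDifferentiable 𝓘(ℝ, ℝ) 𝓘(ℝ, E) γ)
    {s s' : ∀ t, V (γ t)} {I : Set ℝ} (hI : IsPreconnected I)
    (hs : ∀ t ∈ I, IsParallelNear D γ s t) (hs' : ∀ t ∈ I, IsParallelNear D γ s' t)
    {a b : ℝ} (ha : a ∈ I) (hb : b ∈ I) (hab : s a = s' a) : s b = s' b := by
  refine (hI.induction₂ (fun x y => s x = s' x ↔ s y = s' y) (fun x hx => ?_)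
    (fun x y z _ _ _ h1 h2 => h1.trans h2) (fun x y _ _ h => h.symm) ha hb).1 hab
  filter_upwards [mem_nhdsWithin_of_mem_nhds
    ((hs x hx).eventually_eq_iff hflat hγ (hs' x hx))] with t ht
  exact ht.symm

/-- Two parallel sections that agree at a time `b` can be glued. -/
theorem IsParallelNear.glue (hflat : IsFlat D) (hγ : MDifferentiable 𝓘(ℝ, ℝ) 𝓘(ℝ, E) γ)
    {s s' : ∀ t, V (γ t)} {b : ℝ} (hb : s b = s' b) {t : ℝ}
    (hs : t ≤ b → IsParallelNear D γ s t) (hs' : b ≤ t → IsParallelNear D γ s' t) :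
    IsParallelNear D γ (fun t => if t ≤ b then s t else s' t) t := by
  rcases lt_trichotomy t b with h | rfl | h
  · refine (hs h.le).congr ?_
    filter_upwards [Iio_mem_nhds h] with x hx
    rw [if_pos (le_of_lt hx)]
  · refine (hs le_rfl).congr ?_
    filter_upwards [(hs le_rfl).eventually_eq_iff hflat hγ (hs' le_rfl)] with x hx
    split_ifs
    · rfl
    · exact (hx.2 hb).symm
  · refine (hs' h.le).congr ?_
    filter_upwards [Ioi_mem_nhds h] with x hx
    rw [if_neg (not_le.2 hx)]

/-- Solvability of the initial value problem between `a` and `b`, for every starting time in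
between, is a relation that holds for nearby times by flat frames, is transitive by gluing, and is
symmetric. As `ℝ` is connected, it holds for all `a` and `b`. -/
theorem exists_isParallelNear_uIcc (hflat : IsFlat D) (hγ : MDifferentiable 𝓘(ℝ, ℝ) 𝓘(ℝ, E) γ)
    (a b c : ℝ) (hc : c ∈ Set.uIcc a b) (v : V (γ c)) : ∃ s : ∀ t, V (γ t), s c = v ∧
      ∀ t ∈ Set.uIcc a b, IsParallelNear D γ s t := by
  suffices H : ∀ c ∈ Set.uIcc a b, ∀ v : V (γ c), ∃ s : ∀ t, V (γ t), s c = v ∧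
      ∀ t ∈ Set.uIcc a b, IsParallelNear D γ s t from H c hc v
  clear hc v c
  have mono : ∀ {x y x' y' : ℝ}, Set.uIcc x y ⊆ Set.uIcc x' y' →
      (∀ c ∈ Set.uIcc x' y', ∀ v : V (γ c), ∃ s : ∀ t, V (γ t), s c = v ∧
        ∀ t ∈ Set.uIcc x' y', IsParallelNear D γ s t) →
      (∀ c ∈ Set.uIcc x y, ∀ v : V (γ c), ∃ s : ∀ t, V (γ t), s c = v ∧
        ∀ t ∈ Set.uIcc x y, IsParallelNear D γ s t) := by
    intro x y x' y' h h' c hc v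
    obtain ⟨s, hs, hs'⟩ := h' c (h hc) v
    exact ⟨s, hs, fun t ht => hs' t (h ht)⟩
  have glue : ∀ {x y z : ℝ}, x ≤ y → y ≤ z →
      (∀ c ∈ Set.uIcc x y, ∀ v : V (γ c), ∃ s : ∀ t, V (γ t), s c = v ∧
        ∀ t ∈ Set.uIcc x y, IsParallelNear D γ s t) →
      (∀ c ∈ Set.uIcc y z, ∀ v : V (γ c), ∃ s : ∀ t, V (γ t), s c = v ∧
        ∀ t ∈ Set.uIcc y z, IsParallelNear D γ s t) →
      (∀ c ∈ Set.uIcc x z, ∀ v : V (γ c), ∃ s : ∀ t, V (γ t), s c = v ∧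
        ∀ t ∈ Set.uIcc x z, IsParallelNear D γ s t) := by
    intro x y z hxy hyz h1 h2 c hc v
    rw [Set.uIcc_of_le (hxy.trans hyz)] at hc
    simp only [Set.uIcc_of_le hxy, Set.uIcc_of_le hyz, Set.uIcc_of_le (hxy.trans hyz)] at h1 h2 ⊢
    rcases le_total c y with hcy | hcy
    · obtain ⟨s, hs, hs'⟩ := h1 c ⟨hc.1, hcy⟩ v
      obtain ⟨r, hr, hr'⟩ := h2 y ⟨le_rfl, hyz⟩ (s y)
      exact ⟨_, by rw [if_pos hcy, hs], fun t ht => IsParallelNear.glue hflat hγ hr.symm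
        (fun h => hs' t ⟨ht.1, h⟩) (fun h => hr' t ⟨h, ht.2⟩)⟩
    · obtain ⟨s, hs, hs'⟩ := h2 c ⟨hcy, hc.2⟩ v
      obtain ⟨r, hr, hr'⟩ := h1 y ⟨hxy, le_rfl⟩ (s y)
      refine ⟨fun t => if t ≤ y then r t else s t, ?_,
        fun t ht => IsParallelNear.glue hflat hγ hr
        (fun h => hr' t ⟨ht.1, h⟩) (fun h => hs' t ⟨h, ht.2⟩)⟩
      rcases hcy.eq_or_lt with rfl | hlt
      · simp [hr, hs]
      · simp [not_le.2 hlt, hs]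
  refine isPreconnected_univ.induction₂ (fun a b => ∀ c ∈ Set.uIcc a b, ∀ v : V (γ c),
    ∃ s : ∀ t, V (γ t), s c = v ∧ ∀ t ∈ Set.uIcc a b, IsParallelNear D γ s t)
    (fun x _ => ?_) (fun x y z _ _ _ h1 h2 => ?_) (fun x y _ _ h => ?_)
    (Set.mem_univ a) (Set.mem_univ b)
  · obtain ⟨U, hU, e, he⟩ := hflat.exists_isFlatFrame (γ x)
    rw [nhdsWithin_univ]
    obtain ⟨r, hr, hball⟩ := Metric.eventually_nhds_iff_ball.1
      ((hγ x).continuousAt.eventually (he.isOpen.mem_nhds hU))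
    filter_upwards [Metric.ball_mem_nhds x hr] with y hy c hc v
    have hsub : Set.uIcc x y ⊆ Metric.ball x r := by
      rw [← segment_eq_uIcc]
      exact (convex_ball x r).segment_subset (Metric.mem_ball_self hr) hy
    have hUc := hball c (hsub hc)
    let b := Module.Basis.mk (he.linearIndependent _ hUc) (he.span _ hUc).ge
    refine ⟨fun t => ∑ i, b.repr v i • e i (γ t), ?_, fun t ht => ?_⟩
    · have := b.sum_repr v
      simpa [b] using this
    · exact isParallelNear_of_isFlatSectionNear hγ (IsFlatSectionNear.sum Finset.univ
        (fun i => he.isFlatSectionNear (hball t (hsub ht)) i) fun i => b.repr v i)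
        (Eventually.of_forall fun _ => rfl)
  -- If `y` lies between `x` and `z`, solutions are glued at `y`. Otherwise the interval between `x`
  -- and `z` lies in one of the two given intervals.
  · rcases le_total x y with hxy | hxy <;> rcases le_total y z with hyz | hyz
    · exact glue hxy hyz h1 h2
    · rcases le_total x z with hxz | hxz
      · exact mono (by rw [Set.uIcc_of_le hxz, Set.uIcc_of_le hxy];
                       exact Set.Icc_subset_Icc_right hyz) h1
      · exact mono (by rw [Set.uIcc_of_ge hxz, Set.uIcc_of_ge hyz];
                       exact Set.Icc_subset_Icc_right hxy) h2
    · rcases le_total x z with hxz | hxz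
      · exact mono (by rw [Set.uIcc_of_le hxz, Set.uIcc_of_le hyz];
                       exact Set.Icc_subset_Icc_left hxy) h2
      · exact mono (by rw [Set.uIcc_of_ge hxz, Set.uIcc_of_ge hxy];
                       exact Set.Icc_subset_Icc_left hyz) h1
    · simp only [Set.uIcc_comm x y, Set.uIcc_comm y z, Set.uIcc_comm x z] at h1 h2 ⊢
      exact glue hyz hxy h2 h1
  · rwa [Set.uIcc_comm]

/-- Existence of parallel sections along curves. -/
theorem exists_isParallelAlong (hflat : IsFlat D) (hγ : MDifferentiable 𝓘(ℝ, ℝ) 𝓘(ℝ, E) γ)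
    (a : ℝ) (v : V (γ a)) : ∃ s : ∀ t, V (γ t), IsParallelAlong D γ s ∧ s a = v := by
  have hmem : ∀ n : ℕ, a ∈ Set.uIcc (a - n) (a + n) := fun n => by
    rw [Set.uIcc_of_le (by linarith [n.cast_nonneg (α := ℝ)])]
    constructor <;> linarith [n.cast_nonneg (α := ℝ)]
  choose σ hσ hσ' using fun n : ℕ =>
    exists_isParallelNear_uIcc hflat hγ (a - n) (a + n) a (hmem n) v
  have hball : ∀ (n : ℕ) (t : ℝ), t ∈ Set.uIcc (a - n) (a + n) ↔ |t - a| ≤ n := by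
    intro n t
    rw [Set.uIcc_of_le (by linarith [n.cast_nonneg (α := ℝ)]), abs_le, Set.mem_Icc]
    constructor <;> rintro ⟨h1, h2⟩ <;> constructor <;> linarith
  have hagree : ∀ (n k : ℕ) (t : ℝ), |t - a| ≤ n → |t - a| ≤ k → σ n t = σ k t := by
    intro n k t hn hk
    have hI : IsPreconnected (Set.uIcc a t) := Set.ordConnected_uIcc.isPreconnected
    refine eq_of_isParallelNear hflat hγ hI (fun x hx => hσ' n x ?_) (fun x hx => hσ' k x ?_)
      Set.left_mem_uIcc Set.right_mem_uIcc ((hσ n).trans (hσ k).symm)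
    · exact Set.uIcc_subset_uIcc (hmem n) ((hball n t).2 hn) hx
    · exact Set.uIcc_subset_uIcc (hmem k) ((hball k t).2 hk) hx
  -- At time `t` the solution on the smallest interval of integer radius that contains `t` is used.
  -- By `hagree` any larger radius gives the same value.
  refine ⟨fun t => σ ⌈|t - a|⌉₊ t, fun t₀ => ?_, ?_⟩
  · refine (hσ' (⌈|t₀ - a|⌉₊ + 1) t₀ ((hball _ _).2 ?_)).congr ?_
    · push_cast
      linarith [Nat.le_ceil |t₀ - a|]
    · have : ∀ᶠ t in 𝓝 t₀, |t - a| < (⌈|t₀ - a|⌉₊ + 1 : ℕ) := by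
        refine ContinuousAt.eventually_lt (by fun_prop) continuousAt_const ?_
        push_cast
        linarith [Nat.le_ceil |t₀ - a|]
      filter_upwards [this] with t ht
      exact hagree _ _ t (Nat.le_ceil _) ht.le
  · simp [hσ]

theorem IsParallelAlong.eq (hflat : IsFlat D) (hγ : MDifferentiable 𝓘(ℝ, ℝ) 𝓘(ℝ, E) γ)
    {s s' : ∀ t, V (γ t)} (hs : IsParallelAlong D γ s) (hs' : IsParallelAlong D γ s') {a : ℝ}
    (h : s a = s' a) : s = s' :=
  funext fun _ => eq_of_isParallelNear hflat hγ isPreconnected_univ (fun t _ => hs t)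
    (fun t _ => hs' t) (Set.mem_univ a) (Set.mem_univ _) h

/-- Parallel transport maps the value of a parallel section at `a` to its value at `b`. -/
theorem IsParallelAlong.parallelTransport_apply (hflat : IsFlat D)
    (hγ : MDifferentiable 𝓘(ℝ, ℝ) 𝓘(ℝ, E) γ) {s : ∀ t, V (γ t)} (hs : IsParallelAlong D γ s)
    (a b : ℝ) : parallelTransport D γ a b (s a) = s b := by
  -- Uniqueness of parallel sections makes the map from values at `a` to values at `b` linear, so
  -- `parallelTransport` is not its default value.
  have hex : ∃ T : V (γ a) →ₗ[ℂ] V (γ b),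
      ∀ v, ∃ s : ∀ t, V (γ t), IsParallelAlong D γ s ∧ s a = v ∧ s b = T v := by
    choose σ hσ hσ' using fun v => exists_isParallelAlong hflat hγ a v
    refine ⟨{ toFun := fun v => σ v b, map_add' := fun v w => ?_, map_smul' := fun c v => ?_ },
      fun v => ⟨σ v, hσ v, hσ' v, rfl⟩⟩
    · have := IsParallelAlong.eq hflat hγ (hσ (v + w))
        (fun t => IsParallelNear.add hflat hγ (hσ v t) (hσ w t)) (a := a)
        ((hσ' _).trans (congrArg₂ (· + ·) (hσ' v) (hσ' w)).symm)
      exact congrFun this b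
    · have := IsParallelAlong.eq hflat hγ (hσ (c • v))
        (fun t => IsParallelNear.smul hflat hγ (hσ v t) c) (a := a)
        ((hσ' _).trans (congrArg (c • ·) (hσ' v)).symm)
      exact congrFun this b
  rw [parallelTransport, dif_pos hex]
  obtain ⟨s', hs', h1, h2⟩ := hex.choose_spec (s a)
  rw [← h2, IsParallelAlong.eq hflat hγ hs' hs h1]

end ParallelSections

/-! ### Holonomy -/

section Holonomy

variable {E : Type*} [NormedAddCommGroup E] [NormedSpace ℝ E]
  {M : Type*} [TopologicalSpace M] [ChartedSpace E M] [IsManifold 𝓘(ℝ, E) ∞ M]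
  {W : Type*} [NormedAddCommGroup W] [NormedSpace ℂ W] [FiniteDimensional ℂ W]
  {V : M → Type*} [TopologicalSpace (TotalSpace W V)]
  [∀ m, AddCommGroup (V m)] [∀ m, Module ℂ (V m)] [∀ m, TopologicalSpace (V m)]
  [∀ m, IsTopologicalAddGroup (V m)] [∀ m, ContinuousSMul ℝ (V m)]
  [FiberBundle W V] [VectorBundle ℂ W V] [VectorBundle ℝ W V]
  [ContMDiffVectorBundle ∞ W V 𝓘(ℝ, E)]
  {D : CovariantDerivative 𝓘(ℝ, E) W V}
  {G : Type*} [Group G] [TopologicalSpace G] [MulAction G M]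
  {A : BundleAction E G W V}

/-- The action on the total space. -/
def BundleAction.total (A : BundleAction E G W V) (x : G) (q : TotalSpace W V) : TotalSpace W V :=
  ⟨x • q.proj, A.act x q.proj q.snd⟩

theorem BundleAction.total_one (q : TotalSpace W V) : A.total 1 q = q := A.one_act q.1 q.2

theorem BundleAction.total_mul (x y : G) (q : TotalSpace W V) :
    A.total (x * y) q = A.total x (A.total y q) := A.mul_act x y q.1 q.2

theorem BundleAction.total_inv_total (x : G) (q : TotalSpace W V) :
    A.total x⁻¹ (A.total x q) = q := by rw [← A.total_mul, inv_mul_cancel, A.total_one]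

theorem BundleAction.total_total_inv (x : G) (q : TotalSpace W V) :
    A.total x (A.total x⁻¹ q) = q := by rw [← A.total_mul, mul_inv_cancel, A.total_one]

variable (W) in
theorem mk_fibreCast {m m' : M} (h : m = m') (v : V m) :
    (⟨m', fibreCast V h v⟩ : TotalSpace W V) = ⟨m, v⟩ := by
  subst h
  rfl

variable (W) in
theorem mk_injective {m : M} {v w : V m} (h : (⟨m, v⟩ : TotalSpace W V) = ⟨m, w⟩) : v = w := by
  simpa using h

theorem exists_mk_eq (q : TotalSpace W V) {m : M} (h : q.proj = m) :
    ∃ v : V m, (⟨m, v⟩ : TotalSpace W V) = q := by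
  subst h
  exact ⟨q.2, rfl⟩

/-- Translates of flat sections are flat. -/
theorem IsFlatSectionNear.translate (hsmooth : ∀ x : G, ContMDiff 𝓘(ℝ, E) 𝓘(ℝ, E) ∞
    (fun m : M => x • m)) (hinv : IsInvariantConnection A D) {S S' : ∀ m, V m} (h : G)
    (hS' : ∀ p, (⟨h • p, S' (h • p)⟩ : TotalSpace W V) = A.total h ⟨p, S p⟩) {p : M}
    (hS : IsFlatSectionNear D S p) : IsFlatSectionNear D S' (h • p) := by
  have hc : ContinuousAt (fun q : M => h⁻¹ • q) (h • p) := (hsmooth h⁻¹).continuous.continuousAt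
  have hp : Tendsto (fun q : M => h⁻¹ • q) (𝓝 (h • p)) (𝓝 p) := by
    have := hc.tendsto
    rwa [inv_smul_smul] at this
  filter_upwards [hp.eventually hS] with q hq
  obtain ⟨q, rfl⟩ : ∃ q', q = h • q' := ⟨h⁻¹ • q, (smul_inv_smul h q).symm⟩
  rw [inv_smul_smul] at hq
  constructor
  · have h1 : (fun q => (⟨q, S' q⟩ : TotalSpace W V)) =
        (A.total h) ∘ (fun q => (⟨q, S q⟩ : TotalSpace W V)) ∘ fun q : M => h⁻¹ • q := by
      ext1 q
      have := hS' (h⁻¹ • q)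
      rw [smul_inv_smul] at this
      exact this
    change ContMDiffAt _ _ _ _ _
    rw [h1]
    refine (A.contMDiff_act h).contMDiffAt.comp _ (ContMDiffAt.comp _ ?_ (hsmooth h⁻¹).contMDiffAt)
    rw [inv_smul_smul]
    exact hq.1
  · ext1 w
    have hd : ∀ x : G, MDifferentiable 𝓘(ℝ, E) 𝓘(ℝ, E) (fun m : M => x • m) := fun x =>
      (hsmooth x).mdifferentiable (by simp)
    have h2 := hinv h S S' (fun p => mk_injective W (hS' p)) q hq.1
    have h3 : tangentMapAt E (fun p : M => h • p) q ∘L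
        tangentMapAt E (fun p : M => h⁻¹ • p) (h • q) = ContinuousLinearMap.id ℝ E := by
      have h4 := tangentMapAt_comp (p := h • q) (hd h) (hd h⁻¹)
      have h5 : (fun p : M => h • p) ∘ (fun p : M => h⁻¹ • p) = id := by
        ext1 q
        exact smul_inv_smul h q
      rw [h5, tangentMapAt_id, inv_smul_smul] at h4
      exact h4.symm
    have h6 := h2 (mfderiv 𝓘(ℝ, E) 𝓘(ℝ, E) (fun p : M => h⁻¹ • p) (h • q) w)
    have h7 : mfderiv 𝓘(ℝ, E) 𝓘(ℝ, E) (fun p : M => h • p) q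
        (mfderiv 𝓘(ℝ, E) 𝓘(ℝ, E) (fun p : M => h⁻¹ • p) (h • q) w) = w :=
      congrArg (fun L : E →L[ℝ] E => L w) h3
    rw [h7, hq.2] at h6
    rw [h6]
    exact map_zero (A.act h q)

/-- Translates of parallel sections are parallel. -/
theorem IsParallelAlong.translate (hsmooth : ∀ x : G, ContMDiff 𝓘(ℝ, E) 𝓘(ℝ, E) ∞
    (fun m : M => x • m)) (hflat : IsFlat D) (hinv : IsInvariantConnection A D) {γ γ' : ℝ → M}
    (hγ : MDifferentiable 𝓘(ℝ, ℝ) 𝓘(ℝ, E) γ) (hγ' : MDifferentiable 𝓘(ℝ, ℝ) 𝓘(ℝ, E) γ')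
    {s : ∀ t, V (γ t)} {s' : ∀ t, V (γ' t)} (h : G) (r : ℝ)
    (hs' : ∀ t, (⟨γ' t, s' t⟩ : TotalSpace W V) = A.total h ⟨γ (t + r), s (t + r)⟩)
    (hs : IsParallelAlong D γ s) : IsParallelAlong D γ' s' := by
  intro t₀
  obtain ⟨S, hS, hsS⟩ := IsParallelNear.exists_isFlatSectionNear hflat hγ (hs (t₀ + r))
  have hex : ∀ q, ∃ v : V q, (⟨q, v⟩ : TotalSpace W V) =
      A.total h ⟨h⁻¹ • q, S (h⁻¹ • q)⟩ := fun q => exists_mk_eq _ (smul_inv_smul h q)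
  choose S' hS' using hex
  have h1 : γ' t₀ = h • γ (t₀ + r) := congrArg TotalSpace.proj (hs' t₀)
  refine isParallelNear_of_isFlatSectionNear hγ' (S := S') ?_ ?_
  · rw [h1]
    refine IsFlatSectionNear.translate hsmooth hinv h (fun p => ?_) hS
    rw [hS', inv_smul_smul]
  · have hc : Tendsto (fun t => t + r) (𝓝 t₀) (𝓝 (t₀ + r)) := by
      have : ContinuousAt (fun t => t + r) t₀ := by fun_prop
      exact this
    filter_upwards [hc.eventually hsS] with t ht
    refine mk_injective W ?_
    rw [hs', hS', ht]
    have h2 : γ' t = h • γ (t + r) := congrArg TotalSpace.proj (hs' t)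
    rw [h2, inv_smul_smul]

variable {φ : ℝ → M → M}

/-- Transport along `γ` from `0` to `s`, followed by `h`, is an isomorphism of fibres. It
intertwines the holonomies since translates of parallel sections are parallel: the holonomy sends `σ
0` to the value at time `0` of the parallel section `t ↦ x σ(t - l)`. -/
theorem trace_holonomy_conj (hφ : IsSmoothFlow E φ) (hsmooth : ∀ x : G,
    ContMDiff 𝓘(ℝ, E) 𝓘(ℝ, E) ∞ (fun m : M => x • m))
    (hequiv : ∀ (t : ℝ) (x : G) (m : M), φ t (x • m) = x • φ t m)
    (hflat : IsFlat D) (hinv : IsInvariantConnection A D) {x : G} {l : ℝ} {m : M} (h : G) (s : ℝ)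
    (hm : φ l m = x • m) :
    LinearMap.trace ℂ _ (holonomy A D (h * x * h⁻¹) l (fun t => φ t (φ s (h • m)))) =
      LinearMap.trace ℂ _ (holonomy A D x l (fun t => φ t m)) := by
  set γ : ℝ → M := fun t => φ t m with hγdef
  set γ' : ℝ → M := fun t => φ t (φ s (h • m)) with hγ'def
  have hγ : MDifferentiable 𝓘(ℝ, ℝ) 𝓘(ℝ, E) γ := hφ.mdifferentiable_curve m
  have hγ' : MDifferentiable 𝓘(ℝ, ℝ) 𝓘(ℝ, E) γ' := hφ.mdifferentiable_curve _
  have hγγ' : ∀ t, h • γ (t + s) = γ' t := fun t => by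
    simp only [hγdef, hγ'def, hφ.map_add, hequiv]
  have hγx : ∀ t, x • γ (t + -l) = γ t := fun t => by
    simp only [hγdef]
    rw [← hequiv, ← hm, ← hφ.map_add, neg_add_cancel_right]
  have hγx' : ∀ t, (h * x * h⁻¹) • γ' (t + -l) = γ' t := fun t => by
    rw [← hγγ', ← hγγ', smul_smul, inv_mul_cancel_right, mul_smul, add_right_comm, hγx]
  -- Stated in the total space, where fibres over equal base points need no identification.
  have hol : ∀ (y : G) (δ : ℝ → M) (hδ : MDifferentiable 𝓘(ℝ, ℝ) 𝓘(ℝ, E) δ)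
      (hδy : ∀ t, y • δ (t + -l) = δ t) (σ : ∀ t, V (δ t)), IsParallelAlong D δ σ →
      (⟨δ 0, holonomy A D y l δ (σ 0)⟩ : TotalSpace W V) = A.total y ⟨δ (-l), σ (-l)⟩ := by
    intro y δ hδ hδy σ hσ
    have h1 : y • δ (-l) = δ 0 := by
      have := hδy 0
      rwa [zero_add] at this
    rw [holonomy, dif_pos h1]
    change (⟨δ 0, fibreCast V h1 (A.act y (δ (-l)) (parallelTransport D δ 0 (-l) (σ 0)))⟩ :
      TotalSpace W V) = _
    rw [mk_fibreCast, hσ.parallelTransport_apply hflat hδ]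
    rfl
  have hh : h • γ s = γ' 0 := by
    have := hγγ' 0
    rwa [zero_add] at this
  let e₀ : V (γ 0) →ₗ[ℂ] V (γ' 0) :=
    fibreCast V hh ∘ₗ A.act h (γ s) ∘ₗ parallelTransport D γ 0 s
  have he₀ : ∀ σ : ∀ t, V (γ t), IsParallelAlong D γ σ →
      (⟨γ' 0, e₀ (σ 0)⟩ : TotalSpace W V) = A.total h ⟨γ s, σ s⟩ := by
    intro σ hσ
    change (⟨γ' 0, fibreCast V hh (A.act h (γ s) (parallelTransport D γ 0 s (σ 0)))⟩ :
      TotalSpace W V) = _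
    rw [mk_fibreCast, hσ.parallelTransport_apply hflat hγ]
    rfl
  have hbij : Function.Bijective e₀ := by
    constructor
    · intro v w hvw
      obtain ⟨σ, hσ, rfl⟩ := exists_isParallelAlong hflat hγ 0 v
      obtain ⟨σ', hσ', rfl⟩ := exists_isParallelAlong hflat hγ 0 w
      have h1 := (he₀ σ hσ).symm.trans (by rw [hvw, he₀ σ' hσ'])
      have h2 := congrArg (A.total h⁻¹) h1
      rw [A.total_inv_total, A.total_inv_total] at h2
      rw [hσ.eq hflat hγ hσ' (mk_injective W h2)]
    · intro w
      obtain ⟨v, hv⟩ := exists_mk_eq (W := W) (A.total h⁻¹ ⟨γ' 0, w⟩) (m := γ s) (by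
        change h⁻¹ • γ' 0 = γ s
        rw [← hh, inv_smul_smul])
      obtain ⟨σ, hσ, rfl⟩ := exists_isParallelAlong hflat hγ s v
      refine ⟨σ 0, mk_injective W ?_⟩
      rw [he₀ σ hσ, hv, A.total_total_inv]
  let e := LinearEquiv.ofBijective e₀ hbij
  have hconj : holonomy A D (h * x * h⁻¹) l γ' = e.conj (holonomy A D x l γ) := by
    ext w
    obtain ⟨v, rfl⟩ := e.surjective w
    rw [LinearEquiv.conj_apply_apply, LinearEquiv.symm_apply_apply]
    obtain ⟨σ, hσ, rfl⟩ := exists_isParallelAlong hflat hγ 0 v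
    have hex : ∀ t, ∃ v : V (γ' t), (⟨γ' t, v⟩ : TotalSpace W V) =
        A.total h ⟨γ (t + s), σ (t + s)⟩ := fun t => exists_mk_eq _ (hγγ' t)
    choose σ' hσ' using hex
    have hσ'p : IsParallelAlong D γ' σ' := hσ.translate hsmooth hflat hinv hγ hγ' h s hσ'
    have hexx : ∀ t, ∃ v : V (γ t), (⟨γ t, v⟩ : TotalSpace W V) =
        A.total x ⟨γ (t + -l), σ (t + -l)⟩ := fun t => exists_mk_eq _ (hγx t)
    choose τ hτ using hexx
    have hτp : IsParallelAlong D γ τ := hσ.translate hsmooth hflat hinv hγ hγ x (-l) hτ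
    have h1 : e₀ (σ 0) = σ' 0 := mk_injective W (by rw [he₀ σ hσ, hσ', zero_add])
    have h2 : holonomy A D x l γ (σ 0) = τ 0 := mk_injective W (by
      rw [hol x γ hγ hγx σ hσ, hτ, zero_add])
    refine mk_injective W ?_
    change (⟨γ' 0, holonomy A D (h * x * h⁻¹) l γ' (e₀ (σ 0))⟩ : TotalSpace W V) =
      ⟨γ' 0, e₀ (holonomy A D x l γ (σ 0))⟩
    -- Both sides equal `h x σ(s - l)`.
    rw [h1, h2, hol _ γ' hγ' hγx' σ' hσ'p, he₀ τ hτp, hσ', hτ, ← A.total_mul, ← A.total_mul,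
      inv_mul_cancel_right, add_comm (-l) s]
  rw [hconj, LinearMap.trace_conj']

end Holonomy

/-! ### Countable families of measures -/

section WeightedMeasure

open scoped NNReal

variable {M : Type*} [TopologicalSpace M] [MeasurableSpace M] [BorelSpace M]
  [SecondCountableTopology M] [LocallyCompactSpace M] {Λ X : Type*}

/-- The sum of a family of measures, with given weights. -/
noncomputable def weightedMeasure {M Λ : Type*} [MeasurableSpace M] (η : Λ → Measure M)
    (u : Λ → ℝ≥0) : Measure M := Measure.sum fun i => u i • η i

variable {η : Λ → Measure M} {u : Λ → ℝ≥0} {cls : Λ → X}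

theorem lintegral_weightedMeasure (f : M → ENNReal) :
    ∫⁻ m, f m ∂(weightedMeasure η u) = ∑' i, (u i : ENNReal) * ∫⁻ m, f m ∂(η i) := by
  rw [weightedMeasure, lintegral_sum_measure]
  exact tsum_congr fun i => lintegral_smul_measure _ _

instance [Countable Λ] [∀ i, IsFiniteMeasureOnCompacts (η i)] : SFinite (weightedMeasure η u) := by
  unfold weightedMeasure
  have : ∀ i, SFinite (u i • η i) := fun i => inferInstance
  infer_instance

/-- The group `B` permutes the measures of the family `η`, and preserves the classes `cls`. -/
def IsPermutedBy (B : Type*) {M Λ X : Type*} [Group B] [MulAction B M] [MeasurableSpace M]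
    (η : Λ → Measure M) (cls : Λ → X) : Prop :=
  ∀ b : B, ∃ e : Λ ≃ Λ, ∀ i, η (e i) = (η i).map (b • ·) ∧ cls (e i) = cls i

/-- Translation rearranges the summands within classes, where the weights are constant. -/
theorem IsPermutedBy.weightedMeasure_map {B : Type*} [Group B] [MulAction B M]
    [ContinuousConstSMul B M] (h : IsPermutedBy B η cls)
    (hu : ∀ i j, cls i = cls j → u i = u j) (b : B) :
    (weightedMeasure η u).map (b • ·) = weightedMeasure η u := by
  obtain ⟨e, he⟩ := h b
  have hb : Measurable fun m : M => b • m := (continuous_const_smul b).measurable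
  ext S hS
  rw [Measure.map_apply hb hS, weightedMeasure, Measure.sum_apply _ (hb hS),
    Measure.sum_apply _ hS, ← e.tsum_eq fun i => (u i • η i) S]
  refine tsum_congr fun i => ?_
  rw [hu (e i) i (he i).2, Measure.smul_apply, Measure.smul_apply, (he i).1,
    Measure.map_apply hb hS]

/-- The indicator function of the class of `j`. -/
noncomputable def classWeight {Λ X : Type*} (cls : Λ → X) (j i : Λ) : ℝ≥0 :=
  Set.indicator {i | cls i = cls j} 1 i

theorem classWeight_of_eq {i j : Λ} (h : cls i = cls j) : classWeight cls j i = 1 :=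
  Set.indicator_of_mem (s := {i | cls i = cls j}) h _

theorem classWeight_of_ne {i j : Λ} (h : cls i ≠ cls j) : classWeight cls j i = 0 :=
  Set.indicator_of_notMem (s := {i | cls i = cls j}) h _

theorem classWeight_congr (j : Λ) {i i' : Λ} (h : cls i = cls i') :
    classWeight cls j i = classWeight cls j i' := by
  by_cases h' : cls i = cls j
  · rw [classWeight_of_eq h', classWeight_of_eq (h ▸ h')]
  · rw [classWeight_of_ne h', classWeight_of_ne (h ▸ h')]

end WeightedMeasure

/-! ### Absolute convergence over the quotient in terms of cutoff sums -/

section Quotient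

open scoped NNReal

variable {M : Type*} [TopologicalSpace M] [MeasurableSpace M] [BorelSpace M]
  [SecondCountableTopology M] [LocallyCompactSpace M] {Λ X : Type*} [Countable Λ]
  {η : Λ → Measure M} {cls : Λ → X} [∀ i, IsFiniteMeasureOnCompacts (η i)]
  {A : Type*} [Group A] [TopologicalSpace A]
  [IsTopologicalGroup A] [T2Space A] [LocallyCompactSpace A] [MeasurableSpace A] [BorelSpace A]
  [MulAction A M] [ProperSMul A M] {K : Subgroup A}
  [MeasurableSpace (A ⧸ K)] [BorelSpace (A ⧸ K)] {α : Measure A} {β : Measure K}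
  {ν : Measure (A ⧸ K)} {p : ℕ → M → ℝ}

theorem continuous_integral_smul_measure {μ : Measure M} [IsFiniteMeasureOnCompacts μ] {f : M → ℝ}
    (hf : Continuous f) (hfs : HasCompactSupport f) :
    Continuous fun a : A => ∫ m, f (a • m) ∂μ := by
  rw [continuous_iff_continuousAt]
  intro a₀
  obtain ⟨N, hN, haN⟩ := exists_compact_mem_nhds a₀
  have hS : IsCompact ((fun q : A × M => q.1⁻¹ • q.2) '' (N ×ˢ tsupport f)) :=
    (hN.prod hfs.isCompact).image (by fun_prop)
  refine ((continuousOn_integral_of_compact_support (f := fun (a : A) m => f (a • m))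
    (s := N) hS ?_ ?_).continuousAt haN)
  · exact Continuous.continuousOn (by simp only [Function.uncurry_def]; fun_prop)
  · intro a m ha hm
    by_contra h
    exact hm ⟨(a, a • m), ⟨ha, subset_tsupport _ h⟩, by simp⟩

theorem integrable_smul {μ : Measure M} [IsFiniteMeasureOnCompacts μ] {f : M → ℝ}
    (hf : Continuous f) (hfs : HasCompactSupport f) (a : A) :
    Integrable (fun m => f (a • m)) μ :=
  Continuous.integrable_of_hasCompactSupport (by fun_prop)
    (hfs.comp_homeomorph (Homeomorph.smul a))

/-- A sum of nonnegative continuous functions on `A` is at least lower semicontinuous. Invariance of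
the measure under `K` lets it descend to the quotient. -/
theorem measurable_lintegral_quotient (hperm : IsPermutedBy K η cls) {u : Λ → ℝ≥0}
    (hu : ∀ i j, cls i = cls j → u i = u j) {f : M → ℝ} (hf : Continuous f)
    (hfs : HasCompactSupport f) (hf0 : ∀ m, 0 ≤ f m) :
    Measurable fun c : A ⧸ K => ∫⁻ m, ENNReal.ofReal (f (c.out • m)) ∂(weightedMeasure η u) := by
  refine LowerSemicontinuous.measurable ?_
  have h1 : ∀ a : A, ∫⁻ m, ENNReal.ofReal (f ((a : A ⧸ K).out • m)) ∂(weightedMeasure η u) =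
      ∫⁻ m, ENNReal.ofReal (f (a • m)) ∂(weightedMeasure η u) := by
    intro a
    obtain ⟨k, hk⟩ := QuotientGroup.mk_out_eq_mul K a
    conv_rhs => rw [← hperm.weightedMeasure_map hu k]
    rw [lintegral_map (Continuous.measurable (by fun_prop)).ennreal_ofReal
      (continuous_const_smul k).measurable, hk]
    simp only [mul_smul]
    rfl
  have h2 : LowerSemicontinuous fun a : A =>
      ∫⁻ m, ENNReal.ofReal (f (a • m)) ∂(weightedMeasure η u) := by
    simp only [lintegral_weightedMeasure]
    refine lowerSemicontinuous_tsum fun i => Continuous.lowerSemicontinuous ?_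
    refine (ENNReal.continuous_const_mul ENNReal.coe_ne_top).comp ?_
    refine (ENNReal.continuous_ofReal.comp
      (continuous_integral_smul_measure (μ := η i) hf hfs)).congr fun a => ?_
    exact ofReal_integral_eq_lintegral_ofReal (integrable_smul hf hfs a)
      (Eventually.of_forall fun m => hf0 _)
  rw [lowerSemicontinuous_iff_isOpen_preimage] at h2 ⊢
  intro y
  rw [← (QuotientGroup.isQuotientMap_mk (N := K)).isOpen_preimage]
  convert h2 y using 1
  ext a
  simp only [Set.mem_preimage, h1]

variable [IsFiniteMeasureOnCompacts α] [β.IsMulLeftInvariant]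
  [IsFiniteMeasureOnCompacts β] [IsFiniteMeasureOnCompacts ν] [SFinite β] [SFinite ν]

/-- `χ` is a continuous, compactly supported cutoff function, whose absolute values have averages
bounded by `C`. -/
structure IsBoundedCutoff {M A : Type*} [TopologicalSpace M] [Group A] [MulAction A M]
    [MeasurableSpace A] (α : Measure A) (χ : M → ℝ) (C : ℝ≥0) : Prop where
  continuous : Continuous χ
  hasCompactSupport : HasCompactSupport χ
  integral_eq_one : ∀ m, ∫ a : A, χ (a • m) ∂α = 1
  lintegral_le : ∀ m, ∫⁻ a : A, ENNReal.ofReal |χ (a • m)| ∂α ≤ C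

variable {χ : M → ℝ} {C : ℝ≥0}

theorem enorm_integral_le_lintegral_ofReal_abs {μ : Measure M} (f : M → ℝ) :
    ‖∫ m, f m ∂μ‖ₑ ≤ ∫⁻ m, ENNReal.ofReal |f m| ∂μ := by
  refine (enorm_integral_le_lintegral_enorm f).trans (le_of_eq ?_)
  refine lintegral_congr fun m => ?_
  rw [Real.enorm_eq_ofReal_abs]

theorem tsum_enorm_integral_le (u : Λ → ℝ≥0) (c : A) :
    ∑' i, (u i : ENNReal) * ‖∫ m, χ (c • m) ∂(η i)‖ₑ ≤
      ∫⁻ m, ENNReal.ofReal |χ (c • m)| ∂(weightedMeasure η u) := by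
  rw [lintegral_weightedMeasure]
  exact ENNReal.tsum_le_tsum fun i =>
    mul_le_mul_right (enorm_integral_le_lintegral_ofReal_abs _) _

/-- Unfolding with `f = |χ|`, whose averages over `A` are at most `C`. -/
theorem lintegral_quotient_abs_le (hχ : IsBoundedCutoff α χ C) (hK : IsClosed (K : Set A))
    (hc : CompatibleMeasures K (fun k : K => (k : A)) α β ν) (hp : IsCutoffSequence β p)
    (hperm : IsPermutedBy K η cls) {u : Λ → ℝ≥0} (hu : ∀ i j, cls i = cls j → u i = u j) :
    ∫⁻ c : A ⧸ K, ∫⁻ m, ENNReal.ofReal |χ (c.out • m)| ∂(weightedMeasure η u) ∂ν ≤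
      C * ∫⁻ m, cutoffSum p m ∂(weightedMeasure η u) := by
  rw [lintegral_quotient_lintegral_smul hK hc (fun k => hperm.weightedMeasure_map hu k) hp
    (f := fun m => |χ m|) hχ.continuous.abs hχ.hasCompactSupport.norm (fun m => abs_nonneg _),
    ← lintegral_const_mul _ hp.measurable_cutoffSum]
  refine lintegral_mono fun m => ?_
  rw [mul_comm]
  exact mul_le_mul_left (hχ.lintegral_le m) _

theorem hasCompactSupport_posPart {f : M → ℝ} (hf : HasCompactSupport f) :
    HasCompactSupport fun m => max (f m) 0 :=
  hf.comp_left (g := fun x : ℝ => max x 0) (by simp)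

theorem hasCompactSupport_negPart {f : M → ℝ} (hf : HasCompactSupport f) :
    HasCompactSupport fun m => max (-f m) 0 :=
  hf.comp_left (g := fun x : ℝ => max (-x) 0) (by simp)

/-- The integral over the quotient of the positive part of the cutoff function. -/
theorem lintegral_quotient_posPart (hχ : IsBoundedCutoff α χ C) (hK : IsClosed (K : Set A))
    (hc : CompatibleMeasures K (fun k : K => (k : A)) α β ν) (hp : IsCutoffSequence β p)
    (hperm : IsPermutedBy K η cls) {u : Λ → ℝ≥0} (hu : ∀ i j, cls i = cls j → u i = u j) :
    ∫⁻ c : A ⧸ K, ∫⁻ m, ENNReal.ofReal (max (χ (c.out • m)) 0) ∂(weightedMeasure η u) ∂ν =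
      (∫⁻ m, cutoffSum p m ∂(weightedMeasure η u)) +
      ∫⁻ c : A ⧸ K, ∫⁻ m, ENNReal.ofReal (max (-χ (c.out • m)) 0) ∂(weightedMeasure η u) ∂ν := by
  have hχc := hχ.continuous
  rw [lintegral_quotient_lintegral_smul hK hc (fun k => hperm.weightedMeasure_map hu k) hp
      (f := fun m => max (χ m) 0) (by fun_prop) (hasCompactSupport_posPart hχ.hasCompactSupport)
      (fun m => le_max_right _ _),
    lintegral_quotient_lintegral_smul hK hc (fun k => hperm.weightedMeasure_map hu k) hp
      (f := fun m => max (-χ m) 0) (by fun_prop)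
      (hasCompactSupport_negPart hχ.hasCompactSupport) (fun m => le_max_right _ _),
    ← lintegral_add_left hp.measurable_cutoffSum]
  refine lintegral_congr fun m => ?_
  have hint : ∀ {f : M → ℝ}, Continuous f → HasCompactSupport f →
      Integrable (fun a : A => f (a • m)) α := fun hf hfs =>
    Continuous.integrable_of_hasCompactSupport (by fun_prop) (hasCompactSupport_smul hfs m)
  have h1 := hint (f := fun m => max (χ m) 0) (by fun_prop)
    (hasCompactSupport_posPart hχ.hasCompactSupport)
  have h2 := hint (f := fun m => max (-χ m) 0) (by fun_prop)
    (hasCompactSupport_negPart hχ.hasCompactSupport)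
  rw [← ofReal_integral_eq_lintegral_ofReal h1 (Eventually.of_forall fun a => le_max_right _ _),
    ← ofReal_integral_eq_lintegral_ofReal h2 (Eventually.of_forall fun a => le_max_right _ _)]
  -- The positive part minus the negative part is `χ`, which has average one.
  have h3 : ∫ a : A, max (χ (a • m)) 0 ∂α = 1 + ∫ a : A, max (-χ (a • m)) 0 ∂α := by
    rw [← hχ.integral_eq_one m, ← integral_add (hint hχc hχ.hasCompactSupport) h2]
    refine integral_congr_ae (Eventually.of_forall fun a => ?_)
    rcases le_total (χ (a • m)) 0 with h | h
    · simp [h]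
    · simp [h]
  have h4 : 0 ≤ ∫ a : A, max (-χ (a • m)) 0 ∂α := integral_nonneg fun a => le_max_right _ _
  rw [h3, ENNReal.ofReal_add zero_le_one h4,
    ENNReal.ofReal_one, mul_add, mul_one]

/-- As `χ` may change sign, `|∫ χ|` does not control `∫ |χ|`. On each orbit, however, `∫ χ⁺ ≤ |∫ χ|
+ ∫ χ⁻`. After integration over the quotient the left side is the cutoff integral plus the
contribution of `χ⁻`, and the latter is finite and cancels. -/
theorem lintegral_cutoffSum_le_of_lt_top (hχ : IsBoundedCutoff α χ C) (hK : IsClosed (K : Set A))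
    (hc : CompatibleMeasures K (fun k : K => (k : A)) α β ν) (hp : IsCutoffSequence β p)
    (hperm : IsPermutedBy K η cls) {u : Λ → ℝ≥0} (hu : ∀ i j, cls i = cls j → u i = u j)
    (hfin : ∫⁻ m, cutoffSum p m ∂(weightedMeasure η u) < ⊤) :
    ∫⁻ m, cutoffSum p m ∂(weightedMeasure η u) ≤
      ∫⁻ c : A ⧸ K, ∑' i, (u i : ENNReal) * ‖∫ m, χ (c.out • m) ∂(η i)‖ₑ ∂ν := by
  have hχc := hχ.continuous
  have hneg : ∫⁻ c : A ⧸ K, ∫⁻ m, ENNReal.ofReal (max (-χ (c.out • m)) 0)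
      ∂(weightedMeasure η u) ∂ν ≠ ⊤ := by
    refine ne_top_of_le_ne_top (ENNReal.mul_lt_top (ENNReal.coe_lt_top (r := C)) hfin).ne
      ((lintegral_mono fun c => lintegral_mono fun m => ?_).trans
        (lintegral_quotient_abs_le hχ hK hc hp hperm hu))
    exact ENNReal.ofReal_le_ofReal (max_le (neg_le_abs _) (abs_nonneg _))
  refine (ENNReal.add_le_add_iff_right hneg).1 ?_
  rw [← lintegral_quotient_posPart hχ hK hc hp hperm hu, ← lintegral_add_right]
  · refine lintegral_mono fun c => ?_
    simp only [lintegral_weightedMeasure]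
    rw [← ENNReal.tsum_add]
    refine ENNReal.tsum_le_tsum fun i => ?_
    rw [← mul_add]
    refine mul_le_mul_right ?_ _
    have h1 := integrable_smul (μ := η i) (f := fun m => max (χ m) 0) (by fun_prop)
      (hasCompactSupport_posPart hχ.hasCompactSupport) c.out
    have h2 := integrable_smul (μ := η i) (f := fun m => max (-χ m) 0) (by fun_prop)
      (hasCompactSupport_negPart hχ.hasCompactSupport) c.out
    have h3 : 0 ≤ ∫ m, max (-χ (c.out • m)) 0 ∂(η i) := integral_nonneg fun a => le_max_right _ _
    rw [← ofReal_integral_eq_lintegral_ofReal h1 (Eventually.of_forall fun a => le_max_right _ _),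
      ← ofReal_integral_eq_lintegral_ofReal h2 (Eventually.of_forall fun a => le_max_right _ _),
      Real.enorm_eq_ofReal_abs, ← ENNReal.ofReal_add (abs_nonneg _) h3]
    refine ENNReal.ofReal_le_ofReal ?_
    rw [← sub_le_iff_le_add, ← integral_sub h1 h2]
    refine le_trans (le_of_eq ?_) (le_abs_self _)
    refine integral_congr_ae (Eventually.of_forall fun a => ?_)
    rcases le_total (χ (c.out • a)) 0 with h | h
    · simp [h]
    · simp [h]
  · exact measurable_lintegral_quotient hperm hu (f := fun m => max (-χ m) 0) (by fun_prop)
      (hasCompactSupport_negPart hχ.hasCompactSupport) (fun m => le_max_right _ _)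

/-- The sum of the measures in the class of `j`. -/
noncomputable def classMeasure {M Λ X : Type*} [MeasurableSpace M] (η : Λ → Measure M)
    (cls : Λ → X) (j : Λ) : Measure M := weightedMeasure η (classWeight cls j)

/-- Finiteness of the total is relaxed to finiteness for every class. The weights `v` keep only the
classes that meet a finite set `s`, remain constant on classes, and have a finite total. -/
theorem lintegral_cutoffSum_le (hχ : IsBoundedCutoff α χ C) (hK : IsClosed (K : Set A))
    (hc : CompatibleMeasures K (fun k : K => (k : A)) α β ν) (hp : IsCutoffSequence β p)
    (hperm : IsPermutedBy K η cls) {u : Λ → ℝ≥0} (hu : ∀ i j, cls i = cls j → u i = u j)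
    (hfin : ∀ j, ∫⁻ m, cutoffSum p m ∂(classMeasure η cls j) < ⊤) :
    ∫⁻ m, cutoffSum p m ∂(weightedMeasure η u) ≤
      ∫⁻ c : A ⧸ K, ∑' i, (u i : ENNReal) * ‖∫ m, χ (c.out • m) ∂(η i)‖ₑ ∂ν := by
  classical
  rw [lintegral_weightedMeasure, ENNReal.tsum_eq_iSup_sum]
  refine iSup_le fun s => ?_
  let v : Λ → ℝ≥0 := fun i => if ∃ j ∈ s, cls i = cls j then u i else 0
  have hv : ∀ i j, cls i = cls j → v i = v j := fun i j h => by simp only [v, h, hu i j h]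
  have hvu : ∀ i, v i ≤ u i := fun i => by
    simp only [v]
    split_ifs
    · exact le_rfl
    · exact zero_le
  have hvfin : ∫⁻ m, cutoffSum p m ∂(weightedMeasure η v) < ⊤ := by
    have h1 : ∫⁻ m, cutoffSum p m ∂(weightedMeasure η v) ≤
        ∑ j ∈ s, u j * ∫⁻ m, cutoffSum p m ∂(classMeasure η cls j) := by
      simp only [classMeasure, lintegral_weightedMeasure, ← ENNReal.tsum_mul_left]
      rw [← Summable.tsum_finsetSum fun _ _ => ENNReal.summable]
      refine ENNReal.tsum_le_tsum fun i => ?_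
      by_cases h : ∃ j ∈ s, cls i = cls j
      · obtain ⟨j, hj, hij⟩ := h
        refine le_trans ?_ (Finset.single_le_sum (f := fun j => (u j : ENNReal) *
          ((classWeight cls j i : ENNReal) * ∫⁻ m, cutoffSum p m ∂(η i)))
          (fun _ _ => zero_le) hj)
        rw [classWeight_of_eq hij, ENNReal.coe_one, one_mul, ← hu i j hij]
        exact mul_le_mul_left (by exact_mod_cast hvu i) _
      · simp [v, h]
    refine h1.trans_lt (ENNReal.sum_lt_top.2 fun j _ => ENNReal.mul_lt_top ENNReal.coe_lt_top
      (hfin j))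
  calc ∑ i ∈ s, (u i : ENNReal) * ∫⁻ m, cutoffSum p m ∂(η i)
      = ∑ i ∈ s, (v i : ENNReal) * ∫⁻ m, cutoffSum p m ∂(η i) := by
        refine Finset.sum_congr rfl fun i hi => ?_
        have : v i = u i := if_pos ⟨i, hi, rfl⟩
        rw [this]
    _ ≤ ∫⁻ m, cutoffSum p m ∂(weightedMeasure η v) := by
        rw [lintegral_weightedMeasure]
        exact ENNReal.sum_le_tsum s
    _ ≤ ∫⁻ c : A ⧸ K, ∑' i, (v i : ENNReal) * ‖∫ m, χ (c.out • m) ∂(η i)‖ₑ ∂ν :=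
        lintegral_cutoffSum_le_of_lt_top hχ hK hc hp hperm hv hvfin
    _ ≤ _ := lintegral_mono fun c => ENNReal.tsum_le_tsum fun i =>
        mul_le_mul_left (by exact_mod_cast hvu i) _

/-- The absolute integral over the quotient is finite if and only if the integral of the cutoff
sum is. -/
theorem lintegral_quotient_lt_top_iff (hχ : IsBoundedCutoff α χ C) (hK : IsClosed (K : Set A))
    (hc : CompatibleMeasures K (fun k : K => (k : A)) α β ν) (hp : IsCutoffSequence β p)
    (hperm : IsPermutedBy K η cls) {u : Λ → ℝ≥0} (hu : ∀ i j, cls i = cls j → u i = u j)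
    (hfin : ∀ j, ∫⁻ m, cutoffSum p m ∂(classMeasure η cls j) < ⊤) :
    ∫⁻ c : A ⧸ K, ∑' i, (u i : ENNReal) * ‖∫ m, χ (c.out • m) ∂(η i)‖ₑ ∂ν < ⊤ ↔
      ∫⁻ m, cutoffSum p m ∂(weightedMeasure η u) < ⊤ := by
  constructor
  · intro h
    exact lt_of_le_of_lt (lintegral_cutoffSum_le hχ hK hc hp hperm hu hfin) h
  · intro h
    have h1 := lintegral_quotient_abs_le hχ hK hc hp hperm hu
    have h2 : ∫⁻ c : A ⧸ K, ∑' i, (u i : ENNReal) * ‖∫ m, χ (c.out • m) ∂(η i)‖ₑ ∂ν ≤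
        ∫⁻ c : A ⧸ K, ∫⁻ m, ENNReal.ofReal |χ (c.out • m)| ∂(weightedMeasure η u) ∂ν :=
      lintegral_mono fun c => tsum_enorm_integral_le u c.out
    exact lt_of_le_of_lt (h2.trans h1) (ENNReal.mul_lt_top ENNReal.coe_lt_top h)

end Quotient

/-! ### Integrals of weighted sums over quotients -/

section QuotientIntegral

open scoped NNReal

variable {M : Type*} [TopologicalSpace M] [MeasurableSpace M] [BorelSpace M]
  [SecondCountableTopology M] [LocallyCompactSpace M] {Λ X : Type*} [Countable Λ]
  {η : Λ → Measure M} {cls : Λ → X} [∀ i, IsFiniteMeasureOnCompacts (η i)]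
  {A : Type*} [Group A] [TopologicalSpace A]
  [IsTopologicalGroup A] [T2Space A] [LocallyCompactSpace A] [MeasurableSpace A] [BorelSpace A]
  [MulAction A M] [ProperSMul A M] {K : Subgroup A}
  [MeasurableSpace (A ⧸ K)] [BorelSpace (A ⧸ K)] {α : Measure A} {β : Measure K}
  {ν : Measure (A ⧸ K)} {p : ℕ → M → ℝ}
  [IsFiniteMeasureOnCompacts α] [β.IsMulLeftInvariant]
  [IsFiniteMeasureOnCompacts β] [IsFiniteMeasureOnCompacts ν] [SFinite β] [SFinite ν]
  {χ : M → ℝ} {C : ℝ≥0}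

theorem tsum_mul_integral_of_lt_top {u : Λ → ℝ≥0} {f : M → ℝ} (hf : Continuous f)
    (hfs : HasCompactSupport f) (hf0 : ∀ m, 0 ≤ f m) (a : A)
    (hfin : ∫⁻ m, ENNReal.ofReal (f (a • m)) ∂(weightedMeasure η u) < ⊤) :
    Summable (fun i => (u i : ℝ) * ∫ m, f (a • m) ∂(η i)) ∧
    ∑' i, (u i : ℝ) * ∫ m, f (a • m) ∂(η i) =
      (∫⁻ m, ENNReal.ofReal (f (a • m)) ∂(weightedMeasure η u)).toReal := by
  have h1 : ∀ i, ((u i : ENNReal) * ∫⁻ m, ENNReal.ofReal (f (a • m)) ∂(η i)).toReal =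
      (u i : ℝ) * ∫ m, f (a • m) ∂(η i) := by
    intro i
    rw [← ofReal_integral_eq_lintegral_ofReal (integrable_smul hf hfs a)
      (Eventually.of_forall fun m => hf0 _), ENNReal.toReal_mul, ENNReal.coe_toReal,
      ENNReal.toReal_ofReal (integral_nonneg fun m => hf0 _)]
  rw [lintegral_weightedMeasure] at hfin ⊢
  have h2 := ENNReal.summable_toReal hfin.ne
  rw [ENNReal.tsum_toReal_eq (ENNReal.ne_top_of_tsum_ne_top hfin.ne)]
  simp only [h1] at h2 ⊢
  exact ⟨h2, trivial⟩

/-- The integral over the quotient of a weighted sum, for nonnegative weights. -/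
theorem integral_quotient_of_nonneg (hχ : IsBoundedCutoff α χ C) (hK : IsClosed (K : Set A))
    (hc : CompatibleMeasures K (fun k : K => (k : A)) α β ν) (hp : IsCutoffSequence β p)
    (hperm : IsPermutedBy K η cls) {u : Λ → ℝ≥0} (hu : ∀ i j, cls i = cls j → u i = u j)
    (hfin : ∫⁻ m, cutoffSum p m ∂(weightedMeasure η u) < ⊤) :
    (∀ᵐ c ∂ν, Summable fun i => (u i : ℝ) * ∫ m, χ (c.out • m) ∂(η i)) ∧
    Integrable (fun c : A ⧸ K => ∑' i, (u i : ℝ) * ∫ m, χ (c.out • m) ∂(η i)) ν ∧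
    ∫ c : A ⧸ K, ∑' i, (u i : ℝ) * ∫ m, χ (c.out • m) ∂(η i) ∂ν =
      (∫⁻ m, cutoffSum p m ∂(weightedMeasure η u)).toReal := by
  have hχc := hχ.continuous
  have hpc : Continuous fun m => max (χ m) 0 := by fun_prop
  have hnc : Continuous fun m => max (-χ m) 0 := by fun_prop
  have hps := hasCompactSupport_posPart hχ.hasCompactSupport
  have hns := hasCompactSupport_negPart hχ.hasCompactSupport
  have habs : ∫⁻ c : A ⧸ K, ∫⁻ m, ENNReal.ofReal |χ (c.out • m)| ∂(weightedMeasure η u) ∂ν < ⊤ :=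
    lt_of_le_of_lt (lintegral_quotient_abs_le hχ hK hc hp hperm hu)
      (ENNReal.mul_lt_top ENNReal.coe_lt_top hfin)
  set P : A ⧸ K → ENNReal := fun c =>
    ∫⁻ m, ENNReal.ofReal (max (χ (c.out • m)) 0) ∂(weightedMeasure η u) with hP
  set N : A ⧸ K → ENNReal := fun c =>
    ∫⁻ m, ENNReal.ofReal (max (-χ (c.out • m)) 0) ∂(weightedMeasure η u) with hN
  have hPm : Measurable P := measurable_lintegral_quotient hperm hu hpc hps fun m => le_max_right _ _
  have hNm : Measurable N := measurable_lintegral_quotient hperm hu hnc hns fun m => le_max_right _ _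
  have hPfin : ∫⁻ c, P c ∂ν ≠ ⊤ := ne_top_of_le_ne_top habs.ne <| lintegral_mono fun c =>
    lintegral_mono fun m => ENNReal.ofReal_le_ofReal (max_le (le_abs_self _) (abs_nonneg _))
  have hNfin : ∫⁻ c, N c ∂ν ≠ ⊤ := ne_top_of_le_ne_top habs.ne <| lintegral_mono fun c =>
    lintegral_mono fun m => ENNReal.ofReal_le_ofReal (max_le (neg_le_abs _) (abs_nonneg _))
  have hPN : ∫⁻ c, P c ∂ν = (∫⁻ m, cutoffSum p m ∂(weightedMeasure η u)) + ∫⁻ c, N c ∂ν :=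
    lintegral_quotient_posPart hχ hK hc hp hperm hu
  have hPae := ae_lt_top hPm hPfin
  have hNae := ae_lt_top hNm hNfin
  -- For almost every coset both parts are finite, so the signed sum converges and is their
  -- difference.
  have key : ∀ᵐ c ∂ν, Summable (fun i => (u i : ℝ) * ∫ m, χ (c.out • m) ∂(η i)) ∧
      ∑' i, (u i : ℝ) * ∫ m, χ (c.out • m) ∂(η i) = (P c).toReal - (N c).toReal := by
    filter_upwards [hPae, hNae] with c h1 h2
    obtain ⟨h3, h4⟩ := tsum_mul_integral_of_lt_top hpc hps (fun m => le_max_right _ _) c.out h1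
    obtain ⟨h5, h6⟩ := tsum_mul_integral_of_lt_top hnc hns (fun m => le_max_right _ _) c.out h2
    have h7 : ∀ i, (u i : ℝ) * ∫ m, χ (c.out • m) ∂(η i) =
        (u i : ℝ) * ∫ m, max (χ (c.out • m)) 0 ∂(η i) -
          (u i : ℝ) * ∫ m, max (-χ (c.out • m)) 0 ∂(η i) := by
      intro i
      rw [← mul_sub, ← integral_sub (integrable_smul hpc hps c.out) (integrable_smul hnc hns c.out)]
      congr 1
      refine integral_congr_ae (Eventually.of_forall fun m => ?_)
      rcases le_total (χ (c.out • m)) 0 with h | h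
      · simp [h]
      · simp [h]
    simp only [h7]
    exact ⟨h3.sub h5, by rw [h3.tsum_sub h5, h4, h6]⟩
  have hPi := integrable_toReal_of_lintegral_ne_top hPm.aemeasurable hPfin
  have hNi := integrable_toReal_of_lintegral_ne_top hNm.aemeasurable hNfin
  refine ⟨key.mono fun c h => h.1, (hPi.sub hNi).congr (key.mono fun c h => h.2.symm), ?_⟩
  rw [integral_congr_ae (key.mono fun c h => h.2), integral_sub hPi hNi,
    integral_toReal hPm.aemeasurable hPae, integral_toReal hNm.aemeasurable hNae, hPN,
    ENNReal.toReal_add hfin.ne hNfin, add_sub_cancel_right]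

/-- The weighted sum of the integrals of the cutoff sum, for complex weights. -/
noncomputable def cutoffValue {M Λ : Type*} [MeasurableSpace M] (η : Λ → Measure M)
    (p : ℕ → M → ℝ) (w : Λ → ℂ) : ℂ :=
  ((∫⁻ m, cutoffSum p m ∂(weightedMeasure η fun i => (w i).re.toNNReal)).toReal -
    (∫⁻ m, cutoffSum p m ∂(weightedMeasure η fun i => (-(w i).re).toNNReal)).toReal) +
  ((∫⁻ m, cutoffSum p m ∂(weightedMeasure η fun i => (w i).im.toNNReal)).toReal -
    (∫⁻ m, cutoffSum p m ∂(weightedMeasure η fun i => (-(w i).im).toNNReal)).toReal) * Complex.I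

theorem lintegral_weightedMeasure_mono {u v : Λ → ℝ≥0} (h : ∀ i, u i ≤ v i) (f : M → ENNReal) :
    ∫⁻ m, f m ∂(weightedMeasure η u) ≤ ∫⁻ m, f m ∂(weightedMeasure η v) := by
  simp only [lintegral_weightedMeasure]
  exact ENNReal.tsum_le_tsum fun i => mul_le_mul_left (by exact_mod_cast h i) _

theorem toNNReal_le_nnnorm {x : ℝ} {z : ℂ} (h : |x| ≤ ‖z‖) : x.toNNReal ≤ ‖z‖₊ :=
  Real.toNNReal_le_iff_le_coe.2 ((le_abs_self x).trans h)

theorem re_add_im_toNNReal (z : ℂ) (t : ℝ) : z * t =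
    (((z.re.toNNReal : ℝ) * t : ℝ) - ((-z.re).toNNReal * t : ℝ)) +
      (((z.im.toNNReal : ℝ) * t : ℝ) - ((-z.im).toNNReal * t : ℝ)) * Complex.I := by
  have h : ∀ x : ℝ, x = (x.toNNReal : ℝ) - (-x).toNNReal := fun x => by
    rw [Real.coe_toNNReal', Real.coe_toNNReal']
    rcases le_total x 0 with h | h
    · simp [h]
    · simp [h]
  conv_lhs => rw [← Complex.re_add_im z, h z.re, h z.im]
  push_cast
  ring

/-- The integral over the quotient of a weighted sum. -/
theorem integral_quotient (hχ : IsBoundedCutoff α χ C) (hK : IsClosed (K : Set A))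
    (hc : CompatibleMeasures K (fun k : K => (k : A)) α β ν) (hp : IsCutoffSequence β p)
    (hperm : IsPermutedBy K η cls) {w : Λ → ℂ} (hw : ∀ i j, cls i = cls j → w i = w j)
    (hfin : ∫⁻ m, cutoffSum p m ∂(weightedMeasure η fun i => ‖w i‖₊) < ⊤) :
    Integrable (fun c : A ⧸ K => ∑' i, w i * (∫ m, χ (c.out • m) ∂(η i) : ℝ)) ν ∧
    ∫ c : A ⧸ K, ∑' i, w i * (∫ m, χ (c.out • m) ∂(η i) : ℝ) ∂ν = cutoffValue η p w := by
  -- Used for plus and minus the real and imaginary parts, which give four families of nonnegative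
  -- weights dominated by `‖w i‖`.
  have key : ∀ x : ℂ → ℝ, (∀ z, |x z| ≤ ‖z‖) →
      (∀ᵐ c ∂ν, Summable fun i => ((x (w i)).toNNReal : ℝ) * ∫ m, χ (c.out • m) ∂(η i)) ∧
      Integrable (fun c : A ⧸ K =>
        ∑' i, ((x (w i)).toNNReal : ℝ) * ∫ m, χ (c.out • m) ∂(η i)) ν ∧
      ∫ c : A ⧸ K, ∑' i, ((x (w i)).toNNReal : ℝ) * ∫ m, χ (c.out • m) ∂(η i) ∂ν =
        (∫⁻ m, cutoffSum p m ∂(weightedMeasure η fun i => (x (w i)).toNNReal)).toReal := by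
    intro x hx
    refine integral_quotient_of_nonneg hχ hK hc hp hperm (fun i j h => by rw [hw i j h]) ?_
    exact lt_of_le_of_lt (lintegral_weightedMeasure_mono (fun i => toNNReal_le_nnnorm (hx _)) _)
      hfin
  obtain ⟨s1, i1, v1⟩ := key (fun z => z.re) Complex.abs_re_le_norm
  obtain ⟨s2, i2, v2⟩ := key (fun z => -z.re) fun z => by
    rw [abs_neg]
    exact Complex.abs_re_le_norm z
  obtain ⟨s3, i3, v3⟩ := key (fun z => z.im) Complex.abs_im_le_norm
  obtain ⟨s4, i4, v4⟩ := key (fun z => -z.im) fun z => by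
    rw [abs_neg]
    exact Complex.abs_im_le_norm z
  have hsum : ∀ᵐ c ∂ν, ∑' i, w i * (∫ m, χ (c.out • m) ∂(η i) : ℝ) =
      (((∑' i, ((w i).re.toNNReal : ℝ) * ∫ m, χ (c.out • m) ∂(η i) : ℝ) : ℂ) -
        ((∑' i, ((-(w i).re).toNNReal : ℝ) * ∫ m, χ (c.out • m) ∂(η i) : ℝ) : ℂ)) +
      (((∑' i, ((w i).im.toNNReal : ℝ) * ∫ m, χ (c.out • m) ∂(η i) : ℝ) : ℂ) -
        ((∑' i, ((-(w i).im).toNNReal : ℝ) * ∫ m, χ (c.out • m) ∂(η i) : ℝ) : ℂ)) *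
        Complex.I := by
    filter_upwards [s1, s2, s3, s4] with c h1 h2 h3 h4
    have e1 := Complex.hasSum_ofReal.2 h1.hasSum
    have e2 := Complex.hasSum_ofReal.2 h2.hasSum
    have e3 := Complex.hasSum_ofReal.2 h3.hasSum
    have e4 := Complex.hasSum_ofReal.2 h4.hasSum
    refine HasSum.tsum_eq ?_
    simp only [re_add_im_toNNReal]
    exact (e1.sub e2).add ((e3.sub e4).mul_right _)
  have j1 := i1.ofReal (𝕜 := ℂ)
  have j2 := i2.ofReal (𝕜 := ℂ)
  have j3 := i3.ofReal (𝕜 := ℂ)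
  have j4 := i4.ofReal (𝕜 := ℂ)
  have j := (j1.sub j2).add ((j3.sub j4).mul_const Complex.I)
  refine ⟨j.congr (hsum.mono fun c h => h.symm), ?_⟩
  rw [integral_congr_ae hsum]
  refine (integral_add (j1.sub j2) ((j3.sub j4).mul_const Complex.I)).trans ?_
  rw [cutoffValue]
  congr 1
  · refine (integral_sub j1 j2).trans ?_
    rw [← v1, ← v2]
    exact congrArg₂ _ integral_ofReal integral_ofReal
  · refine (integral_mul_const _ _).trans ?_
    rw [← v3, ← v4]
    congr 1
    refine (integral_sub j3 j4).trans ?_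
    exact congrArg₂ _ integral_ofReal integral_ofReal

theorem cutoffValue_eq_mul {p q : ℕ → M → ℝ} {t : ENNReal} {w : Λ → ℂ}
    (hw : ∀ i j, cls i = cls j → w i = w j)
    (h : ∀ u : Λ → ℝ≥0, (∀ i j, cls i = cls j → u i = u j) →
      ∫⁻ m, cutoffSum q m ∂(weightedMeasure η u) = t * ∫⁻ m, cutoffSum p m ∂(weightedMeasure η u)) :
    cutoffValue η q w = t.toReal * cutoffValue η p w := by
  unfold cutoffValue
  rw [h _ fun i j hij => by rw [hw i j hij], h _ fun i j hij => by rw [hw i j hij],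
    h _ fun i j hij => by rw [hw i j hij], h _ fun i j hij => by rw [hw i j hij]]
  simp only [ENNReal.toReal_mul]
  push_cast
  ring

end QuotientIntegral

/-! ### Measures on flow orbits -/

section OrbitMeasure

variable {E : Type*} [NormedAddCommGroup E] [NormedSpace ℝ E]
  {M : Type*} [TopologicalSpace M] [ChartedSpace E M] {φ : ℝ → M → M}

/-- The Lebesgue measure on the flow orbit of `m`, as a measure on `M`. -/
noncomputable def orbitMeasure {M : Type*} [MeasurableSpace M] (φ : ℝ → M → M) (m : M) : Measure M :=
  (volume.restrict (fundamentalInterval fun t => φ t m)).map fun t => φ t m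

theorem fundamentalInterval_congr {γ γ' : ℝ → M} (h : ∀ T, γ T = γ 0 ↔ γ' T = γ' 0) :
    fundamentalInterval γ = fundamentalInterval γ' := by
  unfold fundamentalInterval
  by_cases hp : ∃ T > 0, γ' T = γ' 0
  · rw [if_pos hp, if_pos (by simpa only [h] using hp)]
    simp only [h]
  · rw [if_neg hp, if_neg (by simpa only [h] using hp)]

theorem IsSmoothFlow.map_eq_iff (hφ : IsSmoothFlow E φ) (s t : ℝ) (m : M) :
    φ t (φ s m) = φ s m ↔ φ t m = m := by
  rw [hφ.map_comm]
  exact ⟨fun h => by rw [← hφ.map_neg_map s (φ t m), h, hφ.map_neg_map], fun h => by rw [h]⟩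

variable [MeasurableSpace M] [BorelSpace M] [T2Space M]

/-- For a periodic orbit, the set of times spent in `S` is periodic, and any two half-open intervals
whose length is the period are fundamental domains for the group of multiples of the period.
Otherwise this is translation invariance of Lebesgue measure. -/
theorem orbitMeasure_flow (hφ : IsSmoothFlow E φ) (s : ℝ) (m : M) :
    orbitMeasure φ (φ s m) = orbitMeasure φ m := by
  have hI : (fundamentalInterval fun t => φ t (φ s m)) = fundamentalInterval fun t => φ t m :=
    fundamentalInterval_congr fun T => by simp only [hφ.map_zero, hφ.map_eq_iff]
  have hc := hφ.continuous_curve m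
  have hshift : Measurable fun t : ℝ => t + s := measurable_add_const s
  unfold orbitMeasure
  rw [hI]
  have h1 : (fun t => φ t (φ s m)) = (fun t => φ t m) ∘ fun t => t + s := by
    ext t
    simp [hφ.map_add]
  ext S hS
  rw [h1, Measure.map_apply (hc.measurable.comp hshift) hS, Measure.map_apply hc.measurable hS,
    Set.preimage_comp, Measure.restrict_apply (hshift (hc.measurable hS)),
    Measure.restrict_apply (hc.measurable hS)]
  set P : Set ℝ := (fun t => φ t m) ⁻¹' S with hP
  have hPm : MeasurableSet P := hc.measurable hS
  unfold fundamentalInterval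
  split_ifs with h
  · set Q : Set ℝ := {T : ℝ | 0 < T ∧ φ T m = φ 0 m} with hQ
    have hne : Q.Nonempty := by
      obtain ⟨T, hT, hT'⟩ := h
      exact ⟨T, hT, hT'⟩
    have hbd : BddBelow Q := ⟨0, fun T hT => hT.1.le⟩
    set T := sInf Q with hTdef
    have hTm : φ T m = m := by
      have hcl : IsClosed {T : ℝ | φ T m = φ 0 m} := isClosed_eq hc continuous_const
      have h2 : T ∈ closure Q := csInf_mem_closure hne hbd
      have h3 := (closure_minimal (fun t ht => ht.2 : Q ⊆ {T : ℝ | φ T m = φ 0 m}) hcl) h2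
      change φ T m = φ 0 m at h3
      rwa [hφ.map_zero] at h3
    rcases (Real.sInf_nonneg fun t (ht : t ∈ Q) => ht.1.le).eq_or_lt with h0 | h0
    -- If the infimum of the periods is zero, `fundamentalInterval` is empty and both measures
    -- vanish.
    · rw [← hTdef] at h0
      rw [← h0]
      simp
    · have hfd := isAddFundamentalDomain_Ioc h0 0
      have hfd' := isAddFundamentalDomain_Ioc h0 s
      have hinv : ∀ g : AddSubgroup.zmultiples T, (fun x : ℝ => g +ᵥ x) ⁻¹' P = P := by
        rintro ⟨_, n, rfl⟩
        have hn : φ (n • T) m = m := by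
          have hper : Function.Periodic (fun t => φ t m) T := fun t => by
            simp only [hφ.map_add, hTm]
          have := hper.zsmul n 0
          simpa [hφ.map_zero] using this
        ext t
        simp only [Set.mem_preimage, hP]
        change φ (n • T + t) m ∈ S ↔ _
        rw [add_comm, hφ.map_add, hn]
      have h4 := hfd'.measure_set_eq hfd hPm hinv
      have h5 : (fun t : ℝ => t + s) ⁻¹' P ∩ Set.Ico 0 T =
          (fun t : ℝ => t + s) ⁻¹' (P ∩ Set.Ico s (s + T)) := by
        ext t
        simp only [Set.mem_inter_iff, Set.mem_preimage, Set.mem_Ico]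
        constructor <;> rintro ⟨h1, h2, h3⟩ <;> refine ⟨h1, ?_, ?_⟩ <;> linarith
      rw [h5, measure_preimage_add_right]
      have h6 : ∀ a b : ℝ, volume (P ∩ Set.Ico a b) = volume (P ∩ Set.Ioc a b) := fun a b =>
        measure_congr ((ae_eq_refl P).inter Ico_ae_eq_Ioc)
      rw [h6, h6, h4, zero_add]
  · simp only [Set.inter_univ]
    exact measure_preimage_add_right volume s P

variable {G : Type*} [Group G] [MulAction G M] [ContinuousConstSMul G M]

theorem orbitMeasure_smul (hφ : IsSmoothFlow E φ)
    (hequiv : ∀ (t : ℝ) (x : G) (m : M), φ t (x • m) = x • φ t m) (x : G) (m : M) :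
    orbitMeasure φ (x • m) = (orbitMeasure φ m).map (x • ·) := by
  have hI : (fundamentalInterval fun t => φ t (x • m)) = fundamentalInterval fun t => φ t m :=
    fundamentalInterval_congr fun T => by simp only [hφ.map_zero, hequiv, smul_left_cancel_iff]
  unfold orbitMeasure
  rw [hI, Measure.map_map (continuous_const_smul x).measurable (hφ.continuous_curve m).measurable]
  congr 1
  ext t
  exact hequiv t x m

theorem primitivePeriod_eq (hφ : IsSmoothFlow E φ) {χ : M → ℝ} (hχ : Continuous χ)
    [SecondCountableTopology M] (m : M) :
    primitivePeriod χ (fun t => φ t m) = ∫ p, χ p ∂(orbitMeasure φ m) := by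
  rw [primitivePeriod, orbitMeasure, integral_map (hφ.continuous_curve m).measurable.aemeasurable
    hχ.aestronglyMeasurable]

/-- A periodic orbit has finite total measure. On a nonperiodic one the flow is injective in time,
so `t = t'` and the visits to `U` take place in `(-1, 1)`. -/
theorem orbitMeasure_lt_top (hφ : IsSmoothFlow E φ) {p : M} {U : Set M} (hU : IsOpen U)
    (h : ∀ t, φ t p ∈ U → ∃ t', |t'| < 1 ∧ φ t p = φ t' p) : orbitMeasure φ p U < ⊤ := by
  have hc := hφ.continuous_curve p
  rw [orbitMeasure, Measure.map_apply hc.measurable hU.measurableSet,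
    Measure.restrict_apply (hc.measurable hU.measurableSet)]
  unfold fundamentalInterval
  split_ifs with hper
  · exact (measure_mono Set.inter_subset_right).trans_lt measure_Ico_lt_top
  · refine (measure_mono (t := Set.Ioo (-1) 1) ?_).trans_lt measure_Ioo_lt_top
    rintro t ⟨ht, -⟩
    obtain ⟨t', h1, h2⟩ := h t ht
    have h3 : ∀ r : ℝ, φ r p = p → r ≤ 0 := fun r hr => by
      by_contra hlt
      exact hper ⟨r, not_le.1 hlt, by simp only [hr, hφ.map_zero]⟩
    have h4 : φ (t - t') p = p := by
      rw [sub_eq_add_neg, add_comm, hφ.map_add, h2, hφ.map_neg_map]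
    have h5 : φ (t' - t) p = p := by
      rw [sub_eq_add_neg, add_comm, hφ.map_add, ← h2, hφ.map_neg_map]
    have h6 : t = t' := by linarith [h3 _ h4, h3 _ h5]
    rw [h6]
    exact abs_lt.1 h1

theorem orbitMeasure_eq_zero (hφ : IsSmoothFlow E φ) {p : M} {U : Set M} (hU : MeasurableSet U)
    (h : ∀ t, φ t p ∉ U) : orbitMeasure φ p U = 0 := by
  rw [orbitMeasure, Measure.map_apply (hφ.continuous_curve p).measurable hU]
  have : (fun t => φ t p) ⁻¹' U = ∅ := by
    ext t
    simp [h t]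
  rw [this, measure_empty]

end OrbitMeasure

/-! ### Periodic flow orbits -/

section OrbitIndex

variable {E : Type*} [NormedAddCommGroup E] [NormedSpace ℝ E]
  {M : Type*} [TopologicalSpace M] [ChartedSpace E M] {φ : ℝ → M → M}
  {G : Type*} [Group G] [MulAction G M] {g : G} {L : Set ℝ}

/-- The pairs of a number `l ∈ L` and a flow orbit whose points satisfy `φ_l(m) = g m`. -/
def OrbitIndex (φ : ℝ → M → M) (g : G) (L : Set ℝ) : Type _ :=
  {i : ℝ × Set M // i.1 ∈ L ∧ ∃ m, φ i.1 m = g • m ∧ i.2 = Set.range fun t => φ t m}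

namespace OrbitIndex

/-- The time that corresponds to an orbit index. -/
def time (i : OrbitIndex φ g L) : ℝ := i.1.1

/-- The flow orbit that corresponds to an orbit index. -/
def orbit (i : OrbitIndex φ g L) : Set M := i.1.2

/-- A point on a flow orbit. -/
noncomputable def point (i : OrbitIndex φ g L) : M := i.2.2.choose

theorem time_mem (i : OrbitIndex φ g L) : i.time ∈ L := i.2.1

theorem flow_point (i : OrbitIndex φ g L) : φ i.time i.point = g • i.point :=
  i.2.2.choose_spec.1

theorem orbit_eq (i : OrbitIndex φ g L) : i.orbit = Set.range fun t => φ t i.point :=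
  i.2.2.choose_spec.2

theorem ext {i j : OrbitIndex φ g L} (h : i.time = j.time) (h' : i.orbit = j.orbit) : i = j :=
  Subtype.ext (Prod.ext h h')

/-- The index of the flow orbit of a point. -/
def mk (l : ℝ) (hl : l ∈ L) (m : M) (hm : φ l m = g • m) : OrbitIndex φ g L :=
  ⟨(l, Set.range fun t => φ t m), hl, m, hm, rfl⟩

/-- The measure on a flow orbit. -/
noncomputable def measure [MeasurableSpace M] (i : OrbitIndex φ g L) : Measure M :=
  orbitMeasure φ i.point

/-- The class of a flow orbit under the action of the centraliser of `g`. -/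
def cls (i : OrbitIndex φ g L) : ℝ × Set (Set M) :=
  (i.time, {S | ∃ z ∈ Subgroup.centralizer ({g} : Set G), S = (fun m => z • m) '' i.orbit})

theorem exists_of_cls_eq {i j : OrbitIndex φ g L} (h : i.cls = j.cls) :
    i.time = j.time ∧ ∃ z ∈ Subgroup.centralizer ({g} : Set G),
      i.orbit = (fun m => z • m) '' j.orbit := by
  have h0 := congrArg Prod.fst h
  refine ⟨h0, ?_⟩
  have h1 : i.orbit ∈ i.cls.2 := ⟨1, one_mem _, by simp⟩
  rw [h] at h1
  exact h1

theorem exists_flow_eq (i : OrbitIndex φ g L) {m : M}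
    (hm : m ∈ i.orbit) : ∃ s, m = φ s i.point := by
  rw [i.orbit_eq] at hm
  obtain ⟨s, rfl⟩ := hm
  exact ⟨s, rfl⟩

theorem point_mem (hφ : IsSmoothFlow E φ) (i : OrbitIndex φ g L) : i.point ∈ i.orbit := by
  rw [i.orbit_eq]
  exact ⟨0, hφ.map_zero _⟩

theorem exists_point_eq (hφ : IsSmoothFlow E φ)
    (hequiv : ∀ (t : ℝ) (x : G) (m : M), φ t (x • m) = x • φ t m) {i j : OrbitIndex φ g L}
    (h : i.cls = j.cls) : i.time = j.time ∧ ∃ z ∈ Subgroup.centralizer ({g} : Set G), ∃ s,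
      i.point = φ s (z • j.point) := by
  obtain ⟨h1, z, hz, h2⟩ := exists_of_cls_eq h
  refine ⟨h1, z, hz, ?_⟩
  have h3 := i.point_mem hφ
  rw [h2, j.orbit_eq] at h3
  obtain ⟨_, ⟨s, rfl⟩, h4⟩ := h3
  exact ⟨s, by rw [hequiv]; exact h4.symm⟩

theorem orbit_eq_range (hφ : IsSmoothFlow E φ) (i : OrbitIndex φ g L) {m : M}
    (hm : m ∈ i.orbit) : i.orbit = Set.range fun t => φ t m := by
  obtain ⟨s, rfl⟩ := i.exists_flow_eq hm
  rw [i.orbit_eq]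
  ext p
  constructor
  · rintro ⟨t, rfl⟩
    refine ⟨t - s, ?_⟩
    simp only
    rw [← hφ.map_add, sub_add_cancel]
  · rintro ⟨t, rfl⟩
    exact ⟨t + s, hφ.map_add t s _⟩

theorem flow_eq_of_mem (hφ : IsSmoothFlow E φ)
    (hequiv : ∀ (t : ℝ) (x : G) (m : M), φ t (x • m) = x • φ t m) (i : OrbitIndex φ g L) {m : M}
    (hm : m ∈ i.orbit) : φ i.time m = g • m := by
  obtain ⟨s, rfl⟩ := i.exists_flow_eq hm
  rw [hφ.map_comm, i.flow_point, hequiv]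

/-- The action of the centraliser on flow orbits. -/
def translate (hequiv : ∀ (t : ℝ) (x : G) (m : M), φ t (x • m) = x • φ t m)
    (z : Subgroup.centralizer ({g} : Set G)) (i : OrbitIndex φ g L) : OrbitIndex φ g L :=
  ⟨(i.time, (fun m => (z : G) • m) '' i.orbit), i.time_mem, (z : G) • i.point, by
    constructor
    · simp only
      rw [hequiv, i.flow_point, smul_smul, smul_smul,
        Subgroup.mem_centralizer_singleton_iff.1 z.2]
    · simp only
      rw [i.orbit_eq, ← Set.range_comp]
      congr 1
      ext1 t
      exact (hequiv t z i.point).symm⟩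

variable [MeasurableSpace M] [BorelSpace M] [T2Space M]

theorem measure_eq (hφ : IsSmoothFlow E φ) (i : OrbitIndex φ g L) {m : M} (hm : m ∈ i.orbit) :
    i.measure = orbitMeasure φ m := by
  obtain ⟨s, rfl⟩ := i.exists_flow_eq hm
  exact (orbitMeasure_flow hφ s i.point).symm

theorem isPermutedBy [ContinuousConstSMul G M] (hφ : IsSmoothFlow E φ)
    (hequiv : ∀ (t : ℝ) (x : G) (m : M), φ t (x • m) = x • φ t m) :
    IsPermutedBy (Subgroup.centralizer ({g} : Set G)) (measure (φ := φ) (g := g) (L := L)) cls := by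
  intro z
  refine ⟨⟨translate hequiv z, translate hequiv z⁻¹, fun i => ?_, fun i => ?_⟩, fun i => ⟨?_, ?_⟩⟩
  · refine ext rfl ?_
    change (fun m => ((z⁻¹ : Subgroup.centralizer ({g} : Set G)) : G) • m) ''
      ((fun m => (z : G) • m) '' i.orbit) = i.orbit
    simp [Set.image_image]
  · refine ext rfl ?_
    change (fun m => (z : G) • m) ''
      ((fun m => ((z⁻¹ : Subgroup.centralizer ({g} : Set G)) : G) • m) '' i.orbit) = i.orbit
    simp [Set.image_image]
  · have h1 : (z : G) • i.point ∈ (translate hequiv z i).orbit := ⟨_, i.point_mem hφ, rfl⟩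
    exact ((translate hequiv z i).measure_eq hφ h1).trans (orbitMeasure_smul hφ hequiv _ _)
  · refine Prod.ext rfl ?_
    ext S
    constructor
    · rintro ⟨y, hy, rfl⟩
      refine ⟨y * z, mul_mem hy z.2, ?_⟩
      change (fun m => y • m) '' ((fun m => (z : G) • m) '' i.orbit) = _
      simp [Set.image_image, mul_smul]
    · rintro ⟨y, hy, rfl⟩
      refine ⟨y * (z : G)⁻¹, mul_mem hy (inv_mem z.2), ?_⟩
      change _ = (fun m => (y * (z : G)⁻¹) • m) '' ((fun m => (z : G) • m) '' i.orbit)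
      simp [Set.image_image, mul_smul]

/-- Locally, there is at most one orbit with a given time. -/
theorem exists_isolating_nhd [FiniteDimensional ℝ E] [IsManifold 𝓘(ℝ, E) ∞ M]
    [ContinuousConstSMul G M] (hφ : IsSmoothFlow E φ)
    (hsmooth : ∀ x : G, ContMDiff 𝓘(ℝ, E) 𝓘(ℝ, E) ∞ (fun m : M => x • m))
    (hequiv : ∀ (t : ℝ) (x : G) (m : M), φ t (x • m) = x • φ t m)
    (hnd : Nondegenerate E φ g) (l : ℝ) (hl : l ≠ 0) (p : M) :
    ∃ U, IsOpen U ∧ p ∈ U ∧ ∃ S : Set M, ∀ i : OrbitIndex φ g L, i.time = l →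
      i.measure U < ⊤ ∧ (i.orbit ≠ S → Disjoint i.orbit U ∧ i.measure U = 0) := by
  have hzero : ∀ (i : OrbitIndex φ g L) {U : Set M}, IsOpen U → Disjoint i.orbit U →
      i.measure U = 0 := fun i U hU hd => orbitMeasure_eq_zero hφ hU.measurableSet fun t ht =>
    Set.disjoint_left.1 hd (by rw [i.orbit_eq]; exact ⟨t, rfl⟩) ht
  -- Near a solution `p` all solutions lie on the orbit of `p`. Near any other point there are none,
  -- as the set of solutions is closed.
  by_cases hp : φ l p = g • p
  · obtain ⟨U, hU, hUo, hpU⟩ := eventually_nhds_iff.1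
      (eventually_mem_orbit_of_fixed hφ hsmooth hequiv hp (hnd l p hl hp))
    refine ⟨U, hUo, hpU, Set.range fun t => φ t p, ?_⟩
    rintro i rfl
    by_cases h : p ∈ i.orbit
    · refine ⟨?_, fun h' => absurd (i.orbit_eq_range hφ h) h'⟩
      rw [i.measure_eq hφ h]
      refine orbitMeasure_lt_top hφ hUo fun t ht => ?_
      refine hU _ ht (i.flow_eq_of_mem hφ hequiv ?_)
      rw [i.orbit_eq_range hφ h]
      exact ⟨t, rfl⟩
    · have hd : Disjoint i.orbit U := by
        refine Set.disjoint_left.2 fun q hq hqU => h ?_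
        obtain ⟨t, -, rfl⟩ := hU q hqU (i.flow_eq_of_mem hφ hequiv hq)
        rw [i.orbit_eq_range hφ hq]
        exact ⟨-t, hφ.map_neg_map t p⟩
      have h0 := hzero i hUo hd
      exact ⟨by rw [h0]; exact ENNReal.zero_lt_top, fun _ => ⟨hd, h0⟩⟩
  · have hUo : IsOpen {q : M | φ l q ≠ g • q} :=
      isOpen_ne_fun (hφ.contMDiff_map l).continuous (continuous_const_smul g)
    refine ⟨_, hUo, hp, ∅, ?_⟩
    rintro i rfl
    have hd : Disjoint i.orbit {q : M | φ i.time q ≠ g • q} :=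
      Set.disjoint_left.2 fun q hq hqU => hqU (i.flow_eq_of_mem hφ hequiv hq)
    have h0 := hzero i hUo hd
    exact ⟨by rw [h0]; exact ENNReal.zero_lt_top, fun _ => ⟨hd, h0⟩⟩


end OrbitIndex

end OrbitIndex

/-! ### Finiteness properties of periodic flow orbits -/

section Finiteness

open scoped NNReal

variable {E : Type*} [NormedAddCommGroup E] [NormedSpace ℝ E] [FiniteDimensional ℝ E]
  {M : Type*} [TopologicalSpace M] [ChartedSpace E M] [IsManifold 𝓘(ℝ, E) ∞ M] [T2Space M]
  [SecondCountableTopology M] {φ : ℝ → M → M}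
  {G : Type*} [Group G] [MulAction G M] [ContinuousConstSMul G M] {g : G} {L : Set ℝ}

namespace OrbitIndex

/-- For each length, countably many isolating neighbourhoods cover `M`, and each meets at most one
orbit. -/
theorem countable_of_nondegenerate (hφ : IsSmoothFlow E φ)
    (hsmooth : ∀ x : G, ContMDiff 𝓘(ℝ, E) 𝓘(ℝ, E) ∞ (fun m : M => x • m))
    (hequiv : ∀ (t : ℝ) (x : G) (m : M), φ t (x • m) = x • φ t m)
    (hnd : Nondegenerate E φ g) (hL0 : ∀ l ∈ L, l ≠ 0) (hL : L.Countable) :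
    Countable (OrbitIndex φ g L) := by
  let _ : MeasurableSpace M := borel M
  have : BorelSpace M := ⟨rfl⟩
  have key : ∀ l ∈ L, ∃ T : Set (Set M), T.Countable ∧
      ∀ i : OrbitIndex φ g L, i.time = l → i.orbit ∈ T := by
    intro l hl
    choose U hU hpU S hS using fun p : M =>
      exists_isolating_nhd (L := L) hφ hsmooth hequiv hnd l (hL0 l hl) p
    obtain ⟨s, hs, hs'⟩ := TopologicalSpace.countable_cover_nhds fun p => (hU p).mem_nhds (hpU p)
    refine ⟨S '' s, hs.image S, fun i hi => ?_⟩
    have h1 : i.point ∈ ⋃ p ∈ s, U p := hs' ▸ Set.mem_univ _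
    obtain ⟨p, hp, hpi⟩ := Set.mem_iUnion₂.1 h1
    refine ⟨p, hp, ?_⟩
    by_contra h
    exact Set.disjoint_left.1 ((hS p i hi).2 (Ne.symm h)).1 (i.point_mem hφ) hpi
  choose! T hT hT' using key
  have h1 : (⋃ l ∈ L, ({l} ×ˢ T l : Set (ℝ × Set M))).Countable :=
    hL.biUnion fun l hl => (Set.countable_singleton l).prod (hT l hl)
  have hmem : ∀ i : OrbitIndex φ g L, i.1 ∈ ⋃ l ∈ L, ({l} ×ˢ T l : Set (ℝ × Set M)) := fun i =>
    Set.mem_biUnion i.time_mem ⟨rfl, hT' i.time i.time_mem i rfl⟩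
  have := h1.to_subtype
  exact Function.Injective.countable (f := fun i : OrbitIndex φ g L =>
    (⟨i.1, hmem i⟩ : ↥(⋃ l ∈ L, ({l} ×ˢ T l : Set (ℝ × Set M))))) fun i j h =>
    Subtype.ext (Subtype.mk.inj h)

theorem finite_of_compactSpace [CompactSpace M] (hφ : IsSmoothFlow E φ)
    (hsmooth : ∀ x : G, ContMDiff 𝓘(ℝ, E) 𝓘(ℝ, E) ∞ (fun m : M => x • m))
    (hequiv : ∀ (t : ℝ) (x : G) (m : M), φ t (x • m) = x • φ t m)
    (hnd : Nondegenerate E φ g) {l : ℝ} (hl : l ≠ 0) :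
    Finite (OrbitIndex φ g ({l} : Set ℝ)) := by
  let _ : MeasurableSpace M := borel M
  have : BorelSpace M := ⟨rfl⟩
  choose U hU hpU S hS using fun p : M =>
    exists_isolating_nhd (L := ({l} : Set ℝ)) hφ hsmooth hequiv hnd l hl p
  obtain ⟨s, -, hs⟩ := isCompact_univ.elim_nhds_subcover U fun p _ => (hU p).mem_nhds (hpU p)
  have hT : ∀ i : OrbitIndex φ g ({l} : Set ℝ), i.time = l := fun i => i.time_mem
  have hmem : ∀ i : OrbitIndex φ g ({l} : Set ℝ), i.orbit ∈ S '' (s : Set M) := by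
    intro i
    obtain ⟨p, hp, hpi⟩ := Set.mem_iUnion₂.1 (hs (Set.mem_univ i.point))
    refine ⟨p, hp, ?_⟩
    by_contra h
    exact Set.disjoint_left.1 ((hS p i (hT i)).2 (Ne.symm h)).1 (i.point_mem hφ) hpi
  have hfin : Finite (S '' (s : Set M)) := (s.finite_toSet.image S).to_subtype
  exact Finite.of_injective
    (fun i : OrbitIndex φ g ({l} : Set ℝ) => (⟨i.orbit, hmem i⟩ : S '' (s : Set M)))
    fun i j h => ext ((hT i).trans (hT j).symm) (congrArg Subtype.val h)

variable [MeasurableSpace M] [BorelSpace M]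

theorem isFiniteMeasureOnCompacts (hφ : IsSmoothFlow E φ)
    (hsmooth : ∀ x : G, ContMDiff 𝓘(ℝ, E) 𝓘(ℝ, E) ∞ (fun m : M => x • m))
    (hequiv : ∀ (t : ℝ) (x : G) (m : M), φ t (x • m) = x • φ t m)
    (hnd : Nondegenerate E φ g) (hL0 : ∀ l ∈ L, l ≠ 0) (i : OrbitIndex φ g L) :
    IsFiniteMeasureOnCompacts i.measure := by
  have : IsLocallyFiniteMeasure i.measure := by
    refine ⟨fun p => ?_⟩
    obtain ⟨U, hU, hpU, S, hS⟩ := exists_isolating_nhd (L := L) hφ hsmooth hequiv hnd i.time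
      (hL0 _ i.time_mem) p
    exact ⟨U, hU.mem_nhds hpU, (hS i rfl).1⟩
  infer_instance

/-- All orbits in a class have the same time, so at most one of them contributes to the measure of
an isolating neighbourhood. -/
theorem isFiniteMeasureOnCompacts_classMeasure (hφ : IsSmoothFlow E φ)
    (hsmooth : ∀ x : G, ContMDiff 𝓘(ℝ, E) 𝓘(ℝ, E) ∞ (fun m : M => x • m))
    (hequiv : ∀ (t : ℝ) (x : G) (m : M), φ t (x • m) = x • φ t m)
    (hnd : Nondegenerate E φ g) (hL0 : ∀ l ∈ L, l ≠ 0) (j : OrbitIndex φ g L) :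
    IsFiniteMeasureOnCompacts (classMeasure (measure (φ := φ) (g := g) (L := L)) cls j) := by
  have : IsLocallyFiniteMeasure (classMeasure (measure (φ := φ) (g := g) (L := L)) cls j) := by
    refine ⟨fun p => ?_⟩
    obtain ⟨U, hU, hpU, S, hS⟩ := exists_isolating_nhd (L := L) hφ hsmooth hequiv hnd j.time
      (hL0 _ j.time_mem) p
    refine ⟨U, hU.mem_nhds hpU, ?_⟩
    rw [classMeasure, weightedMeasure, Measure.sum_apply _ hU.measurableSet]
    have hz : ∀ i : OrbitIndex φ g L, ¬ (i.time = j.time ∧ i.orbit = S) →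
        (classWeight cls j i • i.measure) U = 0 := by
      intro i hi
      by_cases h : cls i = cls j
      · have ht := (exists_of_cls_eq h).1
        rw [Measure.smul_apply, ((hS i ht).2 fun h' => hi ⟨ht, h'⟩).2, smul_zero]
      · simp [classWeight_of_ne h]
    by_cases hex : ∃ i₀ : OrbitIndex φ g L, i₀.time = j.time ∧ i₀.orbit = S
    · obtain ⟨i₀, ht, ho⟩ := hex
      rw [tsum_eq_single i₀ fun i hi => hz i fun h => hi (ext (h.1.trans ht.symm)
        (h.2.trans ho.symm)), Measure.smul_apply]
      refine lt_of_le_of_lt ?_ (hS i₀ ht).1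
      by_cases h : cls i₀ = cls j
      · simp [classWeight_of_eq h]
      · simp [classWeight_of_ne h]
    · rw [ENNReal.tsum_eq_zero.2 fun i => hz i fun h => hex ⟨i, h⟩]
      exact ENNReal.zero_lt_top
  infer_instance

end OrbitIndex

end Finiteness

/-! ### Finiteness of the cutoff integral on a class of orbits -/

section ClassFinite

open scoped NNReal

variable {E : Type*} [NormedAddCommGroup E] [NormedSpace ℝ E] [FiniteDimensional ℝ E]
  {M : Type*} [TopologicalSpace M] [ChartedSpace E M] [IsManifold 𝓘(ℝ, E) ∞ M] [T2Space M]
  [SecondCountableTopology M] [LocallyCompactSpace M] [MeasurableSpace M] [BorelSpace M]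
  {φ : ℝ → M → M}
  {G : Type*} [Group G] [TopologicalSpace G] [IsTopologicalGroup G] [T2Space G]
  [LocallyCompactSpace G] [MeasurableSpace G] [BorelSpace G]
  [MulAction G M] [ProperSMul G M] {g : G} {L : Set ℝ}

namespace OrbitIndex

/-- The element `g` of the centraliser moves the orbit along itself by time `l`, so a flow segment
of length `|l|` represents the whole class modulo the centraliser. The average `h` of a bump
function `f` that is one on this segment is therefore bounded below on the class, while `f` has
finite integral. -/
theorem lintegral_cutoffSum_classMeasure_lt_top (hφ : IsSmoothFlow E φ)
    (hsmooth : ∀ x : G, ContMDiff 𝓘(ℝ, E) 𝓘(ℝ, E) ∞ (fun m : M => x • m))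
    (hequiv : ∀ (t : ℝ) (x : G) (m : M), φ t (x • m) = x • φ t m)
    (hnd : Nondegenerate E φ g) (hL0 : ∀ l ∈ L, l ≠ 0) [Countable (OrbitIndex φ g L)]
    {β : Measure (Subgroup.centralizer ({g} : Set G))} [β.IsMulRightInvariant]
    [IsFiniteMeasureOnCompacts β] [β.IsOpenPosMeasure] [SFinite β] {p : ℕ → M → ℝ}
    (hp : IsCutoffSequence β p) (j : OrbitIndex φ g L) :
    ∫⁻ m, cutoffSum p m ∂(classMeasure (measure (φ := φ) (g := g) (L := L)) cls j) < ⊤ := by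
  have hfin := isFiniteMeasureOnCompacts (L := L) hφ hsmooth hequiv hnd hL0
  have hcfin := isFiniteMeasureOnCompacts_classMeasure hφ hsmooth hequiv hnd hL0 j
  have hZ : IsClosed (Subgroup.centralizer ({g} : Set G) : Set G) := Set.isClosed_centralizer _
  have hZp : ProperSMul (Subgroup.centralizer ({g} : Set G)) M :=
    properSMul_of_isClosedEmbedding (Subgroup.centralizer ({g} : Set G)).subtype
      hZ.isClosedEmbedding_subtypeVal fun _ _ => rfl
  have hZl : LocallyCompactSpace (Subgroup.centralizer ({g} : Set G)) :=
    hZ.isClosedEmbedding_subtypeVal.locallyCompactSpace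
  set γ : ℝ → M := fun t => φ t j.point with hγ
  have hγc : Continuous γ := hφ.continuous_curve _
  obtain ⟨f, hf1, -, hfs, hf0⟩ := exists_continuous_one_zero_of_isCompact
    ((isCompact_Icc (a := (0 : ℝ)) (b := |j.time|)).image hγc) isClosed_empty
    (Set.disjoint_empty _)
  have hf0' : ∀ m, 0 ≤ f m := fun m => (hf0 m).1
  let h : M → ℝ := fun m => ∫ b : Subgroup.centralizer ({g} : Set G), f (b • m) ∂β
  have hc : Continuous h := continuous_integral_smul f.continuous hfs
  have hinv : ∀ z ∈ Subgroup.centralizer ({g} : Set G), ∀ m, h (z • m) = h m := by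
    intro z hz m
    have := integral_mul_right_eq_self (μ := β)
      (fun b : Subgroup.centralizer ({g} : Set G) => f (b • m)) ⟨z, hz⟩
    simp only [mul_smul] at this
    exact this
  have hpos : ∀ t ∈ Set.Icc 0 |j.time|, 0 < h (γ t) := by
    intro t ht
    refine Continuous.integral_pos_of_hasCompactSupport_nonneg_nonzero
      (x := (1 : Subgroup.centralizer ({g} : Set G))) ?_
      (hasCompactSupport_smul hfs _) (fun b => hf0' _) ?_
    · exact f.continuous.comp (continuous_id.smul continuous_const)
    · rw [one_smul, hf1 ⟨t, ht, rfl⟩]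
      exact one_ne_zero
  have hgZ : g ∈ Subgroup.centralizer ({g} : Set G) := Subgroup.mem_centralizer_singleton_iff.2 rfl
  -- Flowing by `j.time` amounts to acting by `g`, under which `h` is invariant.
  have hper0 : Function.Periodic (fun t => h (γ t)) j.time := by
    intro t
    simp only [hγ]
    rw [hφ.map_add, j.flow_point, hequiv, hinv g hgZ]
  have hper : Function.Periodic (fun t => h (γ t)) |j.time| := by
    rcases abs_choice j.time with h' | h'
    · rw [h']
      exact hper0
    · rw [h']
      exact hper0.neg
  obtain ⟨t₀, ht₀, hmin⟩ := (isCompact_Icc (a := (0 : ℝ)) (b := |j.time|)).exists_isMinOn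
    ⟨0, le_rfl, abs_nonneg _⟩ (hc.comp hγc).continuousOn
  have hle : ∀ t, h (γ t₀) ≤ h (γ t) := by
    intro t
    obtain ⟨t', ht', heq⟩ := hper.exists_mem_Ico₀ (abs_pos.2 (hL0 _ j.time_mem)) t
    rw [show h (γ t) = h (γ t') from heq]
    exact hmin (Set.Ico_subset_Icc_self ht')
  have hinvm : ∀ b : Subgroup.centralizer ({g} : Set G),
      (classMeasure (measure (φ := φ) (g := g) (L := L)) cls j).map (b • ·) =
        classMeasure (measure (φ := φ) (g := g) (L := L)) cls j := fun b =>
    (isPermutedBy hφ hequiv).weightedMeasure_map (fun _ _ => classWeight_congr j) b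
  have hsf : SFinite (classMeasure (measure (φ := φ) (g := g) (L := L)) cls j) := by
    unfold classMeasure
    infer_instance
  refine hp.lintegral_cutoffSum_lt_top hinvm (f := fun m => ENNReal.ofReal (f m))
    f.continuous.measurable.ennreal_ofReal ?_
    (δ := ENNReal.ofReal (h (γ t₀))) (ENNReal.ofReal_pos.2 (hpos t₀ ht₀)).ne' ?_
  · rw [← ofReal_integral_eq_lintegral_ofReal (f.continuous.integrable_of_hasCompactSupport hfs)
      (Eventually.of_forall hf0')]
    exact ENNReal.ofReal_ne_top
  · have hh : ∀ m, ∫⁻ b : Subgroup.centralizer ({g} : Set G), ENNReal.ofReal (f (b • m)) ∂β =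
        ENNReal.ofReal (h m) := by
      intro m
      refine (ofReal_integral_eq_lintegral_ofReal ?_ (Eventually.of_forall fun b => hf0' _)).symm
      exact (f.continuous.comp
        (continuous_id.smul continuous_const)).integrable_of_hasCompactSupport
        (hasCompactSupport_smul hfs m)
    simp only [hh]
    have hm : MeasurableSet {m | ENNReal.ofReal (h (γ t₀)) ≤ ENNReal.ofReal (h m)} :=
      measurableSet_le measurable_const hc.measurable.ennreal_ofReal
    -- The bound is checked on each summand: members of the class are centraliser translates of the
    -- orbit of `j`, and the other orbits have weight zero.
    change ∀ᵐ m ∂(Measure.sum fun i : OrbitIndex φ g L =>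
      classWeight cls j i • i.measure), _
    rw [Measure.ae_sum_iff' hm]
    intro i
    by_cases hij : cls i = cls j
    · rw [classWeight_of_eq hij, one_smul]
      unfold measure orbitMeasure
      rw [ae_map_iff (hφ.continuous_curve _).measurable.aemeasurable hm]
      refine Eventually.of_forall fun t => ENNReal.ofReal_le_ofReal ?_
      obtain ⟨-, z, hz, s, hs⟩ := exists_point_eq hφ hequiv hij
      rw [hs, ← hφ.map_add, hequiv, hinv z hz]
      exact hle _
    · rw [classWeight_of_ne hij, zero_smul]
      simp

end OrbitIndex

end ClassFinite

/-! ### The terms of the zeta function as integrals over flow orbits -/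

section Amplitude

variable {E : Type*} [NormedAddCommGroup E] [NormedSpace ℝ E]
  {M : Type*} [TopologicalSpace M] [ChartedSpace E M] [IsManifold 𝓘(ℝ, E) ∞ M]
  {W : Type*} [NormedAddCommGroup W] [NormedSpace ℂ W] [FiniteDimensional ℂ W]
  {V : M → Type*} [TopologicalSpace (TotalSpace W V)]
  [∀ m, AddCommGroup (V m)] [∀ m, Module ℂ (V m)] [∀ m, TopologicalSpace (V m)]
  [∀ m, IsTopologicalAddGroup (V m)] [∀ m, ContinuousSMul ℝ (V m)]
  [FiberBundle W V] [VectorBundle ℂ W V] [VectorBundle ℝ W V]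
  [ContMDiffVectorBundle ∞ W V 𝓘(ℝ, E)]
  {G : Type*} [Group G] [TopologicalSpace G] [MulAction G M]
  (A : BundleAction E G W V) (D : CovariantDerivative 𝓘(ℝ, E) W V) {φ : ℝ → M → M}

variable (φ) in
/-- The number `sgn(det(1 - P)) tr(ρ)` for the flow curve through `m`. -/
noncomputable def amplitudeAt (x : G) (l : ℝ) (m : M) : ℂ :=
  (Real.sign (LinearMap.det (1 - poincareMap E φ x l m)) : ℂ) *
    LinearMap.trace ℂ (V (φ 0 m)) (holonomy A D x l fun t => φ t m)

variable {A D}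

theorem amplitudeAt_conj (hφ : IsSmoothFlow E φ)
    (hsmooth : ∀ x : G, ContMDiff 𝓘(ℝ, E) 𝓘(ℝ, E) ∞ (fun m : M => x • m))
    (hequiv : ∀ (t : ℝ) (x : G) (m : M), φ t (x • m) = x • φ t m)
    (hflat : IsFlat D) (hinv : IsInvariantConnection A D) {x : G} {l : ℝ} {m : M} (h : G) (s : ℝ)
    (hm : φ l m = x • m) :
    amplitudeAt A D φ (h * x * h⁻¹) l (φ s (h • m)) = amplitudeAt A D φ x l m := by
  unfold amplitudeAt
  rw [det_poincareMap_conj hφ hsmooth hequiv s hm]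
  congr 1
  exact trace_holonomy_conj hφ hsmooth hequiv hflat hinv h s hm

variable {g : G} {L : Set ℝ}

variable (A D) in
/-- The coefficient of the integral over a flow orbit in the zeta function. -/
noncomputable def OrbitIndex.weight (σ : ℂ) (i : OrbitIndex φ g L) : ℂ :=
  lengthFactor σ i.time * amplitudeAt A D φ g i.time i.point

/-- Orbits in one class differ by some `z` that commutes with `g`, and conjugation by `z` leaves `g`
unchanged in `amplitudeAt_conj`. -/
theorem OrbitIndex.weight_congr (hφ : IsSmoothFlow E φ)
    (hsmooth : ∀ x : G, ContMDiff 𝓘(ℝ, E) 𝓘(ℝ, E) ∞ (fun m : M => x • m))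
    (hequiv : ∀ (t : ℝ) (x : G) (m : M), φ t (x • m) = x • φ t m)
    (hflat : IsFlat D) (hinv : IsInvariantConnection A D) (σ : ℂ) {i j : OrbitIndex φ g L}
    (h : i.cls = j.cls) : i.weight A D σ = j.weight A D σ := by
  obtain ⟨h1, z, hz, s, hs⟩ := OrbitIndex.exists_point_eq hφ hequiv h
  have h2 : z * g * z⁻¹ = g := by
    rw [Subgroup.mem_centralizer_singleton_iff.1 hz, mul_inv_cancel_right]
  have h3 := amplitudeAt_conj hφ hsmooth hequiv hflat hinv z s j.flow_point
  rw [h2] at h3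
  rw [OrbitIndex.weight, OrbitIndex.weight, h1, hs, h3]

/-- Classes of periodic flow curves for a conjugate of `g` correspond to flow orbits. -/
noncomputable def curveClassToOrbit (hequiv : ∀ (t : ℝ) (x : G) (m : M), φ t (x • m) = x • φ t m)
    (L : Set ℝ) (h : G) (q : Σ l : L, CurveClass φ (h * g * h⁻¹) (l : ℝ)) : OrbitIndex φ g L :=
  OrbitIndex.mk q.1 q.1.2 (h⁻¹ • q.2.rep.1 0) (by
    rw [hequiv, ← q.2.rep.2.1, q.2.rep.2.2, smul_smul, smul_smul]
    simp [mul_assoc])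

/-- Curves with the same orbit differ by a time shift, and `h` carries solutions of `φ l m = g • m`
to solutions for the conjugate. Thus the index set of the sum becomes the same for all cosets. -/
theorem curveClassToOrbit_bijective (hφ : IsSmoothFlow E φ)
    (hequiv : ∀ (t : ℝ) (x : G) (m : M), φ t (x • m) = x • φ t m) (L : Set ℝ) (h : G) :
    Function.Bijective (curveClassToOrbit (g := g) hequiv L h) := by
  constructor
  · rintro ⟨l, c⟩ ⟨l', c'⟩ heq
    have hl : l = l' := Subtype.ext (congrArg OrbitIndex.time heq)
    subst hl
    have ho : Set.range (fun t => φ t (h⁻¹ • c.rep.1 0)) =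
        Set.range fun t => φ t (h⁻¹ • c'.rep.1 0) := congrArg OrbitIndex.orbit heq
    have hmem : h⁻¹ • c'.rep.1 0 ∈ Set.range fun t => φ t (h⁻¹ • c.rep.1 0) := by
      rw [ho]
      exact ⟨0, hφ.map_zero _⟩
    obtain ⟨s, hs⟩ := hmem
    simp only [hequiv, smul_left_cancel_iff] at hs
    have hcc : c = c' := by
      rw [← Quotient.out_eq c, ← Quotient.out_eq c']
      refine Quotient.sound ⟨s, fun t => ?_⟩
      change c'.rep.1 t = c.rep.1 (t + s)
      rw [c'.rep.2.1 t, c.rep.2.1 (t + s), hφ.map_add, hs]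
    rw [hcc]
  · intro i
    have hflow : IsFlowCurve φ fun t => φ t (h • i.point) := fun t => by
      simp only
      rw [hφ.map_zero]
    let c : CurveClass φ (h * g * h⁻¹) i.time := Quotient.mk _ ⟨fun t => φ t (h • i.point), hflow, by
      simp only
      rw [hφ.map_zero, hequiv, i.flow_point, smul_smul, smul_smul, inv_mul_cancel_right]⟩
    refine ⟨⟨⟨i.time, i.time_mem⟩, c⟩, ?_⟩
    obtain ⟨s, hs⟩ := Quotient.exact (Quotient.out_eq c)
    have hs' : ∀ t, φ t (h • i.point) = c.rep.1 (t + s) := hs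
    have h1 : h⁻¹ • c.rep.1 0 ∈ i.orbit := by
      rw [i.orbit_eq]
      refine ⟨-s, ?_⟩
      have h2 := hs' (-s)
      rw [neg_add_cancel] at h2
      simp only
      rw [← h2, hequiv, inv_smul_smul]
    refine OrbitIndex.ext rfl ?_
    exact (i.orbit_eq_range hφ h1).symm

variable [MeasurableSpace M] [BorelSpace M] [T2Space M] [SecondCountableTopology M]
  [ContinuousConstSMul G M]

/-- By conjugation invariance, `h` survives only in the primitive period, as a translation inside
`χ`. -/
theorem curveTerm_eq (hφ : IsSmoothFlow E φ)
    (hsmooth : ∀ x : G, ContMDiff 𝓘(ℝ, E) 𝓘(ℝ, E) ∞ (fun m : M => x • m))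
    (hequiv : ∀ (t : ℝ) (x : G) (m : M), φ t (x • m) = x • φ t m)
    (hflat : IsFlat D) (hinv : IsInvariantConnection A D) {χ : M → ℝ} (hχ : Continuous χ) (h : G)
    (q : Σ l : L, CurveClass φ (h * g * h⁻¹) (l : ℝ)) :
    curveTerm A D φ χ (h * g * h⁻¹) q.1 q.2 =
      amplitudeAt A D φ g (curveClassToOrbit hequiv L h q).time
        (curveClassToOrbit hequiv L h q).point *
      (∫ m, χ (h • m) ∂(curveClassToOrbit hequiv L h q).measure : ℝ) := by
  set i := curveClassToOrbit hequiv L h q with hi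
  have htime : (q.1 : ℝ) = i.time := rfl
  -- Generalising over `γ` lets the representative be replaced by `t ↦ φ t m` in types that depend
  -- on it.
  have hgen : ∀ (x : G) (l : ℝ) (m : M) (γ : ℝ → M), γ = (fun t => φ t m) →
      (Real.sign (LinearMap.det (1 - poincareMap E φ x l (γ 0))) : ℂ) *
        LinearMap.trace ℂ (V (γ 0)) (holonomy A D x l γ) * (primitivePeriod χ γ : ℂ) =
      amplitudeAt A D φ x l m * (∫ p, χ p ∂(orbitMeasure φ m) : ℝ) := by
    rintro x l m γ rfl
    have hdet : ∀ m', m' = m → LinearMap.det (1 - poincareMap E φ x l m') =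
        LinearMap.det (1 - poincareMap E φ x l m) := by
      rintro _ rfl
      rfl
    rw [primitivePeriod_eq hφ hχ, amplitudeAt, hdet _ (hφ.map_zero m)]
  have h1 : h⁻¹ • q.2.rep.1 0 ∈ i.orbit := ⟨0, hφ.map_zero _⟩
  obtain ⟨s, hs⟩ := i.exists_flow_eq h1
  have h2 : q.2.rep.1 0 = φ s (h • i.point) := by
    rw [hequiv, ← hs, smul_inv_smul]
  rw [curveTerm, hgen _ _ (φ s (h • i.point)) q.2.rep.1 (by
    ext t
    rw [q.2.rep.2.1 t, h2]), htime,
    amplitudeAt_conj hφ hsmooth hequiv hflat hinv h s i.flow_point, orbitMeasure_flow hφ,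
    orbitMeasure_smul hφ hequiv, integral_map (continuous_const_smul h).measurable.aemeasurable
    hχ.aestronglyMeasurable]
  rfl

/-- The sum of the absolute values of the terms in the zeta function. -/
theorem tsum_enorm_curveTerm (hφ : IsSmoothFlow E φ)
    (hsmooth : ∀ x : G, ContMDiff 𝓘(ℝ, E) 𝓘(ℝ, E) ∞ (fun m : M => x • m))
    (hequiv : ∀ (t : ℝ) (x : G) (m : M), φ t (x • m) = x • φ t m)
    (hflat : IsFlat D) (hinv : IsInvariantConnection A D) {χ : M → ℝ} (hχ : Continuous χ) (σ : ℂ)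
    (h : G) :
    ∑' l : L, ∑' c : CurveClass φ (h * g * h⁻¹) (l : ℝ),
      ‖lengthFactor σ l * curveTerm A D φ χ (h * g * h⁻¹) l c‖ₑ =
    ∑' i : OrbitIndex φ g L, ((‖i.weight A D σ‖₊ : NNReal) : ENNReal) *
      ‖∫ m, χ (h • m) ∂i.measure‖ₑ := by
  rw [← ENNReal.tsum_sigma' (f := fun q : Σ l : L, CurveClass φ (h * g * h⁻¹) (l : ℝ) =>
      ‖lengthFactor σ q.1 * curveTerm A D φ χ (h * g * h⁻¹) q.1 q.2‖ₑ),
    ← (Equiv.ofBijective _ (curveClassToOrbit_bijective (g := g) hφ hequiv L h)).tsum_eq]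
  refine tsum_congr fun q => ?_
  rw [curveTerm_eq hφ hsmooth hequiv hflat hinv hχ h q, ← mul_assoc, enorm_mul]
  congr 1
  rw [← ofReal_norm, Complex.norm_real, ofReal_norm]
  rfl

/-- The sum of the terms in the zeta function. -/
theorem tsum_lengthTerm (hφ : IsSmoothFlow E φ)
    (hsmooth : ∀ x : G, ContMDiff 𝓘(ℝ, E) 𝓘(ℝ, E) ∞ (fun m : M => x • m))
    (hequiv : ∀ (t : ℝ) (x : G) (m : M), φ t (x • m) = x • φ t m)
    (hflat : IsFlat D) (hinv : IsInvariantConnection A D) {χ : M → ℝ} (hχ : Continuous χ) (σ : ℂ)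
    (h : G) (hs : Summable fun i : OrbitIndex φ g L =>
      i.weight A D σ * (∫ m, χ (h • m) ∂i.measure : ℝ)) :
    ∑' l : L, lengthTerm A D φ χ σ (h * g * h⁻¹) l =
      ∑' i : OrbitIndex φ g L, i.weight A D σ * (∫ m, χ (h • m) ∂i.measure : ℝ) := by
  let e := Equiv.ofBijective _ (curveClassToOrbit_bijective (g := g) hφ hequiv L h)
  have h1 : ∀ q : Σ l : L, CurveClass φ (h * g * h⁻¹) (l : ℝ),
      (e q).weight A D σ * (∫ m, χ (h • m) ∂(e q).measure : ℝ) =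
        lengthFactor σ q.1 * curveTerm A D φ χ (h * g * h⁻¹) q.1 q.2 := by
    intro q
    rw [curveTerm_eq hφ hsmooth hequiv hflat hinv hχ h q, ← mul_assoc]
    rfl
  rw [← e.tsum_eq]
  have hs' := (e.summable_iff (f := fun i : OrbitIndex φ g L =>
      i.weight A D σ * (∫ m, χ (h • m) ∂i.measure : ℝ))).2 hs
  simp only [Function.comp_def, h1] at hs' ⊢
  rw [hs'.tsum_sigma]
  exact tsum_congr fun l => tsum_mul_left.symm

end Amplitude

/-! ### Cocompact actions -/

section Cocompact

theorem exists_isCompact_image_eq_univ {X Y : Type*} [TopologicalSpace X] [TopologicalSpace Y]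
    [WeaklyLocallyCompactSpace X] [CompactSpace Y] {q : X → Y} (hq : IsOpenQuotientMap q) :
    ∃ K : Set X, IsCompact K ∧ q '' K = Set.univ := by
  choose N hN hxN using fun x : X => exists_compact_mem_nhds x
  obtain ⟨s, hs⟩ := isCompact_univ.elim_finite_subcover (fun x : X => q '' interior (N x))
    (fun x => hq.isOpenMap _ isOpen_interior) fun y _ => by
      obtain ⟨x, rfl⟩ := hq.surjective y
      exact Set.mem_iUnion.2 ⟨x, x, mem_interior_iff_mem_nhds.2 (hxN x), rfl⟩
  refine ⟨⋃ x ∈ s, N x, s.isCompact_biUnion fun x _ => hN x, Set.eq_univ_of_univ_subset ?_⟩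
  refine hs.trans ?_
  rw [Set.image_iUnion₂]
  exact Set.iUnion₂_mono fun x _ => Set.image_mono interior_subset

variable {G M : Type*} [Group G] [TopologicalSpace G] [IsTopologicalGroup G] [TopologicalSpace M]
  [MulAction G M]

theorem exists_isCompact_smul_eq [LocallyCompactSpace M] [ContinuousConstSMul G M]
    [CompactSpace (MulAction.orbitRel.Quotient G M)] :
    ∃ K : Set M, IsCompact K ∧ ∀ m, ∃ x : G, ∃ k ∈ K, m = x • k := by
  obtain ⟨K, hK, hK'⟩ := exists_isCompact_image_eq_univ
    (MulAction.isOpenQuotientMap_quotientMk (Γ := G) (T := M))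
  refine ⟨K, hK, fun m => ?_⟩
  have h1 : (Quotient.mk (MulAction.orbitRel G M) m) ∈
      Quotient.mk (MulAction.orbitRel G M) '' K := by
    rw [hK']
    exact Set.mem_univ _
  obtain ⟨k, hk, h2⟩ := h1
  obtain ⟨x, hx⟩ := MulAction.orbitRel_apply.1 (Quotient.exact h2.symm)
  exact ⟨x, k, hk, hx.symm⟩

/-- If `F` is compact and maps onto `G ⧸ H`, then `G = H F⁻¹`, and so `F⁻¹ K` meets every `H`-orbit.
-/
theorem exists_isCompact_subgroup_smul_eq [LocallyCompactSpace G] [ContinuousSMul G M]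
    {H : Subgroup G} [CompactSpace (G ⧸ H)]
    (h : ∃ K : Set M, IsCompact K ∧ ∀ m, ∃ x : G, ∃ k ∈ K, m = x • k) :
    ∃ K : Set M, IsCompact K ∧ ∀ m, ∃ x : H, ∃ k ∈ K, m = x • k := by
  obtain ⟨K, hK, hKM⟩ := h
  obtain ⟨F, hF, hFG⟩ := exists_isCompact_image_eq_univ
    (QuotientGroup.isOpenQuotientMap_mk (N := H))
  refine ⟨(fun q : G × M => q.1⁻¹ • q.2) '' (F ×ˢ K),
    (hF.prod hK).image (by fun_prop), fun m => ?_⟩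
  obtain ⟨x, k, hk, rfl⟩ := hKM m
  have h1 : ((x⁻¹ : G) : G ⧸ H) ∈ (fun a : G => (a : G ⧸ H)) '' F := by
    rw [hFG]
    exact Set.mem_univ _
  obtain ⟨f, hf, hfx⟩ := h1
  have h2 : f⁻¹ * x⁻¹ ∈ H := QuotientGroup.eq.1 hfx
  refine ⟨⟨(f⁻¹ * x⁻¹)⁻¹, inv_mem h2⟩, f⁻¹ • k, ⟨(f, k), ⟨hf, hk⟩, rfl⟩, ?_⟩
  change x • k = (f⁻¹ * x⁻¹)⁻¹ • f⁻¹ • k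
  rw [smul_smul]
  simp

theorem compactSpace_of_exists [CompactSpace G] [ContinuousSMul G M]
    (h : ∃ K : Set M, IsCompact K ∧ ∀ m, ∃ x : G, ∃ k ∈ K, m = x • k) : CompactSpace M := by
  obtain ⟨K, hK, hKM⟩ := h
  refine ⟨((isCompact_univ (X := G)).prod hK).image (f := fun q : G × M => q.1 • q.2)
    (by fun_prop) |>.of_isClosed_subset isClosed_univ ?_⟩
  intro m _
  obtain ⟨x, k, hk, rfl⟩ := hKM m
  exact ⟨(x, k), ⟨Set.mem_univ _, hk⟩, rfl⟩

/-- The average of `|χ|` is continuous, and invariant because `μ` is right invariant, so its bound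
on a compact set that meets all orbits is global. -/
theorem exists_isBoundedCutoff [T2Space G] [LocallyCompactSpace G] [MeasurableSpace G]
    [BorelSpace G] [ProperSMul G M] [LocallyCompactSpace M] {μ : Measure G}
    [IsFiniteMeasureOnCompacts μ] [μ.IsMulRightInvariant]
    (h : ∃ K : Set M, IsCompact K ∧ ∀ m, ∃ x : G, ∃ k ∈ K, m = x • k) {χ : M → ℝ}
    (hχ : Continuous χ) (hχs : HasCompactSupport χ) (hχ1 : ∀ m, ∫ x : G, χ (x • m) ∂μ = 1) :
    ∃ C, IsBoundedCutoff μ χ C := by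
  obtain ⟨K, hK, hKM⟩ := h
  have hc : Continuous fun m : M => ∫ x : G, |χ (x • m)| ∂μ :=
    continuous_integral_smul (f := fun m => |χ m|) hχ.abs hχs.norm
  obtain ⟨C, hC⟩ := hK.bddAbove_image hc.continuousOn
  refine ⟨C.toNNReal, hχ, hχs, hχ1, fun m => ?_⟩
  have hint : Integrable (fun x : G => |χ (x • m)|) μ :=
    Continuous.integrable_of_hasCompactSupport (by fun_prop)
      (hasCompactSupport_smul (f := fun m => |χ m|) hχs.norm m)
  rw [← ofReal_integral_eq_lintegral_ofReal hint (Eventually.of_forall fun x => abs_nonneg _)]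
  refine ENNReal.ofReal_le_ofReal ?_
  obtain ⟨x, k, hk, rfl⟩ := hKM m
  have h1 := integral_mul_right_eq_self (μ := μ) (fun a : G => |χ (a • k)|) x
  simp only [mul_smul] at h1
  rw [h1]
  exact hC ⟨k, hk, rfl⟩

end Cocompact

/-! ### The zeta function in terms of cutoff sums -/

section Zeta

variable {E : Type*} [NormedAddCommGroup E] [NormedSpace ℝ E] [FiniteDimensional ℝ E]
  {M : Type*} [TopologicalSpace M] [ChartedSpace E M] [IsManifold 𝓘(ℝ, E) ∞ M] [T2Space M]
  [SecondCountableTopology M] [LocallyCompactSpace M] [MeasurableSpace M] [BorelSpace M]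
  {G : Type*} [Group G] [TopologicalSpace G] [IsTopologicalGroup G] [T2Space G]
  [LocallyCompactSpace G] [SigmaCompactSpace G] [MeasurableSpace G] [BorelSpace G]
  [MulAction G M] [ProperSMul G M]
  {φ : ℝ → M → M}
  {W : Type*} [NormedAddCommGroup W] [NormedSpace ℂ W] [FiniteDimensional ℂ W]
  {V : M → Type*} [TopologicalSpace (TotalSpace W V)]
  [∀ m, AddCommGroup (V m)] [∀ m, Module ℂ (V m)] [∀ m, TopologicalSpace (V m)]
  [∀ m, IsTopologicalAddGroup (V m)] [∀ m, ContinuousSMul ℝ (V m)]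
  [FiberBundle W V] [VectorBundle ℂ W V] [VectorBundle ℝ W V]
  [ContMDiffVectorBundle ∞ W V 𝓘(ℝ, E)]
  {A : BundleAction E G W V} {D : CovariantDerivative 𝓘(ℝ, E) W V} {g : G} {L : Set ℝ}
  {μ : Measure G} [μ.IsHaarMeasure] [μ.IsMulRightInvariant]
  [MeasurableSpace (G ⧸ Subgroup.centralizer ({g} : Set G))]
  [BorelSpace (G ⧸ Subgroup.centralizer ({g} : Set G))]
  {ν : Measure (G ⧸ Subgroup.centralizer ({g} : Set G))} [IsFiniteMeasureOnCompacts ν]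
  {μZ : Measure (Subgroup.centralizer ({g} : Set G))} [μZ.IsHaarMeasure] [μZ.Regular]
  {p : ℕ → M → ℝ} {χ : M → ℝ} {C : NNReal}

theorem isClosed_centralizer_singleton (g : G) :
    IsClosed (Subgroup.centralizer ({g} : Set G) : Set G) := Set.isClosed_centralizer _

/-- Neither the criterion nor the value on the right involves `χ`, so both are independent of the
cutoff function. The set `L` is the whole spectrum for absolute convergence, and a single length for
compact groups. -/
theorem zeta_terms (hφ : IsSmoothFlow E φ)
    (hsmooth : ∀ x : G, ContMDiff 𝓘(ℝ, E) 𝓘(ℝ, E) ∞ (fun m : M => x • m))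
    (hequiv : ∀ (t : ℝ) (x : G) (m : M), φ t (x • m) = x • φ t m)
    (hflat : IsFlat D) (hinv : IsInvariantConnection A D) (hnd : Nondegenerate E φ g)
    (hL0 : ∀ l ∈ L, l ≠ 0) (hL : L.Countable)
    (hμZ : CompatibleMeasures (Subgroup.centralizer ({g} : Set G)) Subtype.val μ μZ ν)
    (hp : IsCutoffSequence μZ p) (hχ : IsBoundedCutoff μ χ C) (σ : ℂ) :
    (∫⁻ c, ∑' l : L, ∑' γ : CurveClass φ (cosetConj g c) (l : ℝ),
        ‖lengthFactor σ l * curveTerm A D φ χ (cosetConj g c) l γ‖ₑ ∂ν < ⊤ ↔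
      ∫⁻ m, cutoffSum p m ∂(weightedMeasure (OrbitIndex.measure (φ := φ) (g := g) (L := L))
        fun i => ‖i.weight A D σ‖₊) < ⊤) ∧
    (∫⁻ m, cutoffSum p m ∂(weightedMeasure (OrbitIndex.measure (φ := φ) (g := g) (L := L))
        fun i => ‖i.weight A D σ‖₊) < ⊤ →
      Integrable (fun c => ∑' l : L, lengthTerm A D φ χ σ (cosetConj g c) l) ν ∧
      ∫ c, ∑' l : L, lengthTerm A D φ χ σ (cosetConj g c) l ∂ν =
        cutoffValue (OrbitIndex.measure (φ := φ) (g := g) (L := L)) p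
          fun i => i.weight A D σ) := by
  have hZ := isClosed_centralizer_singleton g
  have : LocallyCompactSpace (Subgroup.centralizer ({g} : Set G)) :=
    hZ.isClosedEmbedding_subtypeVal.locallyCompactSpace
  have : SigmaCompactSpace (Subgroup.centralizer ({g} : Set G)) :=
    hZ.isClosedEmbedding_subtypeVal.sigmaCompactSpace
  have : SigmaCompactSpace (G ⧸ Subgroup.centralizer ({g} : Set G)) := by
    rw [← isSigmaCompact_univ_iff, ← (QuotientGroup.mk_surjective
      (s := Subgroup.centralizer ({g} : Set G))).range_eq]
    exact isSigmaCompact_range QuotientGroup.continuous_mk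
  have : μZ.IsMulRightInvariant := CompatibleMeasures.isMulRightInvariant
    (ι := (Subgroup.centralizer ({g} : Set G)).subtype) hμZ
  have := OrbitIndex.countable_of_nondegenerate hφ hsmooth hequiv hnd hL0 hL
  have := OrbitIndex.isFiniteMeasureOnCompacts (L := L) hφ hsmooth hequiv hnd hL0
  have hfin := OrbitIndex.lintegral_cutoffSum_classMeasure_lt_top hφ hsmooth hequiv hnd hL0 hp
  have hperm := OrbitIndex.isPermutedBy (g := g) (L := L) hφ hequiv
  have hw : ∀ i j : OrbitIndex φ g L, i.cls = j.cls → i.weight A D σ = j.weight A D σ :=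
    fun i j h => OrbitIndex.weight_congr hφ hsmooth hequiv hflat hinv σ h
  have hu : ∀ i j : OrbitIndex φ g L, i.cls = j.cls → ‖i.weight A D σ‖₊ = ‖j.weight A D σ‖₊ :=
    fun i j h => by rw [hw i j h]
  constructor
  · rw [← lintegral_quotient_lt_top_iff hχ hZ hμZ hp hperm hu hfin]
    simp only [cosetConj, tsum_enorm_curveTerm hφ hsmooth hequiv hflat hinv hχ.continuous]
  · intro hQ
    obtain ⟨h1, -⟩ := integral_quotient_of_nonneg hχ hZ hμZ hp hperm hu hQ
    obtain ⟨h2, h3⟩ := integral_quotient hχ hZ hμZ hp hperm hw hQ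
    have h4 : ∀ᵐ c ∂ν, ∑' l : L, lengthTerm A D φ χ σ (cosetConj g c) l =
        ∑' i : OrbitIndex φ g L, i.weight A D σ * (∫ m, χ (c.out • m) ∂i.measure : ℝ) := by
      filter_upwards [h1] with c hc
      refine tsum_lengthTerm hφ hsmooth hequiv hflat hinv hχ.continuous σ c.out ?_
      refine Summable.of_norm ?_
      refine hc.abs.congr fun i => ?_
      rw [norm_mul, Complex.norm_real, abs_mul, coe_nnnorm, abs_norm, Real.norm_eq_abs]
    exact ⟨h2.congr (h4.mono fun c hc => hc.symm), (integral_congr_ae h4).trans h3⟩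

/-- In case `M` is compact, the contributions of all lengths converge. -/
theorem lintegral_cutoffSum_lt_top_of_compactSpace [CompactSpace M] (hφ : IsSmoothFlow E φ)
    (hsmooth : ∀ x : G, ContMDiff 𝓘(ℝ, E) 𝓘(ℝ, E) ∞ (fun m : M => x • m))
    (hequiv : ∀ (t : ℝ) (x : G) (m : M), φ t (x • m) = x • φ t m)
    (hnd : Nondegenerate E φ g) {l : ℝ} (hl : l ≠ 0)
    (hμZ : CompatibleMeasures (Subgroup.centralizer ({g} : Set G)) Subtype.val μ μZ ν)
    (hp : IsCutoffSequence μZ p) (u : OrbitIndex φ g ({l} : Set ℝ) → NNReal) :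
    ∫⁻ m, cutoffSum p m ∂(weightedMeasure
      (OrbitIndex.measure (φ := φ) (g := g) (L := ({l} : Set ℝ))) u) < ⊤ := by
  have hZ := isClosed_centralizer_singleton g
  have : LocallyCompactSpace (Subgroup.centralizer ({g} : Set G)) :=
    hZ.isClosedEmbedding_subtypeVal.locallyCompactSpace
  have : SigmaCompactSpace (Subgroup.centralizer ({g} : Set G)) :=
    hZ.isClosedEmbedding_subtypeVal.sigmaCompactSpace
  have : μZ.IsMulRightInvariant := CompatibleMeasures.isMulRightInvariant
    (ι := (Subgroup.centralizer ({g} : Set G)).subtype) hμZ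
  have hfinite := OrbitIndex.finite_of_compactSpace hφ hsmooth hequiv hnd hl
  have hL0 : ∀ l' ∈ ({l} : Set ℝ), l' ≠ 0 := fun l' h => h ▸ hl
  have hfin := OrbitIndex.lintegral_cutoffSum_classMeasure_lt_top hφ hsmooth hequiv hnd hL0 hp
  cases nonempty_fintype (OrbitIndex φ g ({l} : Set ℝ))
  rw [lintegral_weightedMeasure, tsum_fintype]
  refine ENNReal.sum_lt_top.2 fun i _ => ENNReal.mul_lt_top ENNReal.coe_lt_top ?_
  refine lt_of_le_of_lt ?_ (hfin i)
  rw [classMeasure, lintegral_weightedMeasure]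
  refine le_trans ?_ (ENNReal.le_tsum i)
  rw [classWeight_of_eq rfl, ENNReal.coe_one, one_mul]

/-- In case `M` is compact, there are finitely many flow curves of a given length. -/
theorem summable_curveTerm_of_compactSpace [CompactSpace M] (hφ : IsSmoothFlow E φ)
    (hsmooth : ∀ x : G, ContMDiff 𝓘(ℝ, E) 𝓘(ℝ, E) ∞ (fun m : M => x • m))
    (hequiv : ∀ (t : ℝ) (x : G) (m : M), φ t (x • m) = x • φ t m)
    (hnd : Nondegenerate E φ g) {l : ℝ} (hl : l ≠ 0) (χ : M → ℝ)
    (c : G ⧸ Subgroup.centralizer ({g} : Set G)) :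
    Summable (curveTerm A D φ χ (cosetConj g c) l) := by
  have := OrbitIndex.finite_of_compactSpace hφ hsmooth hequiv hnd hl
  have h1 := (curveClassToOrbit_bijective (g := g) hφ hequiv ({l} : Set ℝ) c.out).injective
  have : Finite (CurveClass φ (cosetConj g c) l) :=
    Finite.of_injective (fun γ : CurveClass φ (cosetConj g c) l =>
      curveClassToOrbit (g := g) hequiv ({l} : Set ℝ) c.out ⟨⟨l, rfl⟩, γ⟩) fun γ γ' h =>
        eq_of_heq (Sigma.mk.inj_iff.1 (h1 h)).2
  exact Summable.of_finite

end Zeta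

/-! ### Comparison of centralisers -/

section Centralizer

variable {G : Type*} [Group G] [TopologicalSpace G] [IsTopologicalGroup G] [T2Space G]

/-- The inclusion of the centraliser of `g` in `H` into the centraliser of `g` in `G`, as a group
homomorphism. -/
def centralizerInclusionHom (H : Subgroup G) (g : H) :
    Subgroup.centralizer ({g} : Set H) →* Subgroup.centralizer ({(g : G)} : Set G) where
  toFun := centralizerInclusion H g
  map_one' := rfl
  map_mul' _ _ := rfl

theorem range_centralizerInclusionHom (H : Subgroup G) (g : H) :
    (centralizerInclusionHom H g).range =
      H.subgroupOf (Subgroup.centralizer ({(g : G)} : Set G)) := by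
  ext z
  constructor
  · rintro ⟨b, rfl⟩
    exact b.1.2
  · intro hz
    refine ⟨⟨⟨z.1, hz⟩, Subgroup.mem_centralizer_singleton_iff.2 (Subtype.ext ?_)⟩, rfl⟩
    exact Subgroup.mem_centralizer_singleton_iff.1 z.2

theorem isClosedEmbedding_centralizerInclusionHom {H : Subgroup G} (hH : IsClosed (H : Set G))
    (g : H) : IsClosedEmbedding (centralizerInclusionHom H g) := by
  refine ⟨?_, ?_⟩
  · have h1 : IsEmbedding fun z : Subgroup.centralizer ({g} : Set H) => ((z : H) : G) :=
      IsEmbedding.subtypeVal.comp IsEmbedding.subtypeVal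
    refine IsEmbedding.of_comp ?_ continuous_subtype_val h1
    exact Continuous.subtype_mk h1.continuous _
  · rw [← MonoidHom.coe_range, range_centralizerInclusionHom]
    exact hH.preimage continuous_subtype_val

/-- Compatible measures on quotients of groups with Haar measures do not vanish. -/
theorem CompatibleMeasures.ne_zero {A B : Type*} [Group A] [TopologicalSpace A]
    [IsTopologicalGroup A] [LocallyCompactSpace A] [MeasurableSpace A] [BorelSpace A]
    [MeasurableSpace B] {K : Subgroup A} [MeasurableSpace (A ⧸ K)] {ι : B → A} {α : Measure A}
    {β : Measure B} {ν : Measure (A ⧸ K)} [α.IsHaarMeasure]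
    (h : CompatibleMeasures K ι α β ν) : ν ≠ 0 := by
  rintro rfl
  obtain ⟨f, hf, hf0, hf1⟩ := exists_continuous_nonneg_pos (1 : A)
  have hpos : 0 < ∫ a, f a ∂α :=
    f.continuous.integral_pos_of_hasCompactSupport_nonneg_nonzero hf hf0 hf1
  rw [h f f.continuous hf, integral_zero_measure] at hpos
  exact hpos.false

end Centralizer

/-! ### Comparison of the zeta functions for a group and a subgroup -/

section Subgroup

variable {E : Type*} [NormedAddCommGroup E] [NormedSpace ℝ E] [FiniteDimensional ℝ E]
  {M : Type*} [TopologicalSpace M] [ChartedSpace E M] [IsManifold 𝓘(ℝ, E) ∞ M] [T2Space M]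
  [SecondCountableTopology M] [LocallyCompactSpace M]
  {G : Type*} [Group G] [TopologicalSpace G] [IsTopologicalGroup G] [T2Space G]
  [LocallyCompactSpace G] [SigmaCompactSpace G] [MeasurableSpace G] [BorelSpace G]
  [MulAction G M] [ProperSMul G M]
  {φ : ℝ → M → M}
  {W : Type*} [NormedAddCommGroup W] [NormedSpace ℂ W] [FiniteDimensional ℂ W]
  {V : M → Type*} [TopologicalSpace (TotalSpace W V)]
  [∀ m, AddCommGroup (V m)] [∀ m, Module ℂ (V m)] [∀ m, TopologicalSpace (V m)]
  [∀ m, IsTopologicalAddGroup (V m)] [∀ m, ContinuousSMul ℝ (V m)]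
  [FiberBundle W V] [VectorBundle ℂ W V] [VectorBundle ℝ W V]
  [ContMDiffVectorBundle ∞ W V 𝓘(ℝ, E)]
  {A : BundleAction E G W V} {D : CovariantDerivative 𝓘(ℝ, E) W V}

/-- The terms of the zeta functions for `G` and `H` with lengths in `L`: absolute convergence is
equivalent, and the integrals are proportional. -/
theorem zeta_terms_subgroup {H : Subgroup G} (hH : IsClosed (H : Set G)) {g : H} {L : Set ℝ}
    (hφ : IsSmoothFlow E φ)
    (hsmooth : ∀ x : G, ContMDiff 𝓘(ℝ, E) 𝓘(ℝ, E) ∞ (fun m : M => x • m))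
    (hequiv : ∀ (t : ℝ) (x : G) (m : M), φ t (x • m) = x • φ t m)
    (hflat : IsFlat D) (hinv : IsInvariantConnection A D) (hnd : Nondegenerate E φ (g : G))
    (hL0 : ∀ l ∈ L, l ≠ 0) (hL : L.Countable)
    {μG : Measure G} [μG.IsHaarMeasure] [μG.IsMulRightInvariant]
    {μH : Measure H} [μH.IsHaarMeasure] [μH.IsMulRightInvariant]
    [MeasurableSpace (G ⧸ Subgroup.centralizer ({(g : G)} : Set G))]
    [BorelSpace (G ⧸ Subgroup.centralizer ({(g : G)} : Set G))]
    {νG : Measure (G ⧸ Subgroup.centralizer ({(g : G)} : Set G))} [IsFiniteMeasureOnCompacts νG]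
    [MeasurableSpace (H ⧸ Subgroup.centralizer ({g} : Set H))]
    [BorelSpace (H ⧸ Subgroup.centralizer ({g} : Set H))]
    {νH : Measure (H ⧸ Subgroup.centralizer ({g} : Set H))} [IsFiniteMeasureOnCompacts νH]
    {μZ : Measure (Subgroup.centralizer ({(g : G)} : Set G))} [μZ.IsHaarMeasure] [μZ.Regular]
    (hμZ : CompatibleMeasures (Subgroup.centralizer ({(g : G)} : Set G)) Subtype.val μG μZ νG)
    {μZH : Measure (Subgroup.centralizer ({g} : Set H))} [μZH.IsHaarMeasure] [μZH.Regular]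
    (hμZH : CompatibleMeasures (Subgroup.centralizer ({g} : Set H)) Subtype.val μH μZH νH)
    [MeasurableSpace (Subgroup.centralizer ({(g : G)} : Set G) ⧸
      H.subgroupOf (Subgroup.centralizer ({(g : G)} : Set G)))]
    [BorelSpace (Subgroup.centralizer ({(g : G)} : Set G) ⧸
      H.subgroupOf (Subgroup.centralizer ({(g : G)} : Set G)))]
    {τ : Measure (Subgroup.centralizer ({(g : G)} : Set G) ⧸
      H.subgroupOf (Subgroup.centralizer ({(g : G)} : Set G)))} [IsFiniteMeasureOnCompacts τ]
    (hτ : CompatibleMeasures (H.subgroupOf (Subgroup.centralizer ({(g : G)} : Set G)))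
      (centralizerInclusion H g) μZ μZH τ)
    (hvol : τ Set.univ ≠ ⊤) {χ χH : M → ℝ} {C CH : NNReal} (hχ : IsBoundedCutoff μG χ C)
    (hχH : IsBoundedCutoff μH χH CH) (σ : ℂ) :
    (∫⁻ c, ∑' l : L, ∑' γ : CurveClass φ (cosetConj (g : G) c) (l : ℝ),
        ‖lengthFactor σ l * curveTerm A D φ χ (cosetConj (g : G) c) l γ‖ₑ ∂νG < ⊤ ↔
      ∫⁻ c, ∑' l : L, ∑' γ : CurveClass φ (cosetConj g c) (l : ℝ),
        ‖lengthFactor σ l * curveTerm (A.restrict H) D φ χH (cosetConj g c) l γ‖ₑ ∂νH < ⊤) ∧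
    ((∫⁻ c, ∑' l : L, ∑' γ : CurveClass φ (cosetConj (g : G) c) (l : ℝ),
        ‖lengthFactor σ l * curveTerm A D φ χ (cosetConj (g : G) c) l γ‖ₑ ∂νG < ⊤ ∨
        (CompactSpace M ∧ ∃ l, L = {l})) →
      Integrable (fun c => ∑' l : L, lengthTerm A D φ χ σ (cosetConj (g : G) c) l) νG ∧
      Integrable (fun c => ∑' l : L, lengthTerm (A.restrict H) D φ χH σ (cosetConj g c) l) νH ∧
      ∫ c, ∑' l : L, lengthTerm (A.restrict H) D φ χH σ (cosetConj g c) l ∂νH =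
        (τ.real Set.univ : ℂ) *
          ∫ c, ∑' l : L, lengthTerm A D φ χ σ (cosetConj (g : G) c) l ∂νG) := by
  let _ : MeasurableSpace M := borel M
  have : BorelSpace M := ⟨rfl⟩
  have hZ := isClosed_centralizer_singleton (g : G)
  have hHl : LocallyCompactSpace H := hH.isClosedEmbedding_subtypeVal.locallyCompactSpace
  have hHs : SigmaCompactSpace H := hH.isClosedEmbedding_subtypeVal.sigmaCompactSpace
  have hZH := isClosed_centralizer_singleton g
  have hHp : ProperSMul H M := properSMul_of_isClosedEmbedding H.subtype
    hH.isClosedEmbedding_subtypeVal fun _ _ => rfl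
  have hZl : LocallyCompactSpace (Subgroup.centralizer ({(g : G)} : Set G)) :=
    hZ.isClosedEmbedding_subtypeVal.locallyCompactSpace
  have hZs : SigmaCompactSpace (Subgroup.centralizer ({(g : G)} : Set G)) :=
    hZ.isClosedEmbedding_subtypeVal.sigmaCompactSpace
  have hZHl : LocallyCompactSpace (Subgroup.centralizer ({g} : Set H)) :=
    hZH.isClosedEmbedding_subtypeVal.locallyCompactSpace
  have hZp : ProperSMul (Subgroup.centralizer ({(g : G)} : Set G)) M :=
    properSMul_of_isClosedEmbedding (Subgroup.centralizer ({(g : G)} : Set G)).subtype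
      hZ.isClosedEmbedding_subtypeVal fun _ _ => rfl
  have hZHp : ProperSMul (Subgroup.centralizer ({g} : Set H)) M :=
    properSMul_of_isClosedEmbedding (Subgroup.centralizer ({g} : Set H)).subtype
      hZH.isClosedEmbedding_subtypeVal fun _ _ => rfl
  have : μZ.IsMulRightInvariant := CompatibleMeasures.isMulRightInvariant
    (ι := (Subgroup.centralizer ({(g : G)} : Set G)).subtype) hμZ
  have : μZ.IsInvInvariant := isInvInvariant_of_isMulRightInvariant
  have hcount := OrbitIndex.countable_of_nondegenerate hφ hsmooth hequiv hnd hL0 hL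
  -- Whether `g` is viewed in `G` or in `H`, the orbit indices and their measures are the same by
  -- definition. Only the classes, for `Z` and for `Z_H`, differ.
  have hcountH : Countable (OrbitIndex φ g L) := hcount
  have hcompact := OrbitIndex.isFiniteMeasureOnCompacts (L := L) hφ hsmooth hequiv hnd hL0
  have hcompactH : ∀ i : OrbitIndex φ g L, IsFiniteMeasureOnCompacts i.measure := hcompact
  obtain ⟨p, hp⟩ := exists_isCutoffSequence (β := μZ) (M := M)
  obtain ⟨q, hq⟩ := exists_isCutoffSequence (β := μZH) (M := M)
  have hperm := OrbitIndex.isPermutedBy (g := (g : G)) (L := L) hφ hequiv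
  have hw : ∀ i j : OrbitIndex φ (g : G) L, i.cls = j.cls →
      i.weight A D σ = j.weight A D σ :=
    fun i j h => OrbitIndex.weight_congr hφ hsmooth hequiv hflat hinv σ h
  -- Weights constant on the classes for the larger group `Z` give a `Z`-invariant measure, as the
  -- comparison of `p` and `q` requires.
  have hcomp : ∀ u : OrbitIndex φ (g : G) L → NNReal, (∀ i j, i.cls = j.cls → u i = u j) →
      ∫⁻ m, cutoffSum q m ∂(weightedMeasure OrbitIndex.measure u) =
        τ Set.univ * ∫⁻ m, cutoffSum p m ∂(weightedMeasure OrbitIndex.measure u) := fun u hu =>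
    lintegral_cutoffSum_subgroup (isClosedEmbedding_centralizerInclusionHom hH g)
      (range_centralizerInclusionHom H g) (fun _ _ => rfl) hτ
      (fun a => hperm.weightedMeasure_map hu a) hp hq
  obtain ⟨hG1, hG2⟩ := zeta_terms hφ hsmooth hequiv hflat hinv hnd hL0 hL hμZ hp hχ σ
  have hterms := zeta_terms (G := H) (A := A.restrict H) (g := g) hφ (fun x => hsmooth x)
    (fun t x m => hequiv t x m) hflat (fun x => hinv x) hnd hL0 hL hμZH hq hχH σ
  obtain ⟨hH1, hH2⟩ := hterms
  -- Excludes the product `0 * ⊤ = 0`, in which case finiteness for `H` would say nothing about `G`.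
  have hτ0 : τ Set.univ ≠ 0 := fun h => hτ.ne_zero (Measure.measure_univ_eq_zero.1 h)
  have hQ : ∫⁻ m, cutoffSum q m ∂(weightedMeasure
        (OrbitIndex.measure (φ := φ) (g := g) (L := L)) fun i => ‖i.weight (A.restrict H) D σ‖₊) =
      τ Set.univ * ∫⁻ m, cutoffSum p m ∂(weightedMeasure
        (OrbitIndex.measure (φ := φ) (g := (g : G)) (L := L)) fun i => ‖i.weight A D σ‖₊) :=
    hcomp (fun i => ‖i.weight A D σ‖₊) fun i j h => by rw [hw i j h]
  have hV : cutoffValue (OrbitIndex.measure (φ := φ) (g := g) (L := L)) q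
        (fun i => i.weight (A.restrict H) D σ) =
      (τ Set.univ).toReal * cutoffValue (OrbitIndex.measure (φ := φ) (g := (g : G)) (L := L)) p
        fun i => i.weight A D σ := cutoffValue_eq_mul hw hcomp
  have hiff : ∫⁻ m, cutoffSum q m ∂(weightedMeasure
        (OrbitIndex.measure (φ := φ) (g := g) (L := L))
        fun i => ‖i.weight (A.restrict H) D σ‖₊) < ⊤ ↔
      ∫⁻ m, cutoffSum p m ∂(weightedMeasure
        (OrbitIndex.measure (φ := φ) (g := (g : G)) (L := L)) fun i => ‖i.weight A D σ‖₊) < ⊤ := by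
    rw [hQ, ENNReal.mul_lt_top_iff]
    constructor
    · rintro (h | h | h)
      · exact h.2
      · exact absurd h hτ0
      · rw [h]
        exact ENNReal.zero_lt_top
    · exact fun h => Or.inl ⟨hvol.lt_top, h⟩
  refine ⟨by rw [hG1, hH1, hiff], fun h => ?_⟩
  have hfin : ∫⁻ m, cutoffSum p m ∂(weightedMeasure
      (OrbitIndex.measure (φ := φ) (g := (g : G)) (L := L)) fun i => ‖i.weight A D σ‖₊) < ⊤ := by
    rcases h with h | ⟨hM, l, rfl⟩
    · exact hG1.1 h
    · exact lintegral_cutoffSum_lt_top_of_compactSpace hφ hsmooth hequiv hnd (hL0 l rfl) hμZ hp _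
  obtain ⟨i1, v1⟩ := hG2 hfin
  obtain ⟨i2, v2⟩ := hH2 (hiff.2 hfin)
  exact ⟨i1, i2, by rw [v1, v2, hV]; rfl⟩

end Subgroup

/-! ### Convergence for compact groups -/

section Compact

variable {E : Type*} [NormedAddCommGroup E] [NormedSpace ℝ E] [FiniteDimensional ℝ E]
  {M : Type*} [TopologicalSpace M] [ChartedSpace E M] [IsManifold 𝓘(ℝ, E) ∞ M] [T2Space M]
  [SecondCountableTopology M] [CompactSpace M]
  {G : Type*} [Group G] [TopologicalSpace G] [IsTopologicalGroup G] [MulAction G M]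
  [ContinuousConstSMul G M]
  {φ : ℝ → M → M}
  {W : Type*} [NormedAddCommGroup W] [NormedSpace ℂ W] [FiniteDimensional ℂ W]
  {V : M → Type*} [TopologicalSpace (TotalSpace W V)]
  [∀ m, AddCommGroup (V m)] [∀ m, Module ℂ (V m)] [∀ m, TopologicalSpace (V m)]
  [∀ m, IsTopologicalAddGroup (V m)] [∀ m, ContinuousSMul ℝ (V m)]
  [FiberBundle W V] [VectorBundle ℂ W V] [VectorBundle ℝ W V]
  [ContMDiffVectorBundle ∞ W V 𝓘(ℝ, E)]
  {A : BundleAction E G W V} {D : CovariantDerivative 𝓘(ℝ, E) W V} {g : G}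
  [MeasurableSpace (G ⧸ Subgroup.centralizer ({g} : Set G))]
  {ν : Measure (G ⧸ Subgroup.centralizer ({g} : Set G))} {σ : ℂ} {L : ℕ → Finset ℝ} {χ : M → ℝ}

theorem IsExhaustion.mem (hL : IsExhaustion φ g L) {n : ℕ} {l : ℝ} (hl : l ∈ L n) :
    l ∈ lengthSpectrum φ g := by
  rw [← hL.iUnion_eq]
  exact Set.mem_iUnion.2 ⟨n, hl⟩

theorem hasTruncatedLogZeta_iff (hL : IsExhaustion φ g L)
    (hsum : ∀ l ∈ lengthSpectrum φ g, ∀ c, Summable (curveTerm A D φ χ (cosetConj g c) l))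
    (hint : ∀ l ∈ lengthSpectrum φ g,
      Integrable (fun c => lengthTerm A D φ χ σ (cosetConj g c) l) ν) (ℓ : ℂ) :
    HasTruncatedLogZeta A D φ g ν χ σ L ℓ ↔
      Tendsto (fun n => ∑ l ∈ L n, ∫ c, lengthTerm A D φ χ σ (cosetConj g c) l ∂ν) atTop
        (𝓝 (2 * ℓ)) := by
  have h1 : ∀ n, ∫ c, ∑ l ∈ L n, lengthTerm A D φ χ σ (cosetConj g c) l ∂ν =
      ∑ l ∈ L n, ∫ c, lengthTerm A D φ χ σ (cosetConj g c) l ∂ν := fun n =>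
    integral_finsetSum _ fun l hl => hint l (hL.mem hl)
  simp only [HasTruncatedLogZeta, h1]
  exact ⟨fun h => h.2, fun h => ⟨fun l hl => ⟨Eventually.of_forall (hsum l hl), hint l hl⟩, h⟩⟩

/-- The partial sums are the same sequence at every coset, and their integrals are that sequence
times the volume of the quotient, which is finite and nonzero. Convergence at one coset thus decides
everything. -/
theorem hasLogZeta_iff [IsFiniteMeasure ν] (hν : ν ≠ 0) (hL : IsExhaustion φ g L)
    (hsum : ∀ l ∈ lengthSpectrum φ g, ∀ c, Summable (curveTerm A D φ χ (cosetConj g c) l))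
    (hconst : ∀ l ∈ lengthSpectrum φ g, ∃ t, ∀ c, lengthTerm A D φ χ σ (cosetConj g c) l = t)
    (ℓ : ℂ) :
    HasLogZeta A D φ g ν χ σ L ℓ ↔
      Tendsto (fun n => ∑ l ∈ L n, ∫ c, lengthTerm A D φ χ σ (cosetConj g c) l ∂ν) atTop
        (𝓝 (2 * ℓ)) := by
  choose! t ht using hconst
  have hv : (ν.real Set.univ : ℂ) ≠ 0 := by
    rw [Complex.ofReal_ne_zero]
    exact (measureReal_ne_zero_iff (measure_ne_top ν _)).2 fun h =>
      hν (Measure.measure_univ_eq_zero.1 h)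
  have h1 : ∀ n, ∑ l ∈ L n, ∫ c, lengthTerm A D φ χ σ (cosetConj g c) l ∂ν =
      (ν.real Set.univ : ℂ) * ∑ l ∈ L n, t l := fun n => by
    rw [Finset.mul_sum]
    refine Finset.sum_congr rfl fun l hl => ?_
    simp only [ht l (hL.mem hl), integral_const, Complex.real_smul]
  have h2 : ∀ n c, ∑ l ∈ L n, lengthTerm A D φ χ σ (cosetConj g c) l = ∑ l ∈ L n, t l :=
    fun n c => Finset.sum_congr rfl fun l hl => ht l (hL.mem hl) c
  simp only [HasLogZeta, h1, h2]
  have : NeZero ν := ⟨hν⟩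
  constructor
  · rintro ⟨F, hF, hFt, hℓ⟩
    obtain ⟨c₀, -, hc₀⟩ := hFt.exists
    have h3 : ∀ᵐ c ∂ν, F c = F c₀ := hFt.mono fun c hc => tendsto_nhds_unique hc.2 hc₀
    rw [hℓ, integral_congr_ae h3, integral_const, Complex.real_smul]
    exact hc₀.const_mul _
  · intro h
    refine ⟨fun _ => (ν.real Set.univ : ℂ)⁻¹ * (2 * ℓ), integrable_const _,
      Eventually.of_forall fun c => ⟨fun l hl => hsum l hl c, ?_⟩, ?_⟩
    · have := h.const_mul (ν.real Set.univ : ℂ)⁻¹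
      simpa only [inv_mul_cancel_left₀ hv] using this
    · rw [integral_const, Complex.real_smul, mul_inv_cancel_left₀ hv]

/-- For constant cutoff functions, the terms of the zeta function do not depend on the coset. -/
theorem exists_lengthTerm_eq (hφ : IsSmoothFlow E φ)
    (hsmooth : ∀ x : G, ContMDiff 𝓘(ℝ, E) 𝓘(ℝ, E) ∞ (fun m : M => x • m))
    (hequiv : ∀ (t : ℝ) (x : G) (m : M), φ t (x • m) = x • φ t m)
    (hflat : IsFlat D) (hinv : IsInvariantConnection A D) (hnd : Nondegenerate E φ g) (a : ℝ)
    (σ : ℂ) {l : ℝ} (hl : l ≠ 0) :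
    ∃ t, ∀ c, lengthTerm A D φ (fun _ => a) σ (cosetConj g c) l = t := by
  let _ : MeasurableSpace M := borel M
  have : BorelSpace M := ⟨rfl⟩
  have := OrbitIndex.finite_of_compactSpace hφ hsmooth hequiv hnd hl
  -- For constant `χ` the translation by `h` inside the orbit integral has no effect.
  refine ⟨∑' i : OrbitIndex φ g ({l} : Set ℝ), i.weight A D σ * (∫ _, a ∂i.measure : ℝ),
    fun c => ?_⟩
  rw [← tsum_lengthTerm hφ hsmooth hequiv hflat hinv (χ := fun _ => a) continuous_const σ c.out
    Summable.of_finite]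
  exact (tsum_singleton l fun l => lengthTerm A D φ (fun _ => a) σ (cosetConj g c) l).symm

/-- Two proportional sequences converge simultaneously, to proportional limits. -/
theorem exists_tendsto_iff_of_mul {v w : ℕ → ℂ} {t : ℂ} (ht : t ≠ 0) (h : ∀ n, w n = t * v n)
    {P Q : ℂ → Prop} (hP : ∀ ℓ, P ℓ ↔ Tendsto v atTop (𝓝 (2 * ℓ)))
    (hQ : ∀ ℓ, Q ℓ ↔ Tendsto w atTop (𝓝 (2 * ℓ))) :
    ((∃ ℓ, P ℓ) ↔ ∃ ℓ, Q ℓ) ∧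
      ∀ ℓ ℓ', P ℓ → Q ℓ' → ℓ' = t * ℓ ∧ Complex.exp ℓ' = Complex.exp (t * ℓ) := by
  have hw : w = fun n => t * v n := funext h
  have key : ∀ ℓ, P ℓ → Q (t * ℓ) := fun ℓ hℓ => by
    rw [hQ, hw, mul_left_comm]
    exact ((hP ℓ).1 hℓ).const_mul t
  refine ⟨⟨fun ⟨ℓ, hℓ⟩ => ⟨_, key ℓ hℓ⟩, fun ⟨ℓ, hℓ⟩ => ⟨t⁻¹ * ℓ, ?_⟩⟩, fun ℓ ℓ' hℓ hℓ' => ?_⟩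
  · rw [hP, mul_left_comm]
    have h1 := ((hQ ℓ).1 hℓ).const_mul t⁻¹
    rw [hw] at h1
    simpa only [inv_mul_cancel_left₀ ht] using h1
  · have h1 := tendsto_nhds_unique ((hQ _).1 hℓ') ((hQ _).1 (key ℓ hℓ))
    have h2 : ℓ' = t * ℓ := mul_left_cancel₀ two_ne_zero h1
    exact ⟨h2, by rw [h2]⟩

end Compact

end Ruelle

/-! ### The comparison of the zeta functions for a group and a cocompact subgroup -/

theorem lemma2p3
    -- the manifold, the group and its proper, cocompact action
    {E : Type*} [NormedAddCommGroup E] [NormedSpace ℝ E] [FiniteDimensional ℝ E]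
    {M : Type*} [TopologicalSpace M] [ChartedSpace E M] [IsManifold 𝓘(ℝ, E) ∞ M]
    [T2Space M] [SecondCountableTopology M]
    {G : Type*} [Group G] [TopologicalSpace G] [IsTopologicalGroup G] [LocallyCompactSpace G]
    [T2Space G] [MeasurableSpace G] [BorelSpace G]
    [MulAction G M] [ProperSMul G M] [CompactSpace (MulAction.orbitRel.Quotient G M)]
    (hsmooth : ∀ x : G, ContMDiff 𝓘(ℝ, E) 𝓘(ℝ, E) ∞ (fun m : M => x • m))
    -- the flow
    (φ : ℝ → M → M) (hφ : Ruelle.IsSmoothFlow E φ) (hu : ∀ m, Ruelle.generator E φ m ≠ 0)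
    (hequiv : ∀ (t : ℝ) (x : G) (m : M), φ t (x • m) = x • φ t m)
    -- the flat, equivariant bundle
    {W : Type*} [NormedAddCommGroup W] [NormedSpace ℂ W] [FiniteDimensional ℂ W]
    {V : M → Type*} [TopologicalSpace (TotalSpace W V)]
    [∀ m, AddCommGroup (V m)] [∀ m, Module ℂ (V m)] [∀ m, TopologicalSpace (V m)]
    [∀ m, IsTopologicalAddGroup (V m)] [∀ m, ContinuousSMul ℝ (V m)]
    [FiberBundle W V] [VectorBundle ℂ W V] [VectorBundle ℝ W V]
    [ContMDiffVectorBundle ∞ W V 𝓘(ℝ, E)]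
    (A : Ruelle.BundleAction E G W V) (D : CovariantDerivative 𝓘(ℝ, E) W V)
    (hflat : Ruelle.IsFlat D) (hinv : Ruelle.IsInvariantConnection A D)
    -- the subgroup `H` and the element `g`
    (H : Subgroup G) (hH : IsClosed (H : Set G)) [CompactSpace (G ⧸ H)] (g : H)
    (hL : (Ruelle.lengthSpectrum φ (g : G)).Countable)
    (hnd : Ruelle.Nondegenerate E φ (g : G))
    -- Haar measures on the unimodular groups `G` and `H`
    (μG : Measure G) [μG.IsHaarMeasure] [μG.IsMulRightInvariant] [μG.Regular]
    (μH : Measure H) [μH.IsHaarMeasure] [μH.IsMulRightInvariant] [μH.Regular]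
    -- invariant measures on the quotients by the centralisers of `g`
    [MeasurableSpace (G ⧸ Subgroup.centralizer ({(g : G)} : Set G))]
    [BorelSpace (G ⧸ Subgroup.centralizer ({(g : G)} : Set G))]
    (νG : Measure (G ⧸ Subgroup.centralizer ({(g : G)} : Set G)))
    [SMulInvariantMeasure G (G ⧸ Subgroup.centralizer ({(g : G)} : Set G)) νG] [νG.Regular]
    [MeasurableSpace (H ⧸ Subgroup.centralizer ({g} : Set H))]
    [BorelSpace (H ⧸ Subgroup.centralizer ({g} : Set H))]
    (νH : Measure (H ⧸ Subgroup.centralizer ({g} : Set H)))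
    [SMulInvariantMeasure H (H ⧸ Subgroup.centralizer ({g} : Set H)) νH] [νH.Regular]
    -- the compatible Haar measures on the centralisers `Z` and `Z_H` of `g`
    (μZ : Measure (Subgroup.centralizer ({(g : G)} : Set G))) [μZ.IsHaarMeasure] [μZ.Regular]
    (hμZ : Ruelle.CompatibleMeasures (Subgroup.centralizer ({(g : G)} : Set G)) Subtype.val
      μG μZ νG)
    (μZH : Measure (Subgroup.centralizer ({g} : Set H))) [μZH.IsHaarMeasure] [μZH.Regular]
    (hμZH : Ruelle.CompatibleMeasures (Subgroup.centralizer ({g} : Set H)) Subtype.val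
      μH μZH νH)
    -- the compatible measure on `Z / Z_H`, of finite volume
    [MeasurableSpace (Subgroup.centralizer ({(g : G)} : Set G) ⧸
      H.subgroupOf (Subgroup.centralizer ({(g : G)} : Set G)))]
    [BorelSpace (Subgroup.centralizer ({(g : G)} : Set G) ⧸
      H.subgroupOf (Subgroup.centralizer ({(g : G)} : Set G)))]
    (τ : Measure (Subgroup.centralizer ({(g : G)} : Set G) ⧸
      H.subgroupOf (Subgroup.centralizer ({(g : G)} : Set G)))) [τ.Regular]
    (hτ : Ruelle.CompatibleMeasures (H.subgroupOf (Subgroup.centralizer ({(g : G)} : Set G)))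
      (Ruelle.centralizerInclusion H g) μZ μZH τ)
    (hvol : τ Set.univ ≠ ⊤) :
    -- absolute convergence, for arbitrary cutoff functions
    (∀ χ χH : M → ℝ, Ruelle.IsCutoff E μG χ → Ruelle.IsCutoff E μH χH → ∀ σ : ℂ,
      (Ruelle.AbsConverges A D φ (g : G) νG χ σ ↔
        Ruelle.AbsConverges (A.restrict H) D φ g νH χH σ) ∧
      (Ruelle.AbsConverges A D φ (g : G) νG χ σ →
        Ruelle.logZeta (A.restrict H) D φ g νH χH σ =
          (τ.real Set.univ : ℂ) * Ruelle.logZeta A D φ (g : G) νG χ σ ∧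
        Ruelle.zeta (A.restrict H) D φ g νH χH σ =
          Complex.exp ((τ.real Set.univ : ℂ) * Ruelle.logZeta A D φ (g : G) νG χ σ))) ∧
    -- convergence in case `G` is compact
    (CompactSpace G → ∀ L : ℕ → Finset ℝ, Ruelle.IsExhaustion φ (g : G) L → ∀ σ : ℂ,
      -- convergence of the iterated expression, for the constant cutoff functions
      (((∃ ℓ, Ruelle.HasLogZeta A D φ (g : G) νG (fun _ => (μG.real Set.univ)⁻¹) σ L ℓ) ↔
          ∃ ℓ, Ruelle.HasLogZeta (A.restrict H) D φ g νH
            (fun _ => (μH.real Set.univ)⁻¹) σ L ℓ) ∧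
        ∀ ℓ ℓH, Ruelle.HasLogZeta A D φ (g : G) νG (fun _ => (μG.real Set.univ)⁻¹) σ L ℓ →
          Ruelle.HasLogZeta (A.restrict H) D φ g νH (fun _ => (μH.real Set.univ)⁻¹) σ L ℓH →
          ℓH = (τ.real Set.univ : ℂ) * ℓ ∧
          Complex.exp ℓH = Complex.exp ((τ.real Set.univ : ℂ) * ℓ)) ∧
      -- convergence of the truncations, for arbitrary cutoff functions
      (∀ χ χH : M → ℝ, Ruelle.IsCutoff E μG χ → Ruelle.IsCutoff E μH χH →
        ((∃ ℓ, Ruelle.HasTruncatedLogZeta A D φ (g : G) νG χ σ L ℓ) ↔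
          ∃ ℓ, Ruelle.HasTruncatedLogZeta (A.restrict H) D φ g νH χH σ L ℓ) ∧
        ∀ ℓ ℓH, Ruelle.HasTruncatedLogZeta A D φ (g : G) νG χ σ L ℓ →
          Ruelle.HasTruncatedLogZeta (A.restrict H) D φ g νH χH σ L ℓH →
          ℓH = (τ.real Set.univ : ℂ) * ℓ ∧
          Complex.exp ℓH = Complex.exp ((τ.real Set.univ : ℂ) * ℓ))) := by

  open Ruelle in
  have hMl : LocallyCompactSpace M := Manifold.locallyCompact_of_finiteDimensional 𝓘(ℝ, E)
  have hcoG : ∃ K : Set M, IsCompact K ∧ ∀ m, ∃ x : G, ∃ k ∈ K, m = x • k :=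
    exists_isCompact_smul_eq
  have hcoH : ∃ K : Set M, IsCompact K ∧ ∀ m, ∃ x : H, ∃ k ∈ K, m = x • k :=
    exists_isCompact_subgroup_smul_eq hcoG
  have hHl : LocallyCompactSpace H := hH.isClosedEmbedding_subtypeVal.locallyCompactSpace
  have hHp : ProperSMul H M := properSMul_of_isClosedEmbedding H.subtype
    hH.isClosedEmbedding_subtypeVal fun _ _ => rfl
  have hL0 : ∀ l ∈ lengthSpectrum φ (g : G), l ≠ 0 := fun l hl => hl.1
  constructor
  · intro χ χH hχ hχH σ
    -- An orbit map, and hence a point of `M`, is needed for σ-compactness of `G`. If `M` is empty,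
    -- all sums are empty.
    rcases isEmpty_or_nonempty M with hM | hM
    · have h1 : IsEmpty (lengthSpectrum φ (g : G)) := ⟨fun l => hM.false l.2.2.choose⟩
      have h2 : IsEmpty (lengthSpectrum φ g) := ⟨fun l => hM.false l.2.2.choose⟩
      simp [AbsConverges, zeta, logZeta]
    · have : SigmaCompactSpace G := sigmaCompactSpace_of_properSMul (M := M)
      obtain ⟨C, hC⟩ := exists_isBoundedCutoff hcoG hχ.contMDiff.continuous hχ.hasCompactSupport
        hχ.integral_eq_one
      obtain ⟨CH, hCH⟩ := exists_isBoundedCutoff hcoH hχH.contMDiff.continuous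
        hχH.hasCompactSupport hχH.integral_eq_one
      obtain ⟨h1, h2⟩ := zeta_terms_subgroup hH hφ hsmooth hequiv hflat hinv hnd hL0 hL hμZ hμZH
        hτ hvol hC hCH σ
      refine ⟨h1, fun h => ?_⟩
      obtain ⟨-, -, h3⟩ := h2 (Or.inl h)
      have h4 : logZeta (A.restrict H) D φ g νH χH σ =
          (τ.real Set.univ : ℂ) * logZeta A D φ (g : G) νG χ σ :=
        (congrArg (fun z => (1 / 2 : ℂ) * z) h3).trans (mul_left_comm _ _ _)
      exact ⟨h4, by rw [zeta, h4]⟩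
  · intro hG L hLex σ
    have hMc : CompactSpace M := compactSpace_of_exists hcoG
    have hHc : CompactSpace H := isCompact_iff_compactSpace.1 hH.isCompact
    have hLexH : IsExhaustion φ g L := ⟨hLex.1, hLex.2⟩
    have hτ0 : (τ.real Set.univ : ℂ) ≠ 0 := by
      rw [Complex.ofReal_ne_zero]
      have : LocallyCompactSpace (Subgroup.centralizer ({(g : G)} : Set G)) :=
        (isClosed_centralizer_singleton (g : G)).isClosedEmbedding_subtypeVal.locallyCompactSpace
      exact (measureReal_ne_zero_iff hvol).2 fun h =>
        hτ.ne_zero (Measure.measure_univ_eq_zero.1 h)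
    -- The comparison is applied to one length at a time, where compactness of `M` guarantees
    -- convergence.
    have hterms : ∀ {χ χH : M → ℝ} {C CH : NNReal}, IsBoundedCutoff μG χ C →
        IsBoundedCutoff μH χH CH → ∀ l ∈ lengthSpectrum φ (g : G),
        Integrable (fun c => lengthTerm A D φ χ σ (cosetConj (g : G) c) l) νG ∧
        Integrable (fun c => lengthTerm (A.restrict H) D φ χH σ (cosetConj g c) l) νH ∧
        ∫ c, lengthTerm (A.restrict H) D φ χH σ (cosetConj g c) l ∂νH =
          (τ.real Set.univ : ℂ) * ∫ c, lengthTerm A D φ χ σ (cosetConj (g : G) c) l ∂νG := by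
      intro χ χH C CH hχ hχH l hl
      obtain ⟨-, h⟩ := zeta_terms_subgroup hH (L := {l}) hφ hsmooth hequiv hflat hinv hnd
        (fun l' hl' => hl' ▸ hl.1) (Set.countable_singleton l) hμZ hμZH hτ hvol hχ hχH σ
      have h1 := h (Or.inr ⟨hMc, l, rfl⟩)
      have e1 : (fun c => ∑' l' : ({l} : Set ℝ), lengthTerm A D φ χ σ (cosetConj (g : G) c) l') =
          fun c => lengthTerm A D φ χ σ (cosetConj (g : G) c) l := funext fun c =>
        tsum_singleton l fun l => lengthTerm A D φ χ σ (cosetConj (g : G) c) l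
      have e2 : (fun c => ∑' l' : ({l} : Set ℝ),
            lengthTerm (A.restrict H) D φ χH σ (cosetConj g c) l') =
          fun c => lengthTerm (A.restrict H) D φ χH σ (cosetConj g c) l := funext fun c =>
        tsum_singleton l fun l => lengthTerm (A.restrict H) D φ χH σ (cosetConj g c) l
      rwa [e1, e2] at h1
    let _ : MeasurableSpace M := borel M
    have : BorelSpace M := ⟨rfl⟩
    have hsumG : ∀ (χ : M → ℝ), ∀ l ∈ lengthSpectrum φ (g : G), ∀ c,
        Summable (curveTerm A D φ χ (cosetConj (g : G) c) l) := fun χ l hl c =>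
      summable_curveTerm_of_compactSpace hφ hsmooth hequiv hnd hl.1 χ c
    have hsumH : ∀ (χ : M → ℝ), ∀ l ∈ lengthSpectrum φ g, ∀ c,
        Summable (curveTerm (A.restrict H) D φ χ (cosetConj g c) l) := fun χ l hl c =>
      summable_curveTerm_of_compactSpace (G := H) (A := A.restrict H) (g := g) hφ
        (fun x => hsmooth x) (fun t x m => hequiv t x m) hnd hl.1 χ c
    have hprop : ∀ {χ χH : M → ℝ} {C CH : NNReal}, IsBoundedCutoff μG χ C →
        IsBoundedCutoff μH χH CH → ∀ n,
        ∑ l ∈ L n, ∫ c, lengthTerm (A.restrict H) D φ χH σ (cosetConj g c) l ∂νH =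
          (τ.real Set.univ : ℂ) *
            ∑ l ∈ L n, ∫ c, lengthTerm A D φ χ σ (cosetConj (g : G) c) l ∂νG := by
      intro χ χH C CH hχ hχH n
      rw [Finset.mul_sum]
      exact Finset.sum_congr rfl fun l hl => (hterms hχ hχH l (hLex.mem hl)).2.2
    constructor
    -- A compact group has finite, nonzero volume, so these constants are normalised. Their supports
    -- are compact because `M` is.
    · have hconst : ∀ {K : Type _} [Group K] [TopologicalSpace K] [MeasurableSpace K]
          [CompactSpace K] [MulAction K M] (μ : Measure K) [μ.IsHaarMeasure] (m : M),
          ∫ _x : K, (μ.real Set.univ)⁻¹ ∂μ = 1 := by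
        intro K _ _ _ _ _ μ _ m
        rw [integral_const, smul_eq_mul]
        exact mul_inv_cancel₀ ((measureReal_ne_zero_iff (measure_ne_top μ _)).2
          (NeZero.ne (μ Set.univ)))
      obtain ⟨C, hC⟩ := exists_isBoundedCutoff hcoG (μ := μG)
        (χ := fun _ => (μG.real Set.univ)⁻¹) continuous_const
        (HasCompactSupport.of_compactSpace _) (hconst μG)
      obtain ⟨CH, hCH⟩ := exists_isBoundedCutoff hcoH (μ := μH)
        (χ := fun _ => (μH.real Set.univ)⁻¹) continuous_const
        (HasCompactSupport.of_compactSpace _) (hconst μH)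
      exact exists_tendsto_iff_of_mul hτ0 (hprop hC hCH)
        (hasLogZeta_iff hμZ.ne_zero hLex (hsumG _) fun l hl =>
          exists_lengthTerm_eq hφ hsmooth hequiv hflat hinv hnd _ σ hl.1)
        (hasLogZeta_iff hμZH.ne_zero hLexH (hsumH _) fun l hl =>
          exists_lengthTerm_eq (G := H) (A := A.restrict H) (g := g) hφ (fun x => hsmooth x)
            (fun t x m => hequiv t x m) hflat (fun x => hinv x) hnd _ σ hl.1)
    · intro χ χH hχ hχH
      obtain ⟨C, hC⟩ := exists_isBoundedCutoff hcoG hχ.contMDiff.continuous hχ.hasCompactSupport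
        hχ.integral_eq_one
      obtain ⟨CH, hCH⟩ := exists_isBoundedCutoff hcoH hχH.contMDiff.continuous
        hχH.hasCompactSupport hχH.integral_eq_one
      exact exists_tendsto_iff_of_mul hτ0 (hprop hC hCH)
        (hasTruncatedLogZeta_iff hLex (hsumG χ) fun l hl => (hterms hC hCH l hl).1)
        (hasTruncatedLogZeta_iff hLexH (hsumH χH) fun l hl => (hterms hC hCH l hl).2.1)
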